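/- **Setting.** Let $H_S$ be a Hermitian $\dim_S\times\dim_S$ matrix, $\dim_S\ge 2$, with no degenerate eigenvalues, eigenvalues $\lambda_S(1)<\lambda_S(2)<\cdots$ and eigenvectors $|1\rangle,|2\rangle,\dots$; put $\dim=2\dim_S$, let $\|\cdot\|$ be the spectral norm and $\|\cdot\|_1$ the trace norm, $$\Delta_S(i,j)=\lambda_S(i)-\lambda_S(j),\qquad \delta_{\min}=\min_{\Delta_S(i,j)\ne\Delta_S(k,l)}|\Delta_S(i,j)-\Delta_S(k,l)| .$$ For $\gamma\ge 0$ let $H_E=\mathrm{diag}(0,\gamma)$ on a single qubit, and for $\beta\in[0,\infty]$ let $\rho_E(\beta)=q(0)|0\rangle\langle 0|+q(1)|1\rangle\langle 1|$ with $q(0)=\frac1{1+e^{-\beta\gamma}}$, $q(1)=\frac{e^{-\beta\gamma}}{1+e^{-\beta\gamma}}$ (at $\beta=\infty$: the limits as $\beta\to\infty$). Let $G=UDU^\dagger$ with $U$ Haar distributed on the unitary group of dimension $\dim$ and $D$ diagonal with independent standard normal entries, and for real $\alpha,t$ set $$\Phi_\gamma(\rho)=\mathrm{Tr}_E\,\mathbb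 E_G\big[e^{i(H+\alpha G)t}(\rho\otimes\rho_E(\beta))e^{-i(H+\alpha G)t}\big],\qquad H=H_S\otimes 1+1\otimes H_E .$$ $\mathbb E_\gamma$ denotes the average over $\gamma$ uniform in $[0,4\|H_S\|]$. With $\mathrm{sinc}(x)=\sin(x)/x$, $\mathrm{sinc}(0)=1$ and $\widetilde\alpha=\alpha t/\sqrt{\dim+1}$, the on-resonance map $\mathcal T_{\rm on}^{(\gamma)}$ on operators commuting with $H_S$ is given for $i\ne j$ by $$\langle j|\mathcal T_{\rm on}^{(\gamma)}(|i\rangle\langle i|)|j\rangle=\widetilde\alpha^2\sum_{s=\pm1}q_s\,\mathbf I[|\Delta_S(i,j)-s\gamma|\le\delta_{\min}]\;\mathrm{sinc}^2\Big(\tfrac{(\Delta_S(i,j)-s\gamma)t}{2}\Big),\quad q_{+1}=q(0),\ q_{-1}=q(1),$$ by $\langle i|\mathcal T_{\rm on}^{(\gamma)}(|i\rangle\langle i|)|i\rangle=-\sum_{j\ne i}\langle j|\mathcal T_{\rm on}^{(\gamma)}(|i\rangle\langle i|)|j\rangle$, and by zero off-diagonal entries; $T_\gamma$ is its matrix, $e_j^TT_\gamma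 e_i=\langle j|\mathcal T_{\rm on}^{(\gamma)}(|i\rangle\langle i|)|j\rangle$. Let $\widetilde\lambda_\star(\beta)$ be the spectral gap of the rescaled transition matrix $\mathbb E_\gamma T_\gamma\cdot\frac{2\|H_S\|(\dim+1)}{\alpha^2t}$, i.e. the smallest $-\mathrm{Re}\,\mu$ over its eigenvalues $\mu$, counted with multiplicity, other than one copy of the stationary eigenvalue $0$. (It does not depend on $\alpha>0$, but it does depend on $t$.) **Theorem (Zero Knowledge Thermal State Prep).** For all $\beta\in[0,\infty]$, $\alpha,t>0$, the dynamics $1+\mathbb E_\gamma\mathcal T_{\rm on}^{(\gamma)}$ has a unique fixed point $\rho_{\rm fix}=\rho_{\rm fix}(\beta)$ among the density matrices commuting with $H_S$, and the following hold. 1. For finite $\beta\ge0$ and $\alpha,t\ge 0$ the thermal state $\rho_S(\beta)=e^{-\beta H_S}/\mathrm{Tr}\,e^{-\beta H_S}$ satisfies $$\|\rho_S(\beta)-\mathbb E_\gamma\Phi_\gamma(\rho_S(\beta))\|_1\le \alpha^2te^{\beta\delta_{\min}}\|H_S\|^{-1}\pi+\frac{8\alpha^2}{\delta_{\min}^2}+16\sqrt{\tfrac{\pi}{2}}\,\dim_S(\alpha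 t)^3 .$$ 2. For every $\beta\in[0,\infty]$ and $\epsilon\in(0,2]$ there are $\alpha,t>0$ with $$\alpha=\frac{\delta_{\min}^4\epsilon^3\widetilde\lambda_\star(\beta)^3}{\dim_S^7\|H_S\|^3},\qquad t=\frac{\dim_S^2\|H_S\|}{\epsilon\,\widetilde\lambda_\star(\beta)\,\delta_{\min}^2},$$ where $\widetilde\lambda_\star(\beta)$ is taken at this $t$; and for all such $\alpha,t$ there is a number of interactions $$L\in\widetilde O\Big(\frac{\dim_S^{14}\|H_S\|^6}{\epsilon^5\delta_{\min}^6\widetilde\lambda_\star(\beta)^6}\Big)$$ such that every density matrix $\rho$ commuting with $H_S$ satisfies $\|\rho_{\rm fix}-(\mathbb E_\gamma\Phi_\gamma)^{\circ L}(\rho)\|_1\in\widetilde O(\epsilon)$. The total simulation time is $$L\cdot t\in\widetilde O\Big(\frac{\dim_S^{16}\|H_S\|^7}{\delta_{\min}^8\epsilon^6\widetilde\lambda_\star(\beta)^7}\Big).$$ Here $\widetilde O$ hides universal multiplicative constants and a fixed power of $\log(2+X)$ with $X=\dim_S^{14}\|H_S\|^6/(\epsilon^5\delta_{\min}^6\widetilde\lambda_\star(\beta)^6)$;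 more precisely, with universal constants $C_1,C_2>0$ and $k\in\mathbb N$, one may take $L=\lceil C_1X\log(2+X)^k\rceil$, and then the error is at most $C_2\,\epsilon\log(2+X)^k$, $L\le C_2X\log(2+X)^k$, and $L\cdot t$ is at most $C_2\log(2+X)^k$ times the stated bound. 3. For all fixed $\alpha,t>0$, the ground state is the fixed point at $\beta=\infty$ and $$\lim_{\beta\to\infty}\rho_{\rm fix}(\beta)=|1\rangle\langle1|,\qquad \lim_{\beta\to\infty}\widetilde\lambda_\star(\beta)=\widetilde\lambda_\star(\infty)=2\int_0^{\delta_{\min}t/2}\mathrm{sinc}^2(u)\,du .$$ The last quantity is at least $2.43$ whenever $\delta_{\min}t\ge\pi$, and also whenever $t=\frac{4\dim_S^2\|H_S\|}{\epsilon\,\delta_{\min}^2}$ for some $\epsilon\in(0,2]$. -/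

import Mathlib

open MeasureTheory ProbabilityTheory Filter Topology
open scoped Matrix Kronecker NNReal ENNReal ComplexOrder

namespace ThermalPrep

/-! ### Haar-random interactions -/

theorem isCompact_unitaryGroup {n : Type*} [Fintype n] [DecidableEq n] :
    IsCompact (Matrix.unitaryGroup n ℂ : Set (Matrix n n ℂ)) := by
  have hK : IsCompact (Set.pi Set.univ fun _ : n => Set.pi Set.univ fun _ : n =>
      Metric.closedBall (0 : ℂ) 1) :=
    isCompact_univ_pi fun _ => isCompact_univ_pi fun _ => isCompact_closedBall _ _
  refine IsCompact.of_isClosed_subset hK isClosed_unitary fun U hU => ?_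
  intro i _ j _
  simpa using entry_norm_bound_of_unitary hU i j

instance instCompactSpaceUnitaryGroup {n : Type*} [Fintype n] [DecidableEq n] :
    CompactSpace (Matrix.unitaryGroup n ℂ) :=
  isCompact_iff_compactSpace.mp isCompact_unitaryGroup

noncomputable instance instMeasurableSpaceUnitaryGroup {n : Type*} [Fintype n] [DecidableEq n] :
    MeasurableSpace (Matrix.unitaryGroup n ℂ) := borel _

instance instBorelSpaceUnitaryGroup {n : Type*} [Fintype n] [DecidableEq n] :
    BorelSpace (Matrix.unitaryGroup n ℂ) := ⟨rfl⟩

/-- The Haar measure on the unitary group, normalized to total mass `1`. -/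
noncomputable def haarUnitary (n : Type*) [Fintype n] [DecidableEq n] :
    Measure (Matrix.unitaryGroup n ℂ) :=
  Measure.haarMeasure ⊤

/-- The (entrywise) expectation `𝔼_G F(G)` over the random interaction `G = U D Uᴴ`, where `U` is
Haar distributed and `D` is diagonal with independent standard normal entries. -/
noncomputable def interactionExpectation {n m : Type*} [Fintype n] [DecidableEq n]
    (F : Matrix n n ℂ → Matrix m m ℂ) : Matrix m m ℂ :=
  Matrix.of fun a b => ∫ U : Matrix.unitaryGroup n ℂ, ∫ D : n → ℝ,
    F ((U : Matrix n n ℂ) * Matrix.diagonal (fun k => (D k : ℂ)) * (U : Matrix n n ℂ)ᴴ) a b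
      ∂(Measure.pi fun _ : n => gaussianReal 0 1) ∂(haarUnitary n)

/-! ### Linear-algebra preliminaries -/

/-- Spectral norm of a matrix. -/
noncomputable def specNorm {d : ℕ} (A : Matrix (Fin d) (Fin d) ℂ) : ℝ :=
  ‖Matrix.toEuclideanCLM (n := Fin d) (𝕜 := ℂ) A‖

/-- Trace norm (Schatten 1-norm): the sum of the singular values. -/
noncomputable def traceNorm {n : Type*} [Fintype n] [DecidableEq n] (A : Matrix n n ℂ) : ℝ :=
  ∑ i, √((Matrix.isHermitian_conjTranspose_mul_self A).eigenvalues i)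

/-- Density matrices. -/
def IsState {n : Type*} [Fintype n] (ρ : Matrix n n ℂ) : Prop :=
  ρ.PosSemidef ∧ ρ.trace = 1

/-- Partial trace over the second tensor factor. -/
def partialTraceRight {n m : Type*} [Fintype m] (A : Matrix (n × m) (n × m) ℂ) : Matrix n n ℂ :=
  Matrix.of fun i j => ∑ k, A (i, k) (j, k)

/-- The Gibbs state `e^{-βH} / Tr e^{-βH}` at finite inverse temperature. -/
noncomputable def gibbsState {n : Type*} [Fintype n] [DecidableEq n]
    (H : Matrix n n ℂ) (β : ℝ) : Matrix n n ℂ :=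
  (NormedSpace.exp (-(β : ℂ) • H)).trace⁻¹ • NormedSpace.exp (-(β : ℂ) • H)

/-! ### The single-qubit environment and the thermalizing channel -/

/-- The Boltzmann factor `e^{-βγ}` for `β ∈ [0, ∞]` and `γ ≥ 0`, with value at `β = ∞` the limit
`β → ∞`. -/
noncomputable def boltzmann (β : ℝ≥0∞) (γ : ℝ) : ℝ :=
  if β = ⊤ then (if 0 < γ then 0 else 1) else Real.exp (-β.toReal * γ)

/-- Ground-level population `q(0)` of an environment qubit with energies `0, γ`. -/
noncomputable def q₀ (β : ℝ≥0∞) (γ : ℝ) : ℝ := 1 / (1 + boltzmann β γ)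

/-- Excited-level population `q(1)` of an environment qubit with energies `0, γ`. -/
noncomputable def q₁ (β : ℝ≥0∞) (γ : ℝ) : ℝ := boltzmann β γ / (1 + boltzmann β γ)

/-- Environment Hamiltonian `diag(0, γ)`. -/
noncomputable def envHamiltonian (γ : ℝ) : Matrix (Fin 2) (Fin 2) ℂ :=
  Matrix.diagonal ![0, (γ : ℂ)]

/-- Thermal state of the environment, `q(0)|0⟩⟨0| + q(1)|1⟩⟨1|`. -/
noncomputable def envState (β : ℝ≥0∞) (γ : ℝ) : Matrix (Fin 2) (Fin 2) ℂ :=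
  Matrix.diagonal ![(q₀ β γ : ℂ), (q₁ β γ : ℂ)]

/-- `H_S ⊗ 1 + 1 ⊗ H_E`. -/
noncomputable def totalHamiltonian {d : ℕ} (H : Matrix (Fin d) (Fin d) ℂ) (γ : ℝ) :
    Matrix (Fin d × Fin 2) (Fin d × Fin 2) ℂ :=
  H ⊗ₖ (1 : Matrix (Fin 2) (Fin 2) ℂ) + (1 : Matrix (Fin d) (Fin d) ℂ) ⊗ₖ envHamiltonian γ

/-- Joint evolution `e^{i(H+αG)t} (ρ ⊗ ρ_E) e^{-i(H+αG)t}` under a fixed interaction `G`. -/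
noncomputable def jointEvolution {d : ℕ} (H : Matrix (Fin d) (Fin d) ℂ) (β : ℝ≥0∞) (α t γ : ℝ)
    (ρ : Matrix (Fin d) (Fin d) ℂ) (G : Matrix (Fin d × Fin 2) (Fin d × Fin 2) ℂ) :
    Matrix (Fin d × Fin 2) (Fin d × Fin 2) ℂ :=
  NormedSpace.exp ((Complex.I * t) • (totalHamiltonian H γ + (α : ℂ) • G)) *
    (ρ ⊗ₖ envState β γ) *
    NormedSpace.exp (-(Complex.I * t) • (totalHamiltonian H γ + (α : ℂ) • G))

/-- The thermalizing channel `Φ_γ(ρ) = Tr_E 𝔼_G [e^{i(H+αG)t} (ρ ⊗ ρ_E(β)) e^{-i(H+αG)t}]`. -/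
noncomputable def channel {d : ℕ} (H : Matrix (Fin d) (Fin d) ℂ) (β : ℝ≥0∞) (α t γ : ℝ)
    (ρ : Matrix (Fin d) (Fin d) ℂ) : Matrix (Fin d) (Fin d) ℂ :=
  partialTraceRight (interactionExpectation (jointEvolution H β α t γ ρ))

/-- `𝔼_γ Φ_γ`, with `γ` uniformly distributed in `[0, 4‖H_S‖]`. -/
noncomputable def avgChannel {d : ℕ} (H : Matrix (Fin d) (Fin d) ℂ) (β : ℝ≥0∞) (α t : ℝ)
    (ρ : Matrix (Fin d) (Fin d) ℂ) : Matrix (Fin d) (Fin d) ℂ :=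
  Matrix.of fun i j => ⨍ γ in Set.Icc 0 (4 * specNorm H), channel H β α t γ ρ i j

/-! ### The on-resonance Markov chain -/

section System

variable {d : ℕ} {H : Matrix (Fin d) (Fin d) ℂ}

/-- Eigenvalue differences `Δ_S(i,j) = λ_S(i) - λ_S(j)`. -/
noncomputable def gapS (hH : H.IsHermitian) (i j : Fin d) : ℝ :=
  hH.eigenvalues i - hH.eigenvalues j

/-- Smallest distance between two distinct eigenvalue differences. -/
noncomputable def deltaMin (hH : H.IsHermitian) : ℝ :=
  sInf {x | ∃ i j k l, gapS hH i j ≠ gapS hH k l ∧ x = |gapS hH i j - gapS hH k l|}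

/-- The eigenprojector `|i⟩⟨i|` in the eigenbasis of the system Hamiltonian. -/
noncomputable def eigenProj (hH : H.IsHermitian) (i : Fin d) : Matrix (Fin d) (Fin d) ℂ :=
  Matrix.vecMulVec ⇑(hH.eigenvectorBasis i) (star ⇑(hH.eigenvectorBasis i))

/-- `α̃² = α² t² / (dim + 1)`, where `dim = 2 d` is the dimension of system and environment. -/
noncomputable def alphaTildeSq (d : ℕ) (α t : ℝ) : ℝ := (α * t) ^ 2 / (2 * d + 1)

open Classical in
/-- For `i ≠ j`, the on-resonance transition amplitude `⟨j|𝒯_on(|i⟩⟨i|)|j⟩`. -/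
noncomputable def onResonanceRate (hH : H.IsHermitian) (β : ℝ≥0∞) (α t γ : ℝ) (i j : Fin d) : ℝ :=
  alphaTildeSq d α t * q₀ β γ * (if |gapS hH i j - γ| ≤ deltaMin hH then 1 else 0) *
      Real.sinc ((gapS hH i j - γ) * t / 2) ^ 2 +
    alphaTildeSq d α t * q₁ β γ * (if |gapS hH i j + γ| ≤ deltaMin hH then 1 else 0) *
      Real.sinc ((gapS hH i j + γ) * t / 2) ^ 2

/-- The on-resonance transition matrix `T_γ`, with entries `e_jᵀ T_γ e_i = ⟨j|𝒯_on(|i⟩⟨i|)|j⟩`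
(columns sum to zero). -/
noncomputable def transitionMatrix (hH : H.IsHermitian) (β : ℝ≥0∞) (α t γ : ℝ) :
    Matrix (Fin d) (Fin d) ℝ :=
  Matrix.of fun j i =>
    if j = i then -∑ k ∈ Finset.univ.erase i, onResonanceRate hH β α t γ i k
    else onResonanceRate hH β α t γ i j

/-- `𝔼_γ T_γ`, with `γ` uniformly distributed in `[0, 4‖H_S‖]`. -/
noncomputable def avgTransitionMatrix (hH : H.IsHermitian) (β : ℝ≥0∞) (α t : ℝ) :
    Matrix (Fin d) (Fin d) ℝ :=
  Matrix.of fun j i => ⨍ γ in Set.Icc 0 (4 * specNorm H), transitionMatrix hH β α t γ j i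

/-- The averaged on-resonance map `𝔼_γ 𝒯_on` on operators commuting with `H_S` (which are diagonal
in the eigenbasis when `H_S` is non-degenerate). -/
noncomputable def avgOnResonanceMap (hH : H.IsHermitian) (β : ℝ≥0∞) (α t : ℝ)
    (ρ : Matrix (Fin d) (Fin d) ℂ) : Matrix (Fin d) (Fin d) ℂ :=
  ∑ i, ∑ j, ((avgTransitionMatrix hH β α t j i : ℂ) *
    (star ⇑(hH.eigenvectorBasis i) ⬝ᵥ (ρ *ᵥ ⇑(hH.eigenvectorBasis i)))) • eigenProj hH j

/-- `ρ` is a state commuting with `H_S` and fixed by the transition dynamics `1 + 𝔼_γ 𝒯_on`. -/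
def IsFixedState (hH : H.IsHermitian) (β : ℝ≥0∞) (α t : ℝ) (ρ : Matrix (Fin d) (Fin d) ℂ) : Prop :=
  IsState ρ ∧ Commute ρ H ∧ ρ + avgOnResonanceMap hH β α t ρ = ρ

end System

open Classical in
/-- Spectral gap of a generator-type matrix `Q` (`Q = M - 1` up to a positive factor, with `M`
stochastic): the smallest `-Re μ`, where `μ` ranges over the eigenvalues of `Q` (with algebraic
multiplicity) other than one copy of the stationary eigenvalue `0`. -/
noncomputable def spectralGap {n : Type*} [Fintype n] [DecidableEq n] (Q : Matrix n n ℝ) : ℝ :=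
  sInf {x | ∃ μ ∈ (Q.map Complex.ofReal).charpoly.roots.erase 0, x = -μ.re}

/-- `λ̃_⋆(β)`: the spectral gap of the rescaled transition matrix
`𝔼_γ T_γ · 2‖H_S‖(dim + 1) / (α² t)`, where `dim = 2 d`. -/
noncomputable def rescaledGap {d : ℕ} {H : Matrix (Fin d) (Fin d) ℂ} (hH : H.IsHermitian)
    (β : ℝ≥0∞) (α t : ℝ) : ℝ :=
  spectralGap ((2 * specNorm H * (2 * d + 1) / (α ^ 2 * t)) • avgTransitionMatrix hH β α t)

/-- The scale `dim_S¹⁴ ‖H_S‖⁶ / (ε⁵ δ_min⁶ λ⁶)` of the number of interactions. -/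
noncomputable def stepScale {d : ℕ} {H : Matrix (Fin d) (Fin d) ℂ} (hH : H.IsHermitian)
    (ε lam : ℝ) : ℝ :=
  d ^ 14 * specNorm H ^ 6 / (ε ^ 5 * deltaMin hH ^ 6 * lam ^ 6)

/-- The scale `dim_S¹⁶ ‖H_S‖⁷ / (δ_min⁸ ε⁶ λ⁷)` of the total simulation time. -/
noncomputable def timeScale {d : ℕ} {H : Matrix (Fin d) (Fin d) ℂ} (hH : H.IsHermitian)
    (ε lam : ℝ) : ℝ :=
  d ^ 16 * specNorm H ^ 7 / (deltaMin hH ^ 8 * ε ^ 6 * lam ^ 7)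

/-- The polylogarithmic factor `log(2 + x)^k` used to express the soft-O notation. -/
noncomputable def polylog (k : ℕ) (x : ℝ) : ℝ := Real.log (2 + x) ^ k

/-- The number of interactions `L = ⌈C X log(2 + X)^k⌉` with `X` the step scale. -/
noncomputable def numSteps {d : ℕ} {H : Matrix (Fin d) (Fin d) ℂ} (hH : H.IsHermitian)
    (C : ℝ) (k : ℕ) (ε lam : ℝ) : ℕ :=
  ⌈C * stepScale hH ε lam * polylog k (stepScale hH ε lam)⌉₊

/-- The parameter settings `α = δ_min⁴ ε³ λ̃³ / (dim_S⁷ ‖H_S‖³)` and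
`t = dim_S² ‖H_S‖ / (ε λ̃ δ_min²)`, where `λ̃ = λ̃_⋆(β)` is the gap at these `α, t`. -/
def IsParameterSetting {d : ℕ} {H : Matrix (Fin d) (Fin d) ℂ} (hH : H.IsHermitian)
    (β : ℝ≥0∞) (ε α t : ℝ) : Prop :=
  0 < α ∧ 0 < t ∧
    α = deltaMin hH ^ 4 * ε ^ 3 * rescaledGap hH β α t ^ 3 / (d ^ 7 * specNorm H ^ 3) ∧
    t = d ^ 2 * specNorm H / (ε * rescaledGap hH β α t * deltaMin hH ^ 2)

end ThermalPrep

open ThermalPrep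

/-!
The random interaction `G = U D Uᴴ` has a law that is invariant under conjugation by unitaries.
Conjugating by unitaries that fix the eigenvectors of `H` shows that the averaged channel maps
matrices diagonal in the eigenbasis of `H_S` to such matrices, so that on states commuting with
`H_S` it acts as a stochastic matrix on populations (`channel_eigDiag`, `avgChannel_eigDiag`). All
trace norms then become `ℓ¹` norms (`traceNorm_eigDiag`).

*From the channel to a Markov chain.* In the interaction picture the evolution is
`1 + F + O((αt‖G‖)²)` with `F` of first order in `α`, and off the diagonal the squared amplitudes
agree with those of `F` up to third order (`sum_abs_transitionProb_sub_le`). The off-diagonal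
entries of `G` have second moment `1 / (dim + 1)` (`integral_normSq_interaction`), by the fourth moments of a Haar
unitary, which invariance under a few reflections determines; the error is controlled by the third
absolute moments of the normal eigenvalues. The second-order rates that are detuned by more than
`δ_min` are small because `sinc² x ≤ 1 / x²`. Hence one interaction is a step of `1 + 𝔼_γ T_γ`, up
to `channelError` (`sum_abs_channel_step_sub_le`).

*The Markov chain.* Write `r = 2 ∫ sinc²` over `[0, δ_min t / 2]` and `κ = α² t / (2‖H_S‖(dim + 1))`.
As `q(0) + q(1) = 1`, the rates between any two levels sum to `κ r` (`avgRate_add_avgRate`), and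
downward transitions carry at least half of this (`half_le_avgRate`). Every excited level thus jumps
to the ground state at rate at least `κ r / 2`. This Doeblin condition gives the unique fixed point
and the bound `r / 2` on the rescaled gap from below (`IsGenerator.le_spectralGap`); the trace of the
generator bounds the gap by `d r / 2` from above (`spectralGap_mul_le_neg_trace`). The equation for
`t` is therefore solvable by the intermediate value theorem (`exists_isParameterSetting`), the gap
being continuous (`tendsto_spectralGap`). With these parameters and small `ε` the Doeblin constant of a step is at
least `1 / (5X)`, while `channelError` is `O(ε / X)`: iterating the channel converges
exponentially in `L / X` to the fixed point, up to `O(ε)` (`sum_abs_iterate_sub_le`).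

*Thermal states.* At resonance, detailed balance holds up to a factor `e^{βδ_min}`, so that Gibbs
states are nearly stationary (`abs_gibbsPop_flow_le`).

*Zero temperature.* At `β = ∞` there are no upward transitions: the ground state is stationary, the
Doeblin bound improves to `r`, and the first excited state decays only to the ground state, which
makes `-r` an eigenvalue (`rescaledGap_top`). The limits `β → ∞` follow by dominated convergence and
the continuity of the roots of the characteristic polynomial.
-/

namespace ThermalPrep

/-! ### Stochastic matrices and generators -/

section Markov

variable {n : Type*} [Fintype n]

theorem sum_mulVec_of_colSum {K : Matrix n n ℝ} {a : ℝ}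
    (hsum : ∀ j, ∑ i, K i j = a) (v : n → ℝ) :
    ∑ i, (K *ᵥ v) i = a * ∑ i, v i := by
  simp only [Matrix.mulVec, dotProduct]
  rw [Finset.sum_comm, Finset.mul_sum]
  simp_rw [← Finset.sum_mul, hsum]

variable [DecidableEq n]

/-- Doeblin's contraction estimate. Subtracting `c` from every entry of row `g` does not change the
action on vectors of total mass zero, and leaves a nonnegative matrix with column sums `1 - c`. -/
theorem sum_abs_mulVec_le_of_minorized {K : Matrix n n ℝ} {c : ℝ} (g : n)
    (hK : ∀ i j, 0 ≤ K i j) (hsum : ∀ j, ∑ i, K i j = 1) (hg : ∀ j, c ≤ K g j)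
    {v : n → ℝ} (hv : ∑ i, v i = 0) :
    ∑ i, |(K *ᵥ v) i| ≤ (1 - c) * ∑ i, |v i| := by
  set K' : Matrix n n ℝ := fun i j => K i j - if i = g then c else 0 with hK'
  have h0 : ∀ i j, 0 ≤ K' i j := by
    intro i j
    by_cases h : i = g
    · simpa [hK', h] using hg j
    · simpa [hK', h] using hK i j
  have h1 : ∀ i, (K *ᵥ v) i = ∑ j, K' i j * v j := by
    intro i
    simp only [hK', sub_mul, Finset.sum_sub_distrib, ← Finset.mul_sum, hv, mul_zero, sub_zero]
    rfl
  calc ∑ i, |(K *ᵥ v) i| ≤ ∑ i, ∑ j, K' i j * |v j| := by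
        refine Finset.sum_le_sum fun i _ => ?_
        rw [h1]
        refine (Finset.abs_sum_le_sum_abs _ _).trans (le_of_eq ?_)
        exact Finset.sum_congr rfl fun j _ => by rw [abs_mul, abs_of_nonneg (h0 i j)]
    _ = ∑ j, (∑ i, K' i j) * |v j| := by
        rw [Finset.sum_comm]; simp_rw [Finset.sum_mul]
    _ = (1 - c) * ∑ i, |v i| := by
        rw [Finset.mul_sum]
        refine Finset.sum_congr rfl fun j _ => ?_
        simp [hK', Finset.sum_sub_distrib, hsum]

/-- Generators of continuous-time Markov chains acting on column vectors: the off-diagonal entries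
are nonnegative and the columns sum to zero. -/
structure IsGenerator (Q : Matrix n n ℝ) : Prop where
  nonneg : ∀ i j, i ≠ j → 0 ≤ Q i j
  colSum : ∀ j, ∑ i, Q i j = 0

/-- A small multiple of a generator, added to the identity, is a stochastic matrix; a lower bound
on the rates into `g` carries over. -/
theorem IsGenerator.exists_stochastic {Q : Matrix n n ℝ} (hQ : IsGenerator Q) {g : n} {c : ℝ}
    (hc : 0 < c) (hg : ∀ j, j ≠ g → c ≤ Q g j) :
    ∃ s > 0, (∀ i j, 0 ≤ (1 + s • Q) i j) ∧ (∀ j, ∑ i, (1 + s • Q) i j = 1) ∧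
      ∀ j, s * c ≤ (1 + s • Q) g j := by
  -- With `s = 1 / (2M)`, the step changes each diagonal entry, and moves into `g`, at most `1/2`.
  set M : ℝ := ∑ i, |Q i i| + c with hM
  have hMpos : 0 < M := by
    have : 0 ≤ ∑ i, |Q i i| := Finset.sum_nonneg fun _ _ => abs_nonneg _
    linarith
  have hs : ∀ i, -(1 / 2) ≤ (2 * M)⁻¹ * Q i i := by
    intro i
    have h1 : |Q i i| ≤ M := by
      have : |Q i i| ≤ ∑ i, |Q i i| := Finset.single_le_sum (f := fun i => |Q i i|)
        (fun _ _ => abs_nonneg _) (Finset.mem_univ i)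
      linarith
    have h2 : -M ≤ Q i i := (abs_le.mp h1).1
    have h3 : (2 * M)⁻¹ * (-M) ≤ (2 * M)⁻¹ * Q i i := by gcongr
    have h4 : (2 * M)⁻¹ * (-M) = -(1 / 2) := by field_simp
    linarith
  have hsc : (2 * M)⁻¹ * c ≤ 1 / 2 := by
    have : c ≤ M := by
      have : 0 ≤ ∑ i, |Q i i| := Finset.sum_nonneg fun _ _ => abs_nonneg _
      linarith
    calc (2 * M)⁻¹ * c ≤ (2 * M)⁻¹ * M := by gcongr
      _ = 1 / 2 := by field_simp
  refine ⟨(2 * M)⁻¹, by positivity, fun i j => ?_, fun j => ?_, fun j => ?_⟩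
  · rcases eq_or_ne i j with rfl | h
    · have := hs i
      simp only [Matrix.add_apply, Matrix.one_apply_eq, Matrix.smul_apply, smul_eq_mul]
      linarith
    · simp only [Matrix.add_apply, Matrix.one_apply_ne h, Matrix.smul_apply, smul_eq_mul, zero_add]
      exact mul_nonneg (by positivity) (hQ.nonneg i j h)
  · simp [Finset.sum_add_distrib, Matrix.one_apply, ← Finset.mul_sum, hQ.colSum]
  · rcases eq_or_ne j g with rfl | h
    · have := hs j
      simp only [Matrix.add_apply, Matrix.one_apply_eq, Matrix.smul_apply, smul_eq_mul]
      linarith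
    · simp only [Matrix.add_apply, Matrix.one_apply_ne h.symm, Matrix.smul_apply, smul_eq_mul,
        zero_add]
      exact mul_le_mul_of_nonneg_left (hg j h) (by positivity)

theorem one_add_smul_mulVec (Q : Matrix n n ℝ) (s : ℝ) (v : n → ℝ) :
    (1 + s • Q) *ᵥ v = v + s • (Q *ᵥ v) := by
  rw [Matrix.add_mulVec, Matrix.one_mulVec, Matrix.smul_mulVec]

/-- Stationary vectors are determined by their total mass, as a difference of two such vectors is
strictly contracted unless it vanishes. -/
theorem IsGenerator.eq_zero_of_mulVec_eq_zero {Q : Matrix n n ℝ} (hQ : IsGenerator Q) {g : n}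
    {c : ℝ} (hc : 0 < c) (hg : ∀ j, j ≠ g → c ≤ Q g j) {v : n → ℝ} (hv : ∑ i, v i = 0)
    (hQv : Q *ᵥ v = 0) : v = 0 := by
  obtain ⟨s, hs, h0, h1, h2⟩ := hQ.exists_stochastic hc hg
  have := sum_abs_mulVec_le_of_minorized g h0 h1 h2 hv
  rw [one_add_smul_mulVec, hQv, smul_zero, add_zero] at this
  have h3 : 0 ≤ ∑ i, |v i| := Finset.sum_nonneg fun _ _ => abs_nonneg _
  have h4 : ∑ i, |v i| = 0 := by nlinarith [mul_pos hs hc]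
  rw [Finset.sum_eq_zero_iff_of_nonneg fun _ _ => abs_nonneg _] at h4
  funext i
  simpa using h4 i (Finset.mem_univ i)

/-- If `Q v = 0`, then `|v|` is dominated entrywise by its image under a stochastic matrix
`1 + s Q`, which has the same total mass, so that `Q |v| = 0` as well. -/
theorem IsGenerator.exists_stationary {Q : Matrix n n ℝ} (hQ : IsGenerator Q) {g : n} {c : ℝ}
    (hc : 0 < c) (hg : ∀ j, j ≠ g → c ≤ Q g j) :
    ∃ p : n → ℝ, (∀ i, 0 ≤ p i) ∧ ∑ i, p i = 1 ∧ Q *ᵥ p = 0 := by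
  -- The row vector `1ᵀ` lies in the left kernel.
  have hdet : Q.det = 0 := by
    refine Matrix.exists_vecMul_eq_zero_iff.mp ⟨fun _ => 1, ?_, ?_⟩
    · intro h
      simpa using congrFun h g
    · funext j
      simpa [Matrix.vecMul, dotProduct] using hQ.colSum j
  obtain ⟨v, hv0, hv⟩ := Matrix.exists_mulVec_eq_zero_iff.mpr hdet
  obtain ⟨s, hs, h0, h1, -⟩ := hQ.exists_stochastic hc hg
  have hle : ∀ i ∈ Finset.univ, |v i| ≤ ((1 + s • Q) *ᵥ fun i => |v i|) i := by
    intro i _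
    have h2 : v i = ((1 + s • Q) *ᵥ v) i := by
      rw [one_add_smul_mulVec, hv, smul_zero, add_zero]
    rw [h2]
    refine (Finset.abs_sum_le_sum_abs _ _).trans (le_of_eq ?_)
    exact Finset.sum_congr rfl fun j _ => by
      rw [abs_mul, abs_of_nonneg (h0 i j)]
  have heq := (Finset.sum_eq_sum_iff_of_le hle).mp
    (by rw [sum_mulVec_of_colSum h1, one_mul])
  have hQabs : Q *ᵥ (fun i => |v i|) = 0 := by
    funext i
    have h3 := heq i (Finset.mem_univ i)
    rw [one_add_smul_mulVec] at h3
    have h4 : s * (Q *ᵥ fun i => |v i|) i = 0 := by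
      simpa using h3
    simpa [hs.ne'] using h4
  have hpos : 0 < ∑ i, |v i| := by
    refine lt_of_le_of_ne (Finset.sum_nonneg fun _ _ => abs_nonneg _) fun h => hv0 ?_
    have h4 := h.symm
    rw [Finset.sum_eq_zero_iff_of_nonneg fun _ _ => abs_nonneg _] at h4
    funext i
    simpa using h4 i (Finset.mem_univ i)
  refine ⟨(∑ i, |v i|)⁻¹ • fun i => |v i|, fun i => ?_, ?_, ?_⟩
  · exact mul_nonneg (inv_nonneg.mpr hpos.le) (abs_nonneg _)
  · simp only [Pi.smul_apply, smul_eq_mul, ← Finset.mul_sum]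
    exact inv_mul_cancel₀ hpos.ne'
  · rw [Matrix.mulVec_smul, hQabs, smul_zero]

end Markov

/-! ### The spectral gap of a generator -/

section SpectralGap

/-- The infimum in the definition of the spectral gap is attained. -/
theorem exists_isLeast_neg_re {s : Multiset ℂ} (hs : s ≠ 0) :
    ∃ μ ∈ s, (∀ ν ∈ s, -μ.re ≤ -ν.re) ∧ sInf {x : ℝ | ∃ μ ∈ s, x = -μ.re} = -μ.re := by
  classical
  obtain ⟨μ, hμ, hmin⟩ := s.toFinset.exists_min_image (fun μ => -μ.re)
    (by simpa [Finset.nonempty_iff_ne_empty] using hs)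
  have hmin' : ∀ ν ∈ s, -μ.re ≤ -ν.re := fun ν hν => hmin ν (by simpa using hν)
  refine ⟨μ, by simpa using hμ, hmin', IsLeast.csInf_eq ⟨⟨μ, by simpa using hμ, rfl⟩, ?_⟩⟩
  rintro x ⟨ν, hν, rfl⟩
  exact hmin' ν hν

theorem pow_card_le_prod_of_le {s : Multiset ℝ} {a : ℝ} (ha : 0 ≤ a) (h : ∀ x ∈ s, a ≤ x) :
    a ^ s.card ≤ s.prod := by
  induction s using Multiset.induction with
  | empty => simp
  | cons x s ih =>
    rw [Multiset.card_cons, Multiset.prod_cons, pow_succ']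
    have h1 := ih fun y hy => h y (Multiset.mem_cons_of_mem hy)
    exact mul_le_mul (h x (Multiset.mem_cons_self x s)) h1 (by positivity)
      (ha.trans (h x (Multiset.mem_cons_self x s)))

/-- A monic polynomial that is small at `x` has a root close to `x`. -/
theorem exists_root_norm_sub_lt {p : Polynomial ℂ} (hp : p.Monic) {x : ℂ} {ε : ℝ} (hε : 0 ≤ ε)
    (h : ‖p.eval x‖ < ε ^ p.natDegree) : ∃ μ ∈ p.roots, ‖x - μ‖ < ε := by
  by_contra! hcon
  refine absurd h (not_lt.mpr ?_)
  rw [(IsAlgClosed.splits p).eval_eq_prod_roots_of_monic hp]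
  have h1 : ‖(p.roots.map fun μ => x - μ).prod‖ = (p.roots.map fun μ => ‖x - μ‖).prod := by
    have := map_multiset_prod (normHom : ℂ →*₀ ℝ) (p.roots.map fun μ => x - μ)
    rw [Multiset.map_map] at this
    exact this
  have h2 := pow_card_le_prod_of_le (s := p.roots.map fun μ => ‖x - μ‖) hε (by
    intro y hy
    obtain ⟨μ, hμ, rfl⟩ := Multiset.mem_map.mp hy
    exact hcon μ hμ)
  rw [Multiset.card_map, IsAlgClosed.card_roots_eq_natDegree] at h2
  rwa [h1]

/-- Continuity of the roots of a monic polynomial in its coefficients, in terms of the root of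
largest real part. -/
theorem tendsto_sInf_neg_re_roots {ι : Type*} {l : Filter ι} {F : ι → Polynomial ℂ}
    {p : Polynomial ℂ} {m : ℕ} (hm : m ≠ 0) (hF : ∀ i, (F i).Monic)
    (hFd : ∀ i, (F i).natDegree = m) (hp : p.Monic) (hpd : p.natDegree = m)
    (h : ∀ k, Tendsto (fun i => (F i).coeff k) l (𝓝 (p.coeff k))) :
    Tendsto (fun i => sInf {x : ℝ | ∃ μ ∈ (F i).roots, x = -μ.re}) l
      (𝓝 (sInf {x : ℝ | ∃ μ ∈ p.roots, x = -μ.re})) := by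
  have hroots : ∀ q : Polynomial ℂ, q.natDegree = m → q.roots ≠ 0 := by
    intro q hq h0
    have := IsAlgClosed.card_roots_eq_natDegree (p := q)
    rw [h0, hq] at this
    exact hm (by simpa using this.symm)
  set S : Polynomial ℂ → ℝ := fun q => ∑ k ∈ Finset.range m, ‖q.coeff k‖ with hS
  have hbound : ∀ q : Polynomial ℂ, q.Monic → q.natDegree = m → ∀ μ ∈ q.roots, ‖μ‖ ≤ S q + 1 := by
    intro q hq hqd μ hμ
    have h1 := (Polynomial.isRoot_of_mem_roots hμ).norm_lt_cauchyBound hq.ne_zero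
    have h2 : (q.cauchyBound : ℝ) ≤ S q + 1 := by
      rw [Polynomial.cauchyBound, hq.leadingCoeff, hqd]
      have : (Finset.range m).sup (fun k => ‖q.coeff k‖₊) ≤ ∑ k ∈ Finset.range m, ‖q.coeff k‖₊ :=
        Finset.sup_le fun k hk => Finset.single_le_sum (f := fun k => ‖q.coeff k‖₊)
          (fun _ _ => zero_le) hk
      have h3 : (((Finset.range m).sup (fun k => ‖q.coeff k‖₊) : ℝ≥0) : ℝ) ≤ S q := by
        exact (NNReal.coe_le_coe.mpr this).trans (by simp [hS])
      simpa using h3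
    have h4 : ‖μ‖ < (q.cauchyBound : ℝ) := by exact_mod_cast h1
    linarith
  -- Eventually all roots of `F i` and `p` lie in the disc of radius `R`, by Cauchy's bound, and
  -- `D i` bounds `F i - p` on that disc.
  set R : ℝ := S p + 2 with hR
  have hSnn : 0 ≤ S p := Finset.sum_nonneg fun _ _ => norm_nonneg _
  have hStend : Tendsto (fun i => S (F i)) l (𝓝 (S p)) :=
    tendsto_finsetSum _ fun k _ => (h k).norm
  set D : ι → ℝ := fun i => ∑ k ∈ Finset.range (m + 1), ‖(F i).coeff k - p.coeff k‖ * R ^ k with hD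
  have hDtend : Tendsto D l (𝓝 0) := by
    have : Tendsto D l (𝓝 (∑ k ∈ Finset.range (m + 1), 0 * R ^ k)) :=
      tendsto_finsetSum _ fun k _ => Tendsto.mul_const _ <| by
        have := ((h k).sub_const (p.coeff k)).norm
        simpa using this
    simpa using this
  have heval : ∀ i (x : ℂ), ‖x‖ ≤ R → ‖(F i).eval x - p.eval x‖ ≤ D i := by
    intro i x hx
    rw [Polynomial.eval_eq_sum_range, Polynomial.eval_eq_sum_range, hFd, hpd,
      ← Finset.sum_sub_distrib]
    refine (norm_sum_le _ _).trans (Finset.sum_le_sum fun k _ => ?_)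
    rw [← sub_mul, norm_mul, norm_pow]
    gcongr
  rw [Metric.tendsto_nhds]
  intro ε hε
  have hε2 : 0 < ε / 2 := by positivity
  filter_upwards [hDtend.eventually_lt_const (show 0 < (ε / 2) ^ m by positivity),
    hStend.eventually_lt_const (show S p < S p + 1 by linarith)] with i hi1 hi2
  obtain ⟨μ, hμ, hμmin, hμeq⟩ := exists_isLeast_neg_re (hroots _ (hFd i))
  obtain ⟨ν, hν, hνmin, hνeq⟩ := exists_isLeast_neg_re (hroots _ hpd)
  rw [hμeq, hνeq, Real.dist_eq]
  have hμ0 : (F i).eval μ = 0 := Polynomial.isRoot_of_mem_roots hμ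
  have hν0 : p.eval ν = 0 := Polynomial.isRoot_of_mem_roots hν
  have h1 := heval i μ ((hbound _ (hF i) (hFd i) μ hμ).trans (by linarith))
  have h2 := heval i ν ((hbound _ hp hpd ν hν).trans (by linarith))
  rw [hμ0, zero_sub, norm_neg] at h1
  rw [hν0, sub_zero] at h2
  obtain ⟨ν', hν', hd1⟩ := exists_root_norm_sub_lt hp hε2.le (by rw [hpd]; exact h1.trans_lt hi1)
  obtain ⟨μ', hμ', hd2⟩ := exists_root_norm_sub_lt (hF i) hε2.le
    (by rw [hFd i]; exact h2.trans_lt hi1)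
  have e1 := (Complex.abs_re_le_norm (μ - ν')).trans hd1.le
  have e2 := (Complex.abs_re_le_norm (ν - μ')).trans hd2.le
  rw [Complex.sub_re, abs_le] at e1 e2
  have e3 := hμmin μ' hμ'
  have e4 := hνmin ν' hν'
  rw [abs_lt]
  constructor <;> linarith

variable {n : Type*} [Fintype n] [DecidableEq n]

theorem coeff_zero_charpoly_of_colSum [Nonempty n] {Q : Matrix n n ℝ} (hQ : ∀ j, ∑ i, Q i j = 0) :
    (Q.map Complex.ofReal).charpoly.coeff 0 = 0 := by
  have hdet : (Q.map Complex.ofReal).det = 0 := by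
    refine Matrix.exists_vecMul_eq_zero_iff.mp ⟨fun _ => 1, ?_, ?_⟩
    · intro h
      simpa using congrFun h (Classical.arbitrary n)
    · funext j
      simp only [Matrix.vecMul, dotProduct, one_mul, Matrix.map_apply, Pi.zero_apply]
      exact_mod_cast hQ j
  rw [Polynomial.coeff_zero_eq_eval_zero, Matrix.eval_charpoly, map_zero, zero_sub, Matrix.det_neg,
    hdet, mul_zero]

/-- Removing one copy of the stationary eigenvalue `0` amounts to dividing the characteristic
polynomial by `X`. -/
theorem roots_charpoly_erase_zero [Nonempty n] {Q : Matrix n n ℝ} (hQ : ∀ j, ∑ i, Q i j = 0)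
    [DecidableEq ℂ] :
    (Q.map Complex.ofReal).charpoly.roots.erase 0 = (Q.map Complex.ofReal).charpoly.divX.roots := by
  set p := (Q.map Complex.ofReal).charpoly with hp
  have h1 : p = Polynomial.X * p.divX := by
    have := p.X_mul_divX_add
    rw [coeff_zero_charpoly_of_colSum hQ, Polynomial.C_0, add_zero] at this
    exact this.symm
  have h2 : p ≠ 0 := (Matrix.charpoly_monic _).ne_zero
  have h3 : p.roots = 0 ::ₘ p.divX.roots := by
    conv_lhs => rw [h1]
    rw [Polynomial.roots_mul (h1 ▸ h2), Polynomial.roots_X, Multiset.singleton_add]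
  rw [h3, Multiset.erase_cons_head]

theorem monic_divX_charpoly [Nonempty n] {Q : Matrix n n ℝ} (hQ : ∀ j, ∑ i, Q i j = 0) :
    (Q.map Complex.ofReal).charpoly.divX.Monic := by
  have h1 := (Q.map Complex.ofReal).charpoly.X_mul_divX_add
  rw [coeff_zero_charpoly_of_colSum hQ, Polynomial.C_0, add_zero] at h1
  have h2 := Matrix.charpoly_monic (Q.map Complex.ofReal)
  rw [← h1] at h2
  exact Polynomial.monic_X.of_mul_monic_left h2

theorem natDegree_divX_charpoly (Q : Matrix n n ℝ) :
    (Q.map Complex.ofReal).charpoly.divX.natDegree = Fintype.card n - 1 := by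
  rw [Polynomial.natDegree_divX_eq_natDegree_tsub_one, Matrix.charpoly_natDegree_eq_dim]

theorem spectralGap_eq_sInf [Nonempty n] {Q : Matrix n n ℝ} (hQ : ∀ j, ∑ i, Q i j = 0) :
    spectralGap Q =
      sInf {x : ℝ | ∃ μ ∈ (Q.map Complex.ofReal).charpoly.divX.roots, x = -μ.re} := by
  classical
  rw [← roots_charpoly_erase_zero hQ]
  unfold spectralGap
  congr!

theorem continuous_charpoly_coeff (k : ℕ) :
    Continuous fun Q : Matrix n n ℝ => (Q.map Complex.ofReal).charpoly.coeff k := by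
  have : (fun Q : Matrix n n ℝ => (Q.map Complex.ofReal).charpoly.coeff k) = fun Q =>
      MvPolynomial.eval (fun ij : n × n => ((Q ij.1 ij.2 : ℝ) : ℂ))
        ((Matrix.charpoly.univ ℂ n).coeff k) := by
    funext Q
    exact (Matrix.charpoly.univ_coeff_eval₂Hom n (RingHom.id ℂ)
      (fun ij : n × n => ((Q ij.1 ij.2 : ℝ) : ℂ)) k).symm
  rw [this]
  refine (MvPolynomial.continuous_eval _).comp (continuous_pi fun ij => ?_)
  exact Complex.continuous_ofReal.comp (continuous_id.matrix_elem ij.1 ij.2)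

/-- The spectral gap depends continuously on matrices whose columns sum to zero. -/
theorem tendsto_spectralGap {ι : Type*} {l : Filter ι} {F : ι → Matrix n n ℝ} {Q : Matrix n n ℝ}
    (hn : 2 ≤ Fintype.card n) (hF : ∀ i j, ∑ k, F i k j = 0) (hQ : ∀ j, ∑ k, Q k j = 0)
    (h : Tendsto F l (𝓝 Q)) :
    Tendsto (fun i => spectralGap (F i)) l (𝓝 (spectralGap Q)) := by
  have : Nonempty n := Fintype.card_pos_iff.mp (by omega)
  simp_rw [spectralGap_eq_sInf hQ, fun i => spectralGap_eq_sInf (hF i)]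
  refine tendsto_sInf_neg_re_roots (m := Fintype.card n - 1) (by omega)
    (fun i => monic_divX_charpoly (hF i)) (fun i => natDegree_divX_charpoly _)
    (monic_divX_charpoly hQ) (natDegree_divX_charpoly _) fun k => ?_
  simp_rw [Polynomial.coeff_divX]
  exact ((continuous_charpoly_coeff (k + 1)).tendsto Q).comp h

/-- The smallest `-Re μ` is at most the average one, which is given by the trace. -/
theorem spectralGap_mul_le_neg_trace {Q : Matrix n n ℝ} (hn : 2 ≤ Fintype.card n)
    (hQ : ∀ j, ∑ i, Q i j = 0) :
    spectralGap Q * (Fintype.card n - 1) ≤ -Q.trace := by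
  classical
  have : Nonempty n := Fintype.card_pos_iff.mp (by omega)
  have hcard : (Q.map Complex.ofReal).charpoly.divX.roots.card = Fintype.card n - 1 := by
    rw [IsAlgClosed.card_roots_eq_natDegree, natDegree_divX_charpoly]
  have hne : (Q.map Complex.ofReal).charpoly.divX.roots ≠ 0 := by
    intro h0
    rw [h0, Multiset.card_zero] at hcard
    omega
  have htr := Matrix.trace_eq_sum_roots_charpoly (Q.map Complex.ofReal)
  have h1 : (Q.map Complex.ofReal).charpoly.roots =
      0 ::ₘ (Q.map Complex.ofReal).charpoly.divX.roots := by
    rw [← roots_charpoly_erase_zero hQ, Multiset.cons_erase]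
    rw [Polynomial.mem_roots (Matrix.charpoly_monic _).ne_zero, Polynomial.IsRoot,
      ← Polynomial.coeff_zero_eq_eval_zero, coeff_zero_charpoly_of_colSum hQ]
  rw [h1, Multiset.sum_cons, zero_add] at htr
  obtain ⟨μ, hμ, hmin, heq⟩ := exists_isLeast_neg_re hne
  rw [spectralGap_eq_sInf hQ, heq]
  have h2 : Q.trace = ((Q.map Complex.ofReal).charpoly.divX.roots.map fun ν => ν.re).sum := by
    have h3 : Q.trace = ((Q.map Complex.ofReal).trace).re := by
      simp [Matrix.trace]
    rw [h3, htr]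
    exact map_multiset_sum Complex.reAddGroupHom _
  have h4 := Multiset.sum_le_card_nsmul
    ((Q.map Complex.ofReal).charpoly.divX.roots.map fun ν => ν.re) μ.re (by
      intro x hx
      obtain ⟨ν, hν, rfl⟩ := Multiset.mem_map.mp hx
      linarith [hmin ν hν])
  rw [← h2, Multiset.card_map, hcard, nsmul_eq_mul, Nat.cast_sub (by omega), Nat.cast_one] at h4
  linarith

/-- The Gershgorin discs of the columns of a generator lie in the left half-plane and touch the
imaginary axis at `0`. -/
theorem IsGenerator.re_nonpos_of_isRoot {Q : Matrix n n ℝ} (hQ : IsGenerator Q) {μ : ℂ}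
    (hμ : (Q.map Complex.ofReal).charpoly.IsRoot μ) : μ.re ≤ 0 := by
  have h1 : (Q.map Complex.ofReal)ᵀ.charpoly.IsRoot μ := by
    rwa [Matrix.charpoly_transpose]
  rw [← Matrix.charpoly_toLin', ← Module.End.hasEigenvalue_iff_isRoot_charpoly] at h1
  obtain ⟨k, hk⟩ := eigenvalue_mem_ball h1
  rw [mem_closedBall_iff_norm] at hk
  have h2 : ∑ j ∈ Finset.univ.erase k, ‖(Q.map Complex.ofReal)ᵀ k j‖ = -Q k k := by
    have h3 := hQ.colSum k
    rw [← Finset.add_sum_erase _ _ (Finset.mem_univ k)] at h3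
    have h4 : ∑ j ∈ Finset.univ.erase k, ‖(Q.map Complex.ofReal)ᵀ k j‖ =
        ∑ j ∈ Finset.univ.erase k, Q j k := by
      refine Finset.sum_congr rfl fun j hj => ?_
      rw [Matrix.transpose_apply, Matrix.map_apply, Complex.norm_real, Real.norm_eq_abs,
        abs_of_nonneg (hQ.nonneg j k (Finset.ne_of_mem_erase hj))]
    linarith
  have h5 := (Complex.re_le_norm _).trans hk
  rw [h2] at h5
  simp only [Matrix.transpose_apply, Matrix.map_apply, Complex.sub_re, Complex.ofReal_re] at h5
  linarith

/-- The matrix `Q' = Q + c - c e_g 1ᵀ` has columns summing to zero, and since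
`z - Q = (1 - c (z + c)⁻¹ e_g 1ᵀ) (z + c - Q')`, the characteristic polynomials of `Q` and `Q'`
agree up to the shift by `c` and one root. -/
theorem charpoly_shift {Q Q' : Matrix n n ℂ} {c : ℂ} (g : n)
    (hQ' : ∀ j, ∑ i, Q' i j = 0)
    (h : ∀ i j, Q' i j = Q i j + (if i = j then c else 0) - if i = g then c else 0) :
    (Polynomial.X + Polynomial.C c) * Q.charpoly =
      Polynomial.X * Q'.charpoly.comp (Polynomial.X + Polynomial.C c) := by
  refine Polynomial.eq_of_infinite_eval_eq _ _ ?_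
  refine Set.Infinite.mono (s := {z : ℂ | z + c ≠ 0}) ?_ ?_
  · intro z hz
    have hz' : z + c ≠ 0 := hz
    simp only [Set.mem_ofPred_eq, Polynomial.eval_mul, Polynomial.eval_add, Polynomial.eval_X,
      Polynomial.eval_C, Polynomial.eval_comp, Matrix.eval_charpoly]
    have key : Matrix.scalar n z - Q = (1 + Matrix.replicateCol Unit
        (fun i => if i = g then -(c / (z + c)) else 0) *
        Matrix.replicateRow Unit (fun _ : n => (1 : ℂ))) * (Matrix.scalar n (z + c) - Q') := by
      ext i j
      have e1 : (Matrix.replicateRow Unit (fun _ : n => (1 : ℂ)) *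
          (Matrix.scalar n (z + c) - Q')) () j = z + c := by
        simp [Matrix.mul_apply, Matrix.diagonal_apply, hQ']
      rw [add_mul, one_mul, Matrix.mul_assoc, Matrix.add_apply,
        Matrix.mul_apply (M := Matrix.replicateCol Unit _)]
      simp only [Finset.univ_unique, Finset.sum_singleton]
      erw [e1]
      simp only [Matrix.sub_apply, Matrix.scalar_apply, Matrix.diagonal_apply, h,
        Matrix.replicateCol_apply]
      split_ifs <;> field_simp <;> ring
    rw [key, Matrix.det_mul, Matrix.det_one_add_replicateCol_mul_replicateRow]
    simp only [dotProduct, one_mul, Finset.sum_ite_eq', Finset.mem_univ, if_true]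
    field_simp
    ring
  · have : {z : ℂ | z + c ≠ 0} = {-c}ᶜ := by
      ext z
      simp [add_eq_zero_iff_eq_neg]
    rw [this]
    exact (Set.finite_singleton _).infinite_compl

/-- Doeblin's lower bound for the spectral gap: if every state jumps to `g` with rate at least `c`,
then the spectral gap is at least `c`. -/
theorem IsGenerator.le_spectralGap {Q : Matrix n n ℝ} (hQ : IsGenerator Q) {g : n} {c : ℝ}
    (hc : 0 < c) (hg : ∀ j, j ≠ g → c ≤ Q g j) (hn : 2 ≤ Fintype.card n) :
    c ≤ spectralGap Q := by
  classical
  have : Nonempty n := ⟨g⟩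
  -- `Q'` is again a generator, and the eigenvalues of `Q` other than `0` are eigenvalues of `Q'`
  -- shifted by `-c`.
  set Q' : Matrix n n ℝ := fun i j => Q i j + (if i = j then c else 0) - if i = g then c else 0
    with hQ'
  have hgen : IsGenerator Q' := by
    refine ⟨fun i j hij => ?_, fun j => ?_⟩
    · by_cases h : i = g
      · subst h
        simpa [hQ', hij] using hg j hij.symm
      · simpa [hQ', hij, h] using hQ.nonneg i j hij
    · simp [hQ', Finset.sum_sub_distrib, Finset.sum_add_distrib, hQ.colSum]
  have hshift := charpoly_shift (Q := Q.map Complex.ofReal) (Q' := Q'.map Complex.ofReal)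
    (c := (c : ℂ)) g (fun j => by
      simp only [Matrix.map_apply]
      exact_mod_cast hgen.colSum j) (fun i j => by
      rw [Matrix.map_apply, Matrix.map_apply]
      show ((Q i j + (if i = j then c else 0) - if i = g then c else 0 : ℝ) : ℂ) = _
      split_ifs <;> simp)
  have hne1 : (Q.map Complex.ofReal).charpoly ≠ 0 := (Matrix.charpoly_monic _).ne_zero
  have hne2 : (Q'.map Complex.ofReal).charpoly.comp (Polynomial.X + Polynomial.C (c : ℂ)) ≠ 0 := by
    rw [Ne, Polynomial.comp_X_add_C_eq_zero_iff]
    exact (Matrix.charpoly_monic _).ne_zero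
  have hroots := congrArg Polynomial.roots hshift
  rw [Polynomial.roots_mul (mul_ne_zero (Polynomial.X_add_C_ne_zero _) hne1),
    Polynomial.roots_mul (mul_ne_zero Polynomial.X_ne_zero hne2), Polynomial.roots_X,
    Polynomial.roots_X_add_C] at hroots
  have hcne : (0 : ℂ) ≠ -(c : ℂ) := by
    have : (c : ℂ) ≠ 0 := by exact_mod_cast hc.ne'
    exact (neg_ne_zero.mpr this).symm
  have hers := congrArg (fun s : Multiset ℂ => s.erase 0) hroots
  simp only [Multiset.singleton_add, Multiset.erase_cons_head] at hers
  rw [Multiset.erase_cons_tail _ hcne.symm, roots_charpoly_erase_zero hQ.colSum] at hers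
  have hall : ∀ μ ∈ (Q.map Complex.ofReal).charpoly.divX.roots, c ≤ -μ.re := by
    intro μ hμ
    have h1 : μ ∈ ((Q'.map Complex.ofReal).charpoly.comp
        (Polynomial.X + Polynomial.C (c : ℂ))).roots := by
      rw [← hers]
      exact Multiset.mem_cons_of_mem hμ
    have h2 := Polynomial.isRoot_of_mem_roots h1
    rw [Polynomial.IsRoot, Polynomial.eval_comp] at h2
    have h3 := hgen.re_nonpos_of_isRoot (μ := μ + c) (by simpa [Polynomial.IsRoot] using h2)
    simp only [Complex.add_re, Complex.ofReal_re] at h3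
    linarith
  have hne : (Q.map Complex.ofReal).charpoly.divX.roots ≠ 0 := by
    intro h0
    have hcard := IsAlgClosed.card_roots_eq_natDegree (p := (Q.map Complex.ofReal).charpoly.divX)
    rw [h0, natDegree_divX_charpoly, Multiset.card_zero] at hcard
    omega
  obtain ⟨μ, hμ, -, heq⟩ := exists_isLeast_neg_re hne
  rw [spectralGap_eq_sInf hQ.colSum, heq]
  exact hall μ hμ

/-- A nonzero eigenvalue bounds the spectral gap from above. -/
theorem spectralGap_le_of_mulVec_eq {Q : Matrix n n ℝ} {v : n → ℝ}
    (hv : v ≠ 0) {r : ℝ} (hr : r ≠ 0) (h : Q *ᵥ v = -r • v) : spectralGap Q ≤ r := by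
  classical
  have hroot : (Q.map Complex.ofReal).charpoly.IsRoot ((-r : ℝ) : ℂ) := by
    have h1 : Q.charpoly.IsRoot (-r) := by
      rw [← Matrix.charpoly_toLin', ← Module.End.hasEigenvalue_iff_isRoot_charpoly]
      exact Module.End.hasEigenvalue_of_hasEigenvector
        (x := v) ⟨Module.End.mem_eigenspace_iff.mpr (by simpa using h), hv⟩
    have h2 := h1.map (f := Complex.ofRealHom)
    rwa [← Matrix.charpoly_map] at h2
  have hmem : ((-r : ℝ) : ℂ) ∈ (Q.map Complex.ofReal).charpoly.roots.erase 0 := by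
    rw [Multiset.mem_erase_of_ne (by exact_mod_cast neg_ne_zero.mpr hr),
      Polynomial.mem_roots (Matrix.charpoly_monic _).ne_zero]
    exact hroot
  unfold spectralGap
  have hfin : Set.Finite {x : ℝ | ∃ μ ∈ (Q.map Complex.ofReal).charpoly.roots.erase 0,
      x = -μ.re} := by
    refine (((Q.map Complex.ofReal).charpoly.roots.erase 0).toFinset.image
      (fun μ => -μ.re)).finite_toSet.subset ?_
    rintro x ⟨μ, hμ, rfl⟩
    simp only [Finset.coe_image, Set.mem_image, Finset.mem_coe, Multiset.mem_toFinset]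
    exact ⟨μ, hμ, rfl⟩
  refine csInf_le ?_ ⟨((-r : ℝ) : ℂ), ?_, by simp⟩
  · convert hfin.bddBelow
  · convert hmem

end SpectralGap

/-! ### Haar moments -/

section Haar

theorem integral_add_add {Ω : Type*} [MeasurableSpace Ω] {μ : Measure Ω} {f₁ f₂ f₃ : Ω → ℝ}
    (h₁ : Integrable f₁ μ) (h₂ : Integrable f₂ μ) (h₃ : Integrable f₃ μ) :
    ∫ x, f₁ x + f₂ x + f₃ x ∂μ = ∫ x, f₁ x ∂μ + ∫ x, f₂ x ∂μ + ∫ x, f₃ x ∂μ := by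
  rw [← integral_add h₁ h₂]
  exact integral_add (h₁.add h₂) h₃

theorem integral_add_add_add {Ω : Type*} [MeasurableSpace Ω] {μ : Measure Ω}
    {f₁ f₂ f₃ f₄ : Ω → ℝ} (h₁ : Integrable f₁ μ) (h₂ : Integrable f₂ μ) (h₃ : Integrable f₃ μ)
    (h₄ : Integrable f₄ μ) :
    ∫ x, f₁ x + f₂ x + f₃ x + f₄ x ∂μ =
      ∫ x, f₁ x ∂μ + ∫ x, f₂ x ∂μ + ∫ x, f₃ x ∂μ + ∫ x, f₄ x ∂μ := by
  rw [← integral_add_add h₁ h₂ h₃]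
  exact integral_add ((h₁.add h₂).add h₃) h₄

variable {n : Type*} [Fintype n] [DecidableEq n]

instance isHaarMeasure_haarUnitary : (haarUnitary n).IsHaarMeasure := by
  unfold haarUnitary; infer_instance

instance isProbabilityMeasure_haarUnitary : IsProbabilityMeasure (haarUnitary n) :=
  ⟨by simpa [haarUnitary] using
    Measure.haarMeasure_self (K₀ := (⊤ : TopologicalSpace.PositiveCompacts
      (Matrix.unitaryGroup n ℂ)))⟩

/-- The law of the pair `(U, D)` of a Haar unitary and the independent standard normal
eigenvalues. -/
noncomputable def interactionLaw (n : Type*) [Fintype n] [DecidableEq n] :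
    Measure (Matrix.unitaryGroup n ℂ × (n → ℝ)) :=
  (haarUnitary n).prod (Measure.pi fun _ : n => gaussianReal 0 1)

instance isProbabilityMeasure_interactionLaw : IsProbabilityMeasure (interactionLaw n) := by
  unfold interactionLaw; infer_instance

/-- The interaction `U D Uᴴ` as a function of the pair `(U, D)`. -/
noncomputable def interaction (ω : Matrix.unitaryGroup n ℂ × (n → ℝ)) : Matrix n n ℂ :=
  (ω.1 : Matrix n n ℂ) * Matrix.diagonal (fun k => (ω.2 k : ℂ)) * (ω.1 : Matrix n n ℂ)ᴴ

theorem continuous_interaction : Continuous (interaction (n := n)) := by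
  unfold interaction
  refine Continuous.matrix_mul (Continuous.matrix_mul (by fun_prop) ?_) ?_
  · exact Continuous.matrix_diagonal (by fun_prop)
  · exact Continuous.matrix_conjTranspose (by fun_prop)

theorem isHermitian_interaction (ω : Matrix.unitaryGroup n ℂ × (n → ℝ)) :
    (interaction ω).IsHermitian := by
  unfold interaction
  refine Matrix.isHermitian_mul_mul_conjTranspose _ ?_
  rw [Matrix.isHermitian_diagonal_iff]
  intro i
  simp [IsSelfAdjoint]

theorem interactionExpectation_apply {m : Type*} [Fintype m] [DecidableEq m]
    {F : Matrix n n ℂ → Matrix m m ℂ} (a b : m)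
    (hF : Integrable (fun ω => F (interaction ω) a b) (interactionLaw n)) :
    interactionExpectation F a b = ∫ ω, F (interaction ω) a b ∂interactionLaw n := by
  rw [interactionLaw, integral_prod _ hF]
  rfl

/-- The law of the interaction is invariant under conjugation by unitary matrices. -/
theorem integral_interaction_conj {E : Type*} [NormedAddCommGroup E] [NormedSpace ℝ E]
    (W : Matrix.unitaryGroup n ℂ) (f : Matrix n n ℂ → E) :
    ∫ ω, f ((W : Matrix n n ℂ) * interaction ω * (W : Matrix n n ℂ)ᴴ) ∂interactionLaw n =
      ∫ ω, f (interaction ω) ∂interactionLaw n := by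
  have h1 : MeasurePreserving
      ((MeasurableEquiv.mulLeft W).prodCongr (MeasurableEquiv.refl (n → ℝ)))
      (interactionLaw n) (interactionLaw n) :=
    (measurePreserving_mul_left (haarUnitary n) W).prod (MeasurePreserving.id _)
  rw [← h1.integral_comp' fun ω => f (interaction ω)]
  refine integral_congr_ae (Eventually.of_forall fun ω => ?_)
  simp only [interaction]
  congr 1
  change _ = ((W : Matrix n n ℂ) * (ω.1 : Matrix n n ℂ)) * _ *
    ((W : Matrix n n ℂ) * (ω.1 : Matrix n n ℂ))ᴴ
  rw [Matrix.conjTranspose_mul]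
  simp only [Matrix.mul_assoc]
  rfl

/-- The reflection `1 - 2 v vᴴ` along a unit vector. -/
noncomputable def unitReflection (v : n → ℂ) (hv : star v ⬝ᵥ v = 1) : Matrix.unitaryGroup n ℂ :=
  ⟨1 - (2 : ℂ) • Matrix.vecMulVec v (star v), by
    rw [Matrix.mem_unitaryGroup_iff, Matrix.star_eq_conjTranspose]
    have h1 : (Matrix.vecMulVec v (star v))ᴴ = Matrix.vecMulVec v (star v) := by
      rw [Matrix.conjTranspose_vecMulVec, star_star]
    have h2 : Matrix.vecMulVec v (star v) * Matrix.vecMulVec v (star v) =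
        Matrix.vecMulVec v (star v) := by
      rw [Matrix.vecMulVec_mul_vecMulVec, hv, one_smul]
    rw [Matrix.conjTranspose_sub, Matrix.conjTranspose_smul, h1, Matrix.conjTranspose_one]
    have h3 : star (2 : ℂ) = 2 := by simp
    rw [h3, sub_mul, mul_sub, mul_sub, smul_mul_smul_comm, h2, one_mul, mul_one, one_mul]
    module⟩

theorem unitReflection_mul_apply (v : n → ℂ) (hv : star v ⬝ᵥ v = 1) (U : Matrix n n ℂ) (a k : n) :
    ((unitReflection v hv : Matrix n n ℂ) * U) a k =
      U a k - 2 * v a * ∑ j, star (v j) * U j k := by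
  change ((1 - (2 : ℂ) • Matrix.vecMulVec v (star v)) * U) a k = _
  rw [sub_mul, one_mul, smul_mul_assoc, Matrix.sub_apply, Matrix.smul_apply, Matrix.mul_apply,
    smul_eq_mul, Finset.mul_sum, Finset.mul_sum]
  congr 1
  refine Finset.sum_congr rfl fun j _ => ?_
  rw [Matrix.vecMulVec_apply, Pi.star_apply]
  ring

/-- Averaging over the fourth roots of unity removes the terms that depend on the phases of `x` and
`y`. The coefficients `7/25` and `24/25` come from the reflection along `(3/5, 4/5)`. -/
theorem sum_normSq_phases (x y : ℂ) :
    Complex.normSq ((7 * x - 24 * (1 * y)) / 25) ^ 2 +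
      Complex.normSq ((7 * x - 24 * (-1 * y)) / 25) ^ 2 +
      Complex.normSq ((7 * x - 24 * (Complex.I * y)) / 25) ^ 2 +
      Complex.normSq ((7 * x - 24 * (-Complex.I * y)) / 25) ^ 2 =
    4 * (49 ^ 2 / 25 ^ 4 * Complex.normSq x ^ 2 + 576 ^ 2 / 25 ^ 4 * Complex.normSq y ^ 2 +
      4 * 28224 / 25 ^ 4 * (Complex.normSq x * Complex.normSq y)) := by
  have h : ∀ z : ℂ, Complex.normSq (z / 25) = (z.re * z.re + z.im * z.im) / 625 := by
    intro z
    rw [Complex.normSq_div, Complex.normSq_apply]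
    norm_num
  rw [h, h, h, h, Complex.normSq_apply, Complex.normSq_apply]
  simp only [Complex.sub_re, Complex.sub_im, Complex.mul_re, Complex.mul_im, Complex.neg_re,
    Complex.neg_im, Complex.I_re, Complex.I_im, Complex.one_re, Complex.one_im,
    Complex.re_ofNat, Complex.im_ofNat]
  ring

theorem integrable_haar_of_continuous {E : Type*} [NormedAddCommGroup E]
    {f : Matrix.unitaryGroup n ℂ → E} (hf : Continuous f) : Integrable f (haarUnitary n) :=
  hf.integrable_of_hasCompactSupport (HasCompactSupport.of_compactSpace f)

theorem continuous_normSq_entry (a k : n) :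
    Continuous fun U : Matrix.unitaryGroup n ℂ => Complex.normSq ((U : Matrix n n ℂ) a k) :=
  Complex.continuous_normSq.comp (Continuous.matrix_elem continuous_subtype_val a k)

/-- Invariance of the Haar measure under the four reflections along `3/5 e_a + 4/5 ω e_b`, with `ω`
a fourth root of unity, averages out the phases and relates the fourth moments of a column. -/
theorem haar_fourth_moment_relation {a b : n} (hab : a ≠ b) (k : n) :
    ∫ U : Matrix.unitaryGroup n ℂ, Complex.normSq ((U : Matrix n n ℂ) a k) ^ 2 ∂haarUnitary n =
      49 ^ 2 / 25 ^ 4 *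
        ∫ U : Matrix.unitaryGroup n ℂ, Complex.normSq ((U : Matrix n n ℂ) a k) ^ 2 ∂haarUnitary n +
      576 ^ 2 / 25 ^ 4 *
        ∫ U : Matrix.unitaryGroup n ℂ, Complex.normSq ((U : Matrix n n ℂ) b k) ^ 2 ∂haarUnitary n +
      4 * 28224 / 25 ^ 4 * ∫ U : Matrix.unitaryGroup n ℂ,
        Complex.normSq ((U : Matrix n n ℂ) a k) * Complex.normSq ((U : Matrix n n ℂ) b k)
          ∂haarUnitary n := by
  have hω : ∀ ω : ℂ, ω * star ω = 1 →
      ∫ U : Matrix.unitaryGroup n ℂ, Complex.normSq ((7 * (U : Matrix n n ℂ) a k -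
        24 * (ω * (U : Matrix n n ℂ) b k)) / 25) ^ 2 ∂haarUnitary n =
      ∫ U : Matrix.unitaryGroup n ℂ, Complex.normSq ((U : Matrix n n ℂ) a k) ^ 2
        ∂haarUnitary n := by
    intro ω h
    set v : n → ℂ := fun j => if j = a then 3 / 5 else if j = b then 4 / 5 * star ω else 0 with hv
    have hva : v a = 3 / 5 := by simp [hv]
    have hvb : v b = 4 / 5 * star ω := by simp [hv, hab.symm]
    have hsum : ∀ w : n → ℂ, ∑ j, star (v j) * w j = 3 / 5 * w a + 4 / 5 * ω * w b := by
      intro w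
      rw [Fintype.sum_eq_add a b hab]
      · rw [hva, hvb]; simp
      · rintro j ⟨h1, h2⟩
        simp [hv, h1, h2]
    have hunit : star v ⬝ᵥ v = 1 := by
      have := hsum v
      simp only [dotProduct, Pi.star_apply]
      rw [this, hva, hvb]
      linear_combination (16 / 25) * h
    rw [← integral_mul_left_eq_self (fun U : Matrix.unitaryGroup n ℂ =>
      Complex.normSq ((U : Matrix n n ℂ) a k) ^ 2) (unitReflection v hunit)]
    refine integral_congr_ae (Eventually.of_forall fun U => ?_)
    have hU : ((unitReflection v hunit * U : Matrix.unitaryGroup n ℂ) : Matrix n n ℂ) a k =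
        (7 * (U : Matrix n n ℂ) a k - 24 * (ω * (U : Matrix n n ℂ) b k)) / 25 := by
      rw [Submonoid.coe_mul, unitReflection_mul_apply, hsum, hva]
      ring
    simp only [hU]
  have h1 := hω 1 (by simp)
  have h2 := hω (-1) (by simp)
  have h3 := hω Complex.I (by simp)
  have h4 := hω (-Complex.I) (by simp)
  have hint : ∀ ω : ℂ, Integrable (fun U : Matrix.unitaryGroup n ℂ =>
      Complex.normSq ((7 * (U : Matrix n n ℂ) a k - 24 * (ω * (U : Matrix n n ℂ) b k)) / 25) ^ 2)
      (haarUnitary n) := by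
    intro ω
    refine integrable_haar_of_continuous ((Complex.continuous_normSq.comp ?_).pow 2)
    have ha : Continuous fun U : Matrix.unitaryGroup n ℂ => (U : Matrix n n ℂ) a k :=
      Continuous.matrix_elem continuous_subtype_val a k
    have hb : Continuous fun U : Matrix.unitaryGroup n ℂ => (U : Matrix n n ℂ) b k :=
      Continuous.matrix_elem continuous_subtype_val b k
    exact ((continuous_const.mul ha).sub
      (continuous_const.mul (continuous_const.mul hb))).div_const 25
  have hsum := integral_congr_ae (μ := haarUnitary n) (Eventually.of_forall
    fun U : Matrix.unitaryGroup n ℂ => sum_normSq_phases ((U : Matrix n n ℂ) a k)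
      ((U : Matrix n n ℂ) b k))
  have ia : Integrable (fun U : Matrix.unitaryGroup n ℂ =>
      Complex.normSq ((U : Matrix n n ℂ) a k) ^ 2) (haarUnitary n) :=
    integrable_haar_of_continuous ((continuous_normSq_entry a k).pow 2)
  have ib : Integrable (fun U : Matrix.unitaryGroup n ℂ =>
      Complex.normSq ((U : Matrix n n ℂ) b k) ^ 2) (haarUnitary n) :=
    integrable_haar_of_continuous ((continuous_normSq_entry b k).pow 2)
  have iab : Integrable (fun U : Matrix.unitaryGroup n ℂ =>
      Complex.normSq ((U : Matrix n n ℂ) a k) * Complex.normSq ((U : Matrix n n ℂ) b k))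
      (haarUnitary n) :=
    integrable_haar_of_continuous ((continuous_normSq_entry a k).mul (continuous_normSq_entry b k))
  rw [integral_add_add_add (hint 1) (hint (-1)) (hint Complex.I) (hint (-Complex.I)), h1, h2, h3,
    h4, integral_const_mul, integral_add_add (ia.const_mul _) (ib.const_mul _) (iab.const_mul _),
    integral_const_mul, integral_const_mul, integral_const_mul] at hsum
  linarith

/-- The mixed fourth moment of a column of a Haar unitary. -/
theorem haar_fourth_moment {a b : n} (hab : a ≠ b) (k : n) :
    ∫ U : Matrix.unitaryGroup n ℂ,
        Complex.normSq ((U : Matrix n n ℂ) a k) * Complex.normSq ((U : Matrix n n ℂ) b k)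
          ∂haarUnitary n = 1 / (Fintype.card n * (Fintype.card n + 1)) := by
  set A : n → ℝ := fun a => ∫ U : Matrix.unitaryGroup n ℂ,
    Complex.normSq ((U : Matrix n n ℂ) a k) ^ 2 ∂haarUnitary n with hA
  set B : n → n → ℝ := fun a b => ∫ U : Matrix.unitaryGroup n ℂ,
    Complex.normSq ((U : Matrix n n ℂ) a k) * Complex.normSq ((U : Matrix n n ℂ) b k)
      ∂haarUnitary n with hB
  have hrel : ∀ a b, a ≠ b → A a = 49 ^ 2 / 25 ^ 4 * A a + 576 ^ 2 / 25 ^ 4 * A b +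
      4 * 28224 / 25 ^ 4 * B a b := fun a b h => haar_fourth_moment_relation h k
  have hBsymm : ∀ a b, B a b = B b a := by
    intro a b
    simp only [hB, mul_comm]
  -- Subtracting the relations for `(a, b)` and `(b, a)` gives `A a = A b`; then `B a b = A a / 2`,
  -- and the normalization of the column determines the common value.
  have hAA : ∀ a b, A a = A b := by
    intro a b
    rcases eq_or_ne a b with rfl | h
    · rfl
    · have h1 := hrel a b h
      have h2 := hrel b a h.symm
      rw [hBsymm b a] at h2
      linarith
  have hAB : ∀ a b, a ≠ b → B a b = A a / 2 := by
    intro a b h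
    have h1 := hrel a b h
    rw [hAA b a] at h1
    linarith
  have hBA : ∀ a, B a a = A a := by
    intro a
    simp only [hB, hA, sq]
  have hnorm : ∀ U : Matrix.unitaryGroup n ℂ,
      ∑ a, ∑ b, Complex.normSq ((U : Matrix n n ℂ) a k) * Complex.normSq ((U : Matrix n n ℂ) b k)
        = 1 := by
    intro U
    have h1 : ∑ a, Complex.normSq ((U : Matrix n n ℂ) a k) = 1 := by
      have h2 := congrFun (congrFun (Matrix.mem_unitaryGroup_iff'.mp U.2) k) k
      rw [Matrix.star_eq_conjTranspose, Matrix.mul_apply, Matrix.one_apply_eq] at h2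
      have h3 : ((∑ a, Complex.normSq ((U : Matrix n n ℂ) a k) : ℝ) : ℂ) = 1 := by
        rw [← h2]
        push_cast
        exact Finset.sum_congr rfl fun j _ => by
          rw [Matrix.conjTranspose_apply, Complex.normSq_eq_conj_mul_self]; rfl
      exact_mod_cast h3
    simp_rw [← Finset.mul_sum, h1, mul_one, h1]
  have hsum : ∑ a, ∑ b, B a b = 1 := by
    have hint : ∀ a b : n, Integrable (fun U : Matrix.unitaryGroup n ℂ =>
        Complex.normSq ((U : Matrix n n ℂ) a k) * Complex.normSq ((U : Matrix n n ℂ) b k))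
        (haarUnitary n) := fun a b => integrable_haar_of_continuous
      ((continuous_normSq_entry a k).mul (continuous_normSq_entry b k))
    have h1 : ∀ a, ∑ b, B a b = ∫ U : Matrix.unitaryGroup n ℂ, ∑ b,
        Complex.normSq ((U : Matrix n n ℂ) a k) * Complex.normSq ((U : Matrix n n ℂ) b k)
        ∂haarUnitary n := fun a => (integral_finsetSum _ fun b _ => hint a b).symm
    rw [Finset.sum_congr rfl fun a _ => h1 a,
      ← integral_finsetSum _ fun a _ => integrable_finsetSum _ fun b _ => hint a b,
      integral_congr_ae (Eventually.of_forall hnorm)]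
    simp
  have hval : ∀ i j, B i j = A a / 2 + if i = j then A a / 2 else 0 := by
    intro i j
    split_ifs with h
    · rw [h, hBA, hAA j a]; ring
    · rw [hAB i j h, hAA i a, add_zero]
  simp_rw [hval] at hsum
  simp only [Finset.sum_add_distrib, Finset.sum_const, Finset.card_univ, nsmul_eq_mul,
    Finset.sum_ite_eq, Finset.mem_univ, if_true] at hsum
  change B a b = _
  rw [hAB a b hab]
  have hN : (0 : ℝ) < Fintype.card n := by
    exact_mod_cast Fintype.card_pos_iff.mpr ⟨a⟩
  rw [eq_div_iff (by positivity)]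
  linarith

end Haar

/-! ### Gaussian moments -/

section Gaussian

theorem integral_sq_gaussianReal : ∫ x, x ^ 2 ∂gaussianReal 0 1 = 1 := by
  have h := variance_id_gaussianReal (μ := 0) (v := 1)
  rw [variance_of_integral_eq_zero measurable_id.aemeasurable (by simp)] at h
  simpa using h

theorem integrable_abs_pow_gaussianReal (k : ℕ) :
    Integrable (fun x : ℝ => |x| ^ k) (gaussianReal 0 1) := by
  have h := (memLp_id_gaussianReal (μ := 0) (v := 1) (k : ℝ≥0)).integrable_norm_pow'
  simpa using h

theorem integral_abs_pow_three_gaussianReal :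
    ∫ x, |x| ^ 3 ∂gaussianReal 0 1 ≤ 2 * √(Real.pi / 2) := by
  rw [integral_gaussianReal_eq_integral_smul one_ne_zero]
  have h1 : ∀ x : ℝ, gaussianPDFReal 0 1 x • |x| ^ 3 =
      (fun y : ℝ => (√(2 * Real.pi))⁻¹ * (y ^ (3 : ℝ) * Real.exp (-(1 / 2) * y ^ (2 : ℝ)))) |x| := by
    intro x
    simp only [gaussianPDFReal, smul_eq_mul, NNReal.coe_one, mul_one, sub_zero]
    rw [show ((3 : ℝ)) = ((3 : ℕ) : ℝ) by norm_num, show ((2 : ℝ)) = ((2 : ℕ) : ℝ) by norm_num,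
      Real.rpow_natCast, Real.rpow_natCast, sq_abs]
    push_cast
    rw [show -x ^ 2 / 2 = -(1 / 2) * x ^ 2 by ring]
    ring
  rw [integral_congr_ae (Eventually.of_forall h1), integral_comp_abs (f := fun y : ℝ =>
      (√(2 * Real.pi))⁻¹ * (y ^ (3 : ℝ) * Real.exp (-(1 / 2) * y ^ (2 : ℝ)))), integral_const_mul,
    integral_rpow_mul_exp_neg_mul_rpow (by norm_num) (by norm_num) (by norm_num)]
  have h2 : Real.Gamma ((3 + 1) / 2) = 1 := by
    rw [show ((3 : ℝ) + 1) / 2 = 2 by norm_num, Real.Gamma_two]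
  -- The moment is `4 / √(2π) = 2 / √(π/2)`, and `√(π/2) ≥ 1`.
  have h3 : (1 / 2 : ℝ) ^ (-(3 + 1) / 2 : ℝ) = 4 := by
    rw [show (-(3 + 1) / 2 : ℝ) = -((2 : ℕ) : ℝ) by norm_num, Real.rpow_neg (by norm_num),
      Real.rpow_natCast]
    norm_num
  rw [h2, h3]
  have hpi := Real.pi_gt_three
  have h4 : √(2 * Real.pi) = 2 * √(Real.pi / 2) := by
    rw [show 2 * Real.pi = 2 ^ 2 * (Real.pi / 2) by ring, Real.sqrt_mul (by norm_num),
      Real.sqrt_sq (by norm_num)]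
  rw [h4]
  have h5 : 0 < √(Real.pi / 2) := Real.sqrt_pos.mpr (by positivity)
  have h6 : √(Real.pi / 2) ^ 2 = Real.pi / 2 := Real.sq_sqrt (by positivity)
  rw [mul_inv]
  have h7 : (√(Real.pi / 2))⁻¹ ≤ √(Real.pi / 2) := by
    rw [inv_le_iff_one_le_mul₀ h5, ← sq, h6]
    linarith
  linarith

end Gaussian

/-! ### Moments of the random interaction -/

section SecondMoment

variable {n : Type*} [Fintype n]

theorem integrable_eval_mul_eval (k l : n) :
    Integrable (fun D : n → ℝ => D k * D l) (Measure.pi fun _ : n => gaussianReal 0 1) := by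
  have h : ∀ k : n, MemLp (fun D : n → ℝ => D k) 2 (Measure.pi fun _ : n => gaussianReal 0 1) :=
    fun k => (memLp_id_gaussianReal (μ := 0) (v := 1) 2).comp_measurePreserving
      (measurePreserving_eval (fun _ : n => gaussianReal 0 1) k)
  exact (h k).integrable_mul (h l)

variable [DecidableEq n]

theorem integral_eval_mul_eval (k l : n) :
    ∫ D : n → ℝ, D k * D l ∂(Measure.pi fun _ : n => gaussianReal 0 1) =
      if k = l then 1 else 0 := by
  have h1 : ∀ D : n → ℝ, D k * D l =
      ∏ i, (if i = k then D i else 1) * (if i = l then D i else 1) := by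
    intro D
    rw [Finset.prod_mul_distrib]
    simp
  simp_rw [h1]
  rw [integral_fintype_prod_eq_prod (μ := fun _ : n => gaussianReal 0 1)
    (fun i x => (if i = k then x else 1) * (if i = l then x else 1))]
  split_ifs with h
  · subst h
    refine Finset.prod_eq_one fun i _ => ?_
    by_cases hi : i = k
    · simpa [hi, ← sq] using integral_sq_gaussianReal
    · simp [hi]
  · refine Finset.prod_eq_zero (Finset.mem_univ k) ?_
    simp [h]

/-- The squared modulus of an entry, expanded as a quadratic form in the normal eigenvalues, with
coefficients that depend only on the Haar unitary. -/
theorem normSq_interaction_apply (ω : Matrix.unitaryGroup n ℂ × (n → ℝ)) (a b : n) :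
    Complex.normSq (interaction ω a b) = ∑ k, ∑ l,
      ((ω.1 : Matrix n n ℂ) a k * star ((ω.1 : Matrix n n ℂ) b k) *
        star ((ω.1 : Matrix n n ℂ) a l * star ((ω.1 : Matrix n n ℂ) b l))).re *
        (ω.2 k * ω.2 l) := by
  have h1 : interaction ω a b = ∑ k, (ω.2 k : ℂ) *
      ((ω.1 : Matrix n n ℂ) a k * star ((ω.1 : Matrix n n ℂ) b k)) := by
    rw [interaction, Matrix.mul_apply]
    refine Finset.sum_congr rfl fun k _ => ?_
    rw [Matrix.mul_diagonal, Matrix.conjTranspose_apply]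
    ring
  have h2 : Complex.normSq (interaction ω a b) =
      (interaction ω a b * star (interaction ω a b)).re := by
    rw [Complex.star_def, Complex.mul_conj, Complex.ofReal_re]
  rw [h2, h1, star_sum, Finset.sum_mul_sum, Complex.re_sum]
  refine Finset.sum_congr rfl fun k _ => ?_
  rw [Complex.re_sum]
  refine Finset.sum_congr rfl fun l _ => ?_
  have h3 : ∀ (x y : ℝ) (z w : ℂ), ((x : ℂ) * z * star ((y : ℂ) * w)).re =
      (z * star w).re * (x * y) := by
    intro x y z w
    have : (x : ℂ) * z * star ((y : ℂ) * w) = ((x * y : ℝ) : ℂ) * (z * star w) := by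
      rw [star_mul']
      simp only [Complex.star_def, Complex.conj_ofReal]
      push_cast
      ring
    rw [this, Complex.re_ofReal_mul]
    ring
  exact h3 _ _ _ _

theorem integrable_normSq_interaction (a b : n) :
    Integrable (fun ω => Complex.normSq (interaction ω a b)) (interactionLaw n) := by
  simp_rw [normSq_interaction_apply]
  refine integrable_finsetSum _ fun k _ => integrable_finsetSum _ fun l _ =>
    Integrable.mul_prod (f := fun U : Matrix.unitaryGroup n ℂ =>
      ((U : Matrix n n ℂ) a k * star ((U : Matrix n n ℂ) b k) *
        star ((U : Matrix n n ℂ) a l * star ((U : Matrix n n ℂ) b l))).re)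
      (integrable_haar_of_continuous ?_) (integrable_eval_mul_eval k l)
  have h : ∀ a k, Continuous fun U : Matrix.unitaryGroup n ℂ => (U : Matrix n n ℂ) a k :=
    fun a k => Continuous.matrix_elem continuous_subtype_val a k
  exact Complex.continuous_re.comp
    (((h a k).mul (h b k).star).mul ((h a l).mul (h b l).star).star)

/-- The off-diagonal entries of the interaction have second moment `1 / (dim + 1)`. -/
theorem integral_normSq_interaction {a b : n} (hab : a ≠ b) :
    ∫ ω, Complex.normSq (interaction ω a b) ∂interactionLaw n = 1 / (Fintype.card n + 1) := by
  have h : ∀ a k, Continuous fun U : Matrix.unitaryGroup n ℂ => (U : Matrix n n ℂ) a k :=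
    fun a k => Continuous.matrix_elem continuous_subtype_val a k
  have hcont : ∀ k l, Integrable (fun U : Matrix.unitaryGroup n ℂ =>
      ((U : Matrix n n ℂ) a k * star ((U : Matrix n n ℂ) b k) *
        star ((U : Matrix n n ℂ) a l * star ((U : Matrix n n ℂ) b l))).re) (haarUnitary n) := by
    intro k l
    refine integrable_haar_of_continuous ?_
    exact Complex.continuous_re.comp
      (((h a k).mul (h b k).star).mul ((h a l).mul (h b l).star).star)
  simp_rw [normSq_interaction_apply]
  have hI : ∀ k l, Integrable (fun ω : Matrix.unitaryGroup n ℂ × (n → ℝ) =>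
      ((ω.1 : Matrix n n ℂ) a k * star ((ω.1 : Matrix n n ℂ) b k) *
        star ((ω.1 : Matrix n n ℂ) a l * star ((ω.1 : Matrix n n ℂ) b l))).re *
        (ω.2 k * ω.2 l)) (interactionLaw n) := fun k l =>
    Integrable.mul_prod (hcont k l) (integrable_eval_mul_eval k l)
  rw [integral_finsetSum _ fun k _ => integrable_finsetSum _ fun l _ => hI k l]
  have h1 : ∀ k, ∫ ω : Matrix.unitaryGroup n ℂ × (n → ℝ), ∑ l,
      ((ω.1 : Matrix n n ℂ) a k * star ((ω.1 : Matrix n n ℂ) b k) *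
        star ((ω.1 : Matrix n n ℂ) a l * star ((ω.1 : Matrix n n ℂ) b l))).re *
        (ω.2 k * ω.2 l) ∂interactionLaw n = 1 / (Fintype.card n * (Fintype.card n + 1)) := by
    intro k
    rw [integral_finsetSum _ fun l _ => hI k l]
    -- The eigenvalues are independent and centred, so that only the terms with `k = l` survive.
    have h2 : ∀ l, ∫ ω : Matrix.unitaryGroup n ℂ × (n → ℝ),
        ((ω.1 : Matrix n n ℂ) a k * star ((ω.1 : Matrix n n ℂ) b k) *
        star ((ω.1 : Matrix n n ℂ) a l * star ((ω.1 : Matrix n n ℂ) b l))).re *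
        (ω.2 k * ω.2 l) ∂interactionLaw n = if k = l then
          1 / (Fintype.card n * (Fintype.card n + 1) : ℝ) else 0 := by
      intro l
      rw [interactionLaw, integral_prod_mul (fun U : Matrix.unitaryGroup n ℂ =>
        ((U : Matrix n n ℂ) a k * star ((U : Matrix n n ℂ) b k) *
        star ((U : Matrix n n ℂ) a l * star ((U : Matrix n n ℂ) b l))).re)
        (fun D : n → ℝ => D k * D l), integral_eval_mul_eval]
      split_ifs with hkl
      · subst hkl
        rw [mul_one, ← haar_fourth_moment hab k]
        refine integral_congr_ae (Eventually.of_forall fun U => ?_)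
        simp only [Complex.star_def, Complex.mul_conj, Complex.ofReal_re, Complex.normSq_mul,
          Complex.normSq_conj]
      · rw [mul_zero]
    simp_rw [h2]
    simp
  simp_rw [h1]
  have hN : (0 : ℝ) < Fintype.card n := by
    exact_mod_cast Fintype.card_pos_iff.mpr ⟨a⟩
  rw [Finset.sum_const, Finset.card_univ, nsmul_eq_mul]
  field_simp

open scoped Matrix.Norms.L2Operator in
/-- The operator norm of the interaction is the largest modulus of its normal eigenvalues, and the
maximum is bounded by the sum. -/
theorem norm_interaction_pow_three_le (ω : Matrix.unitaryGroup n ℂ × (n → ℝ)) :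
    ‖interaction ω‖ ^ 3 ≤ ∑ k, |ω.2 k| ^ 3 := by
  have hU : ‖(ω.1 : Matrix n n ℂ)‖ ≤ 1 := by
    cases isEmpty_or_nonempty n
    · have : (ω.1 : Matrix n n ℂ) = 0 := Subsingleton.elim _ _
      simp [this]
    · exact (CStarRing.norm_of_mem_unitary ω.1.2).le
  have hU' : ‖(ω.1 : Matrix n n ℂ)ᴴ‖ ≤ 1 := by
    rwa [Matrix.l2_opNorm_conjTranspose]
  have h1 : ‖interaction ω‖ ≤ ‖fun k => (ω.2 k : ℂ)‖ := by
    unfold interaction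
    refine (norm_mul_le _ _).trans ?_
    refine (mul_le_mul (norm_mul_le _ _) hU' (norm_nonneg _) (by positivity)).trans ?_
    rw [Matrix.l2_opNorm_diagonal, mul_one]
    exact mul_le_of_le_one_left (norm_nonneg _) hU
  refine (pow_le_pow_left₀ (norm_nonneg _) h1 3).trans ?_
  cases isEmpty_or_nonempty n
  · simp [Pi.norm_def]
  · obtain ⟨k, -, hk⟩ := Finset.exists_mem_eq_sup' Finset.univ_nonempty
      fun k => ‖(ω.2 k : ℂ)‖₊
    have hk' : ‖fun k => (ω.2 k : ℂ)‖ = |ω.2 k| := by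
      rw [Pi.norm_def, ← Finset.sup'_eq_sup Finset.univ_nonempty, hk, coe_nnnorm,
        Complex.norm_real, Real.norm_eq_abs]
    rw [hk']
    exact Finset.single_le_sum (f := fun k => |ω.2 k| ^ 3) (fun _ _ => by positivity)
      (Finset.mem_univ k)

theorem integrable_sum_abs_pow_three :
    Integrable (fun ω : Matrix.unitaryGroup n ℂ × (n → ℝ) => ∑ k, |ω.2 k| ^ 3)
      (interactionLaw n) := by
  refine integrable_finsetSum _ fun k _ => ?_
  refine Integrable.comp_snd (f := fun D : n → ℝ => |D k| ^ 3) ?_ _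
  exact (measurePreserving_eval (fun _ : n => gaussianReal 0 1) k).integrable_comp_of_integrable
    (integrable_abs_pow_gaussianReal 3)

theorem integral_sum_abs_pow_three_le :
    ∫ ω : Matrix.unitaryGroup n ℂ × (n → ℝ), ∑ k, |ω.2 k| ^ 3 ∂interactionLaw n ≤
      Fintype.card n * (2 * √(Real.pi / 2)) := by
  have hi : ∀ k : n, Integrable (fun D : n → ℝ => |D k| ^ 3)
      (Measure.pi fun _ : n => gaussianReal 0 1) := fun k =>
    (measurePreserving_eval (fun _ : n => gaussianReal 0 1) k).integrable_comp_of_integrable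
      (integrable_abs_pow_gaussianReal 3)
  have h1 : ∀ k : n, ∫ ω : Matrix.unitaryGroup n ℂ × (n → ℝ), |ω.2 k| ^ 3 ∂interactionLaw n ≤
      2 * √(Real.pi / 2) := by
    intro k
    rw [interactionLaw, integral_fun_snd (f := fun D : n → ℝ => |D k| ^ 3)]
    simp only [probReal_univ, one_smul]
    have h2 := integral_comp_eval (μ := fun _ : n => gaussianReal 0 1) (i := k)
      (f := fun x : ℝ => |x| ^ 3) (integrable_abs_pow_gaussianReal 3).aestronglyMeasurable
    rw [h2]
    exact integral_abs_pow_three_gaussianReal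
  have hi' : ∀ k : n, Integrable (fun ω : Matrix.unitaryGroup n ℂ × (n → ℝ) => |ω.2 k| ^ 3)
      (interactionLaw n) := fun k => Integrable.comp_snd (hi k) _
  rw [integral_finsetSum _ fun k _ => hi' k]
  refine (Finset.sum_le_sum fun k _ => h1 k).trans ?_
  simp

end SecondMoment

/-! ### Time-dependent perturbation theory -/

section Dyson

theorem I_mul_ofReal_smul {n : Type*} (t : ℝ) (A : Matrix n n ℂ) :
    (Complex.I * t) • A = t • (Complex.I • A) := by
  rw [mul_comm, mul_smul, Complex.coe_smul]

theorem isHermitian_diagonal_ofReal {n : Type*} [DecidableEq n] (h : n → ℝ) :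
    (Matrix.diagonal fun k => (h k : ℂ)).IsHermitian := by
  rw [Matrix.isHermitian_diagonal_iff]
  intro i
  simp [IsSelfAdjoint]

theorem isHermitian_diagonal_add_smul {n : Type*} [DecidableEq n] {h : n → ℝ} {G : Matrix n n ℂ}
    {α : ℝ} (hG : G.IsHermitian) :
    ((Matrix.diagonal fun k => (h k : ℂ)) + (α : ℂ) • G).IsHermitian := by
  refine (isHermitian_diagonal_ofReal h).add ?_
  rw [Matrix.IsHermitian, Matrix.conjTranspose_smul, hG.eq]
  simp

theorem smul_I_smul_mem_skewAdjoint {n : Type*} {A : Matrix n n ℂ} (hA : A.IsHermitian)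
    (s : ℝ) : s • (Complex.I • A) ∈ skewAdjoint (Matrix n n ℂ) := by
  rw [skewAdjoint.mem_iff, Matrix.star_eq_conjTranspose, Matrix.conjTranspose_smul,
    Matrix.conjTranspose_smul, hA.eq]
  simp

variable {n : Type*} [Fintype n] [DecidableEq n]

open scoped Matrix.Norms.L2Operator in
theorem exp_I_smul_mem_unitary {A : Matrix n n ℂ} (hA : A.IsHermitian) (s : ℝ) :
    NormedSpace.exp (s • (Complex.I • A)) ∈ unitary (Matrix n n ℂ) :=
  letI : NormedAlgebra ℚ (Matrix n n ℂ) := NormedAlgebra.restrictScalars ℚ ℂ _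
  NormedSpace.exp_mem_unitary_of_mem_skewAdjoint (smul_I_smul_mem_skewAdjoint hA s)

open scoped Matrix.Norms.L2Operator in
theorem l2_opNorm_le_one_of_mem_unitary {U : Matrix n n ℂ} (hU : U ∈ unitary (Matrix n n ℂ)) :
    ‖U‖ ≤ 1 := by
  cases isEmpty_or_nonempty n
  · have : U = 0 := Subsingleton.elim _ _
    simp [this]
  · exact (CStarRing.norm_of_mem_unitary hU).le

/-- The integrated phase `∫₀ˢ e^{iωu} du`. -/
noncomputable def phaseIntegral (ω s : ℝ) : ℂ := ∫ u in (0 : ℝ)..s, Complex.exp (ω * Complex.I * u)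

theorem hasDerivAt_phaseIntegral (ω s : ℝ) :
    HasDerivAt (phaseIntegral ω) (Complex.exp (ω * Complex.I * s)) s := by
  have hc : Continuous fun u : ℝ => Complex.exp (ω * Complex.I * u) := by fun_prop
  exact hc.integral_hasStrictDerivAt 0 s |>.hasDerivAt

/-- The resonance line shape: `|∫₀ˢ e^{iωu} du|² = s² sinc²(ωs/2)`. -/
theorem normSq_phaseIntegral (ω s : ℝ) :
    Complex.normSq (phaseIntegral ω s) = s ^ 2 * Real.sinc (ω * s / 2) ^ 2 := by
  rcases eq_or_ne ω 0 with rfl | hω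
  · simp [phaseIntegral, Complex.normSq_ofReal, sq]
  rcases eq_or_ne s 0 with rfl | hs
  · simp [phaseIntegral]
  have hc : (ω : ℂ) * Complex.I ≠ 0 := by simp [hω]
  rw [phaseIntegral, integral_exp_mul_complex hc, Complex.normSq_eq_norm_sq, norm_div]
  have h1 : Complex.exp (ω * Complex.I * s) - Complex.exp (ω * Complex.I * (0 : ℝ)) =
      Complex.exp (Complex.I * ((ω * s : ℝ) : ℂ)) - 1 := by
    congr 1
    · congr 1; push_cast; ring
    · simp
  rw [h1, Complex.norm_exp_I_mul_ofReal_sub_one, Real.sinc_of_ne_zero (by positivity)]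
  simp only [norm_mul, Complex.norm_real, Complex.norm_I, mul_one, Real.norm_eq_abs,
    Nat.abs_ofNat, div_pow, mul_pow, sq_abs]
  field_simp

open scoped Matrix.Norms.L2Operator

theorem sum_sq_norm_col_le (A : Matrix n n ℂ) (b : n) : ∑ a, ‖A a b‖ ^ 2 ≤ ‖A‖ ^ 2 := by
  have h := Matrix.l2_opNorm_mulVec A (EuclideanSpace.single b (1 : ℂ))
  rw [PiLp.norm_single, norm_one, mul_one] at h
  have h2 := pow_le_pow_left₀ (norm_nonneg _) h 2
  rw [EuclideanSpace.norm_sq_eq] at h2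
  simpa using h2

theorem sum_norm_col_mul_le (A B : Matrix n n ℂ) (b : n) :
    ∑ a, ‖A a b‖ * ‖B a b‖ ≤ ‖A‖ * ‖B‖ := by
  refine (Real.sum_mul_le_sqrt_mul_sqrt _ _ _).trans ?_
  gcongr
  · exact Real.sqrt_le_iff.mpr ⟨norm_nonneg _, sum_sq_norm_col_le A b⟩
  · exact Real.sqrt_le_iff.mpr ⟨norm_nonneg _, sum_sq_norm_col_le B b⟩

/-- The first-order term `i α ∫₀ˢ e^{iuh} G e^{-iuh} du` of the Dyson series. -/
noncomputable def dysonFirst (h : n → ℝ) (G : Matrix n n ℂ) (α s : ℝ) : Matrix n n ℂ :=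
  ∑ a, ∑ b, phaseIntegral (h a - h b) s • Matrix.single a b (Complex.I * α * G a b)

theorem dysonFirst_apply (h : n → ℝ) (G : Matrix n n ℂ) (α s : ℝ) (a b : n) :
    dysonFirst h G α s a b = phaseIntegral (h a - h b) s * (Complex.I * α * G a b) := by
  simp only [dysonFirst, Matrix.sum_apply, Matrix.smul_apply, smul_eq_mul]
  rw [Finset.sum_eq_single a, Finset.sum_eq_single b]
  · simp
  · intro j _ hj
    simp [Matrix.single_apply_of_col_ne _ _ hj]
  · simp
  · intro i _ hi
    exact Finset.sum_eq_zero fun j _ => by simp [Matrix.single_apply_of_row_ne hi]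
  · simp

/-- The free evolution in the energy eigenbasis. -/
noncomputable def freeEvolution (h : n → ℝ) (s : ℝ) : Matrix n n ℂ :=
  NormedSpace.exp (s • (Complex.I • Matrix.diagonal fun k => (h k : ℂ)))

theorem freeEvolution_eq (h : n → ℝ) (s : ℝ) :
    freeEvolution h s = Matrix.diagonal fun k => Complex.exp (h k * Complex.I * s) := by
  rw [freeEvolution, ← Matrix.diagonal_smul, ← Matrix.diagonal_smul, Matrix.exp_diagonal]
  congr 1
  funext k
  rw [Pi.coe_exp, Complex.exp_eq_exp_ℂ]
  congr 1
  simp only [Pi.smul_apply, smul_eq_mul, Complex.real_smul]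
  ring

theorem freeEvolution_mem_unitary (h : n → ℝ) (s : ℝ) :
    freeEvolution h s ∈ unitary (Matrix n n ℂ) :=
  exp_I_smul_mem_unitary (isHermitian_diagonal_ofReal h) s

theorem hasDerivAt_dysonFirst (h : n → ℝ) (G : Matrix n n ℂ) (α s : ℝ) :
    HasDerivAt (dysonFirst h G α)
      (freeEvolution h s * ((Complex.I * α) • G) * freeEvolution h (-s)) s := by
  have h1 : HasDerivAt (dysonFirst h G α) (∑ a, ∑ b, Complex.exp (((h a - h b : ℝ) : ℂ) *
      Complex.I * s) • Matrix.single a b (Complex.I * α * G a b)) s := by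
    unfold dysonFirst
    refine HasDerivAt.fun_sum fun a _ => HasDerivAt.fun_sum fun b _ => ?_
    exact (hasDerivAt_phaseIntegral _ s).smul_const _
  convert h1 using 1
  rw [Matrix.matrix_eq_sum_single (freeEvolution h s * ((Complex.I * α) • G) *
    freeEvolution h (-s))]
  refine Finset.sum_congr rfl fun a _ => Finset.sum_congr rfl fun b _ => ?_
  rw [Matrix.smul_single, freeEvolution_eq, freeEvolution_eq, Matrix.mul_diagonal,
    Matrix.diagonal_mul, Matrix.smul_apply]
  congr 1
  have : Complex.exp (((h a - h b : ℝ) : ℂ) * Complex.I * s) =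
      Complex.exp (h a * Complex.I * s) * Complex.exp (h b * Complex.I * ((-s : ℝ) : ℂ)) := by
    rw [← Complex.exp_add]
    congr 1
    push_cast
    ring
  rw [this]
  simp only [smul_eq_mul]
  ring

/-- The evolution `e^{is(h + αG)} e^{-ish}` in the interaction picture. -/
noncomputable def interactionPicture (h : n → ℝ) (G : Matrix n n ℂ) (α s : ℝ) : Matrix n n ℂ :=
  NormedSpace.exp (s • (Complex.I • ((Matrix.diagonal fun k => (h k : ℂ)) + (α : ℂ) • G))) *
    freeEvolution h (-s)

theorem freeEvolution_neg_mul (h : n → ℝ) (s : ℝ) :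
    freeEvolution h (-s) * freeEvolution h s = 1 := by
  rw [freeEvolution_eq, freeEvolution_eq, Matrix.diagonal_mul_diagonal, ← Matrix.diagonal_one]
  congr 1
  funext k
  rw [← Complex.exp_add]
  simp

/-- The Schrödinger equation in the interaction picture, `V' = V · iα e^{ish} G e^{-ish}`. -/
theorem hasDerivAt_interactionPicture (h : n → ℝ) (G : Matrix n n ℂ) (α s : ℝ) :
    HasDerivAt (interactionPicture h G α)
      (interactionPicture h G α s *
        (freeEvolution h s * ((Complex.I * α) • G) * freeEvolution h (-s))) s := by
  set X : Matrix n n ℂ := Complex.I • ((Matrix.diagonal fun k => (h k : ℂ)) + (α : ℂ) • G) with hX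
  set Y : Matrix n n ℂ := Complex.I • Matrix.diagonal fun k => (h k : ℂ) with hY
  have h1 : HasDerivAt (fun s : ℝ => NormedSpace.exp (s • X)) (NormedSpace.exp (s • X) * X) s :=
    hasDerivAt_exp_smul_const X s
  have h2 : HasDerivAt (fun s : ℝ => freeEvolution h (-s)) (-(Y * freeEvolution h (-s))) s := by
    have h3 : HasDerivAt (fun s : ℝ => NormedSpace.exp (s • Y)) (Y * NormedSpace.exp (-s • Y))
        (-s) := hasDerivAt_exp_smul_const' Y (-s)
    have h4 := h3.scomp s (hasDerivAt_neg s)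
    rw [neg_one_smul] at h4
    exact h4
  have h5 := h1.mul h2
  have h6 : interactionPicture h G α s * (freeEvolution h s * ((Complex.I * α) • G) *
      freeEvolution h (-s)) = NormedSpace.exp (s • X) *
      (freeEvolution h (-s) * freeEvolution h s) * ((Complex.I * α) • G) * freeEvolution h (-s) := by
    simp only [interactionPicture, Matrix.mul_assoc, hX]
  have h7 : (Complex.I * (α : ℂ)) • G = X - Y := by
    rw [hX, hY, smul_add, add_sub_cancel_left, smul_smul]
  have h8 : NormedSpace.exp (s • X) * (X - Y) * freeEvolution h (-s) =
      NormedSpace.exp (s • X) * X * freeEvolution h (-s) +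
        NormedSpace.exp (s • X) * -(Y * freeEvolution h (-s)) := by
    noncomm_ring
  rw [h6, freeEvolution_neg_mul, mul_one, h7, h8]
  exact h5

theorem norm_dyson_generator_le (h : n → ℝ) (G : Matrix n n ℂ) {α : ℝ} (hα : 0 ≤ α) (s : ℝ) :
    ‖freeEvolution h s * ((Complex.I * α) • G) * freeEvolution h (-s)‖ ≤ α * ‖G‖ := by
  have h1 := l2_opNorm_le_one_of_mem_unitary (freeEvolution_mem_unitary h s)
  have h2 := l2_opNorm_le_one_of_mem_unitary (freeEvolution_mem_unitary h (-s))
  refine (norm_mul_le _ _).trans ((mul_le_of_le_one_right (norm_nonneg _) h2).trans ?_)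
  refine (norm_mul_le _ _).trans ((mul_le_of_le_one_left (norm_nonneg _) h1).trans ?_)
  rw [norm_smul, norm_mul, Complex.norm_I, one_mul, Complex.norm_real, Real.norm_eq_abs,
    abs_of_nonneg hα]

variable {h : n → ℝ} {G : Matrix n n ℂ} {α : ℝ}

theorem interactionPicture_mem_unitary (hG : G.IsHermitian) (s : ℝ) :
    interactionPicture h G α s ∈ unitary (Matrix n n ℂ) :=
  mul_mem (exp_I_smul_mem_unitary (isHermitian_diagonal_add_smul hG) s)
    (freeEvolution_mem_unitary h (-s))

theorem norm_dysonFirst_le (hα : 0 ≤ α) {t : ℝ} (ht : 0 ≤ t) :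
    ‖dysonFirst h G α t‖ ≤ α * t * ‖G‖ := by
  have h0 : dysonFirst h G α 0 = 0 := by
    ext a b
    simp [dysonFirst_apply, phaseIntegral]
  have := norm_image_sub_le_of_norm_deriv_le_segment' (a := 0) (b := t)
    (fun s _ => (hasDerivAt_dysonFirst h G α s).hasDerivWithinAt)
    (fun s _ => norm_dyson_generator_le h G hα s) t ⟨ht, le_rfl⟩
  rw [h0, sub_zero, sub_zero] at this
  linarith

theorem interactionPicture_zero : interactionPicture h G α 0 = 1 := by
  simp [interactionPicture, freeEvolution]

theorem norm_interactionPicture_sub_one_le (hG : G.IsHermitian) (hα : 0 ≤ α) {t : ℝ}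
    (ht : 0 ≤ t) : ‖interactionPicture h G α t - 1‖ ≤ α * t * ‖G‖ := by
  have := norm_image_sub_le_of_norm_deriv_le_segment' (a := 0) (b := t) (C := α * ‖G‖)
    (fun s _ => (hasDerivAt_interactionPicture h G α s).hasDerivWithinAt)
    (fun s _ => (norm_mul_le _ _).trans <| (mul_le_of_le_one_left (norm_nonneg _)
      (l2_opNorm_le_one_of_mem_unitary (interactionPicture_mem_unitary hG s))).trans
      (norm_dyson_generator_le h G hα s)) t ⟨ht, le_rfl⟩
  rw [interactionPicture_zero, sub_zero] at this
  linarith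

/-- The second-order remainder `V - 1 - F` has derivative `(V - 1) F'`, where `V - 1` is of first
order. -/
theorem norm_interactionPicture_sub_sub_le (hG : G.IsHermitian) (hα : 0 ≤ α) {t : ℝ}
    (ht : 0 ≤ t) :
    ‖interactionPicture h G α t - 1 - dysonFirst h G α t‖ ≤ (α * t * ‖G‖) ^ 2 := by
  have hd : ∀ s, HasDerivAt (fun s => interactionPicture h G α s - dysonFirst h G α s)
      ((interactionPicture h G α s - 1) *
        (freeEvolution h s * ((Complex.I * α) • G) * freeEvolution h (-s))) s := by
    intro s
    rw [sub_mul, one_mul]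
    exact (hasDerivAt_interactionPicture h G α s).sub (hasDerivAt_dysonFirst h G α s)
  have := norm_image_sub_le_of_norm_deriv_le_segment' (a := 0) (b := t)
    (C := (α * t * ‖G‖) * (α * ‖G‖))
    (fun s _ => (hd s).hasDerivWithinAt)
    (fun s hs => by
      refine (norm_mul_le _ _).trans (mul_le_mul ?_ (norm_dyson_generator_le h G hα s)
        (norm_nonneg _) (by positivity))
      refine (norm_interactionPicture_sub_one_le hG hα hs.1).trans ?_
      have := hs.2.le
      gcongr) t ⟨ht, le_rfl⟩
  have h0 : dysonFirst h G α 0 = 0 := by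
    ext a b
    simp [dysonFirst_apply, phaseIntegral]
  rw [interactionPicture_zero, h0, sub_zero, sub_zero] at this
  rw [sub_right_comm]
  refine this.trans (le_of_eq (by ring))

/-- Transition probability from `b` to `a` under the evolution `e^{it(h + αG)}`. -/
noncomputable def transitionProb (h : n → ℝ) (α t : ℝ) (G : Matrix n n ℂ) (a b : n) : ℝ :=
  Complex.normSq (NormedSpace.exp ((Complex.I * t) •
    ((Matrix.diagonal fun k => (h k : ℂ)) + (α : ℂ) • G)) a b)

theorem transitionProb_eq (t : ℝ) (a b : n) :
    transitionProb h α t G a b = Complex.normSq (interactionPicture h G α t a b) := by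
  rw [transitionProb, interactionPicture, I_mul_ofReal_smul, freeEvolution_eq,
    Matrix.mul_diagonal, Complex.normSq_mul]
  have : Complex.normSq (Complex.exp (h b * Complex.I * ((-t : ℝ) : ℂ))) = 1 := by
    rw [Complex.normSq_eq_norm_sq, show (h b * Complex.I * ((-t : ℝ) : ℂ)) =
      ((h b * (-t) : ℝ) : ℂ) * Complex.I by push_cast; ring, Complex.norm_exp_ofReal_mul_I, one_pow]
  rw [this, mul_one]

theorem transitionProb_nonneg (t : ℝ) (a b : n) : 0 ≤ transitionProb h α t G a b :=
  Complex.normSq_nonneg _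

theorem sum_transitionProb (hG : G.IsHermitian) (t : ℝ) (b : n) :
    ∑ a, transitionProb h α t G a b = 1 := by
  have hU : interactionPicture h G α t ∈ Matrix.unitaryGroup n ℂ :=
    interactionPicture_mem_unitary hG t
  have h2 := congrFun (congrFun (Matrix.mem_unitaryGroup_iff'.mp hU) b) b
  rw [Matrix.star_eq_conjTranspose, Matrix.mul_apply, Matrix.one_apply_eq] at h2
  have h3 : ((∑ a, transitionProb h α t G a b : ℝ) : ℂ) = 1 := by
    rw [← h2]
    push_cast
    exact Finset.sum_congr rfl fun j _ => by
      rw [Matrix.conjTranspose_apply, transitionProb_eq, Complex.normSq_eq_conj_mul_self]; rfl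
  exact_mod_cast h3

theorem transitionProb_le_one (hG : G.IsHermitian) (t : ℝ) (a b : n) :
    transitionProb h α t G a b ≤ 1 := by
  rw [← sum_transitionProb (h := h) (α := α) hG t b]
  exact Finset.single_le_sum (f := fun a => transitionProb h α t G a b)
    (fun a _ => transitionProb_nonneg t a b) (Finset.mem_univ a)

/-- Second-order perturbation theory for transition probabilities, with a cubic error. Off the
diagonal both amplitudes are at most of first order and differ in second order, so that their
squares differ in third order. -/
theorem sum_abs_transitionProb_sub_le (hG : G.IsHermitian) (hα : 0 ≤ α) {t : ℝ} (ht : 0 ≤ t)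
    (b : n) :
    ∑ a ∈ Finset.univ.erase b, |transitionProb h α t G a b -
      (α * t) ^ 2 * Complex.normSq (G a b) * Real.sinc ((h a - h b) * t / 2) ^ 2| ≤
      2 * (α * t * ‖G‖) ^ 3 := by
  set V := interactionPicture h G α t with hV
  set F := dysonFirst h G α t with hF
  have hfirst : ∀ a, Complex.normSq (F a b) =
      (α * t) ^ 2 * Complex.normSq (G a b) * Real.sinc ((h a - h b) * t / 2) ^ 2 := by
    intro a
    rw [hF, dysonFirst_apply, Complex.normSq_mul, normSq_phaseIntegral, Complex.normSq_mul,
      Complex.normSq_mul, Complex.normSq_I, Complex.normSq_ofReal]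
    ring
  have hsub : ∀ z w : ℂ, |Complex.normSq z - Complex.normSq w| ≤ ‖z - w‖ * (‖z‖ + ‖w‖) := by
    intro z w
    rw [Complex.normSq_eq_norm_sq, Complex.normSq_eq_norm_sq, sq_sub_sq, abs_mul,
      abs_of_nonneg (by positivity : 0 ≤ ‖z‖ + ‖w‖), mul_comm]
    gcongr
    exact abs_norm_sub_norm_le z w
  have hterm : ∀ a ∈ Finset.univ.erase b, |transitionProb h α t G a b -
      (α * t) ^ 2 * Complex.normSq (G a b) * Real.sinc ((h a - h b) * t / 2) ^ 2| ≤
      ‖(V - 1 - F) a b‖ * ‖(V - 1) a b‖ + ‖(V - 1 - F) a b‖ * ‖F a b‖ := by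
    intro a ha
    have hab : a ≠ b := Finset.ne_of_mem_erase ha
    have e1 : (V - 1) a b = V a b := by
      rw [Matrix.sub_apply, Matrix.one_apply_ne hab, sub_zero]
    rw [Matrix.sub_apply (V - 1) F, e1, transitionProb_eq, ← hfirst, ← mul_add]
    exact hsub _ _
  refine (Finset.sum_le_sum hterm).trans ?_
  refine (Finset.sum_le_univ_sum_of_nonneg fun a => by positivity).trans ?_
  rw [Finset.sum_add_distrib]
  have hW := norm_interactionPicture_sub_sub_le (h := h) hG hα ht
  have hV1 := norm_interactionPicture_sub_one_le (h := h) hG hα ht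
  have hF1 := norm_dysonFirst_le (h := h) (G := G) hα ht
  have hx : 0 ≤ α * t * ‖G‖ := by positivity
  have b1 : ∑ a, ‖(V - 1 - F) a b‖ * ‖(V - 1) a b‖ ≤ (α * t * ‖G‖) ^ 2 * (α * t * ‖G‖) :=
    (sum_norm_col_mul_le _ _ b).trans (mul_le_mul hW hV1 (norm_nonneg _) (by positivity))
  have b2 : ∑ a, ‖(V - 1 - F) a b‖ * ‖F a b‖ ≤ (α * t * ‖G‖) ^ 2 * (α * t * ‖G‖) :=
    (sum_norm_col_mul_le _ _ b).trans (mul_le_mul hW hF1 (norm_nonneg _) (by positivity))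
  linarith

end Dyson

/-! ### The mass of `sinc²` -/

section Sinc

/-- The mass `∫_{-x}^{x} sinc²` of the resonance line shape. -/
noncomputable def sincMass (x : ℝ) : ℝ := 2 * ∫ u in (0 : ℝ)..x, Real.sinc u ^ 2

theorem continuous_sinc_sq : Continuous fun u : ℝ => Real.sinc u ^ 2 :=
  Real.continuous_sinc.pow 2

theorem intervalIntegrable_sinc_sq (a b : ℝ) :
    IntervalIntegrable (fun u : ℝ => Real.sinc u ^ 2) volume a b :=
  continuous_sinc_sq.intervalIntegrable a b

theorem sinc_sq_le_one (u : ℝ) : Real.sinc u ^ 2 ≤ 1 := by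
  rw [sq_le_one_iff_abs_le_one, abs_le]
  exact ⟨Real.neg_one_le_sinc u, Real.sinc_le_one u⟩

theorem sincMass_mono {x y : ℝ} (hxy : x ≤ y) : sincMass x ≤ sincMass y := by
  have h : sincMass y - sincMass x = 2 * ∫ u in x..y, Real.sinc u ^ 2 := by
    rw [sincMass, sincMass, ← mul_sub, intervalIntegral.integral_interval_sub_left
      (intervalIntegrable_sinc_sq _ _) (intervalIntegrable_sinc_sq _ _)]
  have h2 : 0 ≤ ∫ u in x..y, Real.sinc u ^ 2 :=
    intervalIntegral.integral_nonneg hxy fun u _ => sq_nonneg _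
  linarith

theorem sincMass_zero : sincMass 0 = 0 := by simp [sincMass]

theorem sincMass_nonneg {x : ℝ} (hx : 0 ≤ x) : 0 ≤ sincMass x :=
  sincMass_zero ▸ sincMass_mono hx

theorem sincMass_le_two_mul {x : ℝ} (hx : 0 ≤ x) : sincMass x ≤ 2 * x := by
  have h : ∫ u in (0 : ℝ)..x, Real.sinc u ^ 2 ≤ ∫ _ in (0 : ℝ)..x, (1 : ℝ) :=
    intervalIntegral.integral_mono_on hx (intervalIntegrable_sinc_sq _ _)
      intervalIntegrable_const fun u _ => sinc_sq_le_one u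
  rw [intervalIntegral.integral_const, smul_eq_mul, mul_one, sub_zero] at h
  rw [sincMass]
  linarith

/-- Since `sinc²` is bounded by `1` on `[0, 1]` and by `u⁻²` beyond, its mass is at most `4`. -/
theorem sincMass_le_four (x : ℝ) : sincMass x ≤ 4 := by
  rcases le_total x 1 with h1 | h1
  · exact (sincMass_mono h1).trans ((sincMass_le_two_mul zero_le_one).trans (by norm_num))
  have h2 : ∫ u in (0 : ℝ)..1, Real.sinc u ^ 2 ≤ 1 := by
    have := sincMass_le_two_mul zero_le_one
    rw [sincMass] at this
    linarith
  have hne : ∀ u ∈ Set.uIcc 1 x, u ≠ 0 := by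
    intro u hu
    rw [Set.uIcc_of_le h1] at hu
    linarith [hu.1]
  have hd : ∀ u ∈ Set.uIcc 1 x, HasDerivAt (fun u : ℝ => -u⁻¹) ((u ^ 2)⁻¹) u := by
    intro u hu
    have h := (hasDerivAt_inv (hne u hu)).neg
    rw [neg_neg] at h
    exact h
  have hint : IntervalIntegrable (fun u : ℝ => (u ^ 2)⁻¹) volume 1 x := by
    refine ContinuousOn.intervalIntegrable ?_
    exact ContinuousOn.inv₀ (by fun_prop) fun u hu => pow_ne_zero 2 (hne u hu)
  have h3 : ∫ u in (1 : ℝ)..x, Real.sinc u ^ 2 ≤ ∫ u in (1 : ℝ)..x, (u ^ 2)⁻¹ := by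
    refine intervalIntegral.integral_mono_on h1 (intervalIntegrable_sinc_sq _ _) hint ?_
    intro u hu
    have hu0 : 0 < u := by linarith [hu.1]
    rw [Real.sinc_of_ne_zero hu0.ne', div_pow, div_eq_mul_inv]
    exact mul_le_of_le_one_left (by positivity) (Real.sin_sq_le_one u)
  rw [intervalIntegral.integral_eq_sub_of_hasDerivAt hd hint] at h3
  have h4 : 0 ≤ x⁻¹ := by positivity
  rw [sincMass, ← intervalIntegral.integral_add_adjacent_intervals
    (intervalIntegrable_sinc_sq 0 1) (intervalIntegrable_sinc_sq 1 x)]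
  norm_num at h3
  linarith

theorem sincMass_pos {x : ℝ} (hx : 0 < x) : 0 < sincMass x := by
  have h : 0 < sincMass (min x 1) := by
    have : 0 < ∫ u in (0 : ℝ)..(min x 1), Real.sinc u ^ 2 := by
      refine intervalIntegral.intervalIntegral_pos_of_pos_on (intervalIntegrable_sinc_sq _ _) ?_
        (lt_min hx one_pos)
      intro u hu
      have h1 : u < 1 := hu.2.trans_le (min_le_right _ _)
      have h2 : 0 < Real.sin u := Real.sin_pos_of_pos_of_lt_pi hu.1 (by linarith [Real.pi_gt_three])
      rw [Real.sinc_of_ne_zero hu.1.ne']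
      have := hu.1
      positivity
    rw [sincMass]
    linarith
  exact h.trans_le (sincMass_mono (min_le_left _ _))

theorem nonneg_of_hasDerivAt_nonneg {f f' : ℝ → ℝ} (hf : ∀ x, HasDerivAt f (f' x) x)
    (h0 : f 0 = 0) (h : ∀ x, 0 ≤ x → 0 ≤ f' x) (x : ℝ) (hx : 0 ≤ x) : 0 ≤ f x := by
  have hm : MonotoneOn f (Set.Ici 0) := by
    refine monotoneOn_of_hasDerivWithinAt_nonneg (convex_Ici 0)
      (fun y _ => (hf y).continuousAt.continuousWithinAt)
      (fun y _ => (hf y).hasDerivWithinAt) fun y hy => ?_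
    rw [interior_Ici] at hy
    exact h y (le_of_lt hy)
  have := hm (Set.mem_Ici.mpr le_rfl) (Set.mem_Ici.mpr hx) hx
  rwa [h0] at this

/-- The alternating Taylor bounds for `sin` and `cos`, obtained from `sin x ≤ x` by repeated
integration. -/
theorem sub_pow_le_sin (x : ℝ) (hx : 0 ≤ x) :
    x - x ^ 3 / 6 + x ^ 5 / 120 - x ^ 7 / 5040 ≤ Real.sin x := by
  have hp : ∀ (k : ℕ) (c : ℝ) (x : ℝ),
      HasDerivAt (fun x : ℝ => x ^ (k + 1) / c) (((k + 1 : ℕ) : ℝ) * x ^ k / c) x := by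
    intro k c x
    simpa using (hasDerivAt_pow (k + 1) x).div_const c
  have s1 : ∀ x : ℝ, 0 ≤ x → 0 ≤ x - Real.sin x := fun x hx => by
    linarith [Real.sin_le hx]
  have c2 : ∀ x : ℝ, 0 ≤ x → 0 ≤ Real.cos x - 1 + x ^ 2 / 2 :=
    nonneg_of_hasDerivAt_nonneg
      (fun x => ((Real.hasDerivAt_cos x).sub_const 1).add (hp 1 2 x)) (by simp)
      fun x hx => by norm_num; linarith [s1 x hx]
  have s3 : ∀ x : ℝ, 0 ≤ x → 0 ≤ Real.sin x - x + x ^ 3 / 6 :=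
    nonneg_of_hasDerivAt_nonneg
      (fun x => ((Real.hasDerivAt_sin x).sub (hasDerivAt_id x)).add (hp 2 6 x)) (by simp)
      fun x hx => by norm_num; linarith [c2 x hx]
  have c4 : ∀ x : ℝ, 0 ≤ x → 0 ≤ x ^ 4 / 24 - (Real.cos x - 1 + x ^ 2 / 2) :=
    nonneg_of_hasDerivAt_nonneg
      (fun x => (hp 3 24 x).sub (((Real.hasDerivAt_cos x).sub_const 1).add (hp 1 2 x))) (by simp)
      fun x hx => by norm_num; linarith [s3 x hx]
  have s5 : ∀ x : ℝ, 0 ≤ x → 0 ≤ x ^ 5 / 120 - (Real.sin x - x + x ^ 3 / 6) :=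
    nonneg_of_hasDerivAt_nonneg
      (fun x => (hp 4 120 x).sub
        (((Real.hasDerivAt_sin x).sub (hasDerivAt_id x)).add (hp 2 6 x))) (by simp)
      fun x hx => by norm_num; linarith [c4 x hx]
  have c6 : ∀ x : ℝ, 0 ≤ x → 0 ≤ x ^ 6 / 720 - (x ^ 4 / 24 - (Real.cos x - 1 + x ^ 2 / 2)) :=
    nonneg_of_hasDerivAt_nonneg
      (fun x => (hp 5 720 x).sub
        ((hp 3 24 x).sub (((Real.hasDerivAt_cos x).sub_const 1).add (hp 1 2 x)))) (by simp)
      fun x hx => by norm_num; linarith [s5 x hx]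
  have s7 : ∀ x : ℝ, 0 ≤ x →
      0 ≤ x ^ 7 / 5040 - (x ^ 5 / 120 - (Real.sin x - x + x ^ 3 / 6)) :=
    nonneg_of_hasDerivAt_nonneg
      (fun x => (hp 6 5040 x).sub ((hp 4 120 x).sub
        (((Real.hasDerivAt_sin x).sub (hasDerivAt_id x)).add (hp 2 6 x)))) (by simp)
      fun x hx => by norm_num; linarith [c6 x hx]
  linarith [s7 x hx]

/-- The square of the Taylor polynomial of `sinc` of degree `6`, a lower bound for `sinc²`, is
integrated up to `1.5707 < π/2`. -/
theorem le_sincMass_of_pi_div_two_le {x : ℝ} (hx : Real.pi / 2 ≤ x) : 2.43 ≤ sincMass x := by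
  have hx' : (1.5707 : ℝ) ≤ x := by linarith [Real.pi_gt_d4]
  refine le_trans ?_ (sincMass_mono hx')
  set p : ℝ → ℝ := fun u => (1 - u ^ 2 / 6 + u ^ 4 / 120 - u ^ 6 / 5040) ^ 2 with hp
  have hle : ∫ u in (0 : ℝ)..1.5707, p u ≤ ∫ u in (0 : ℝ)..1.5707, Real.sinc u ^ 2 := by
    refine intervalIntegral.integral_mono_on (by norm_num)
      (Continuous.intervalIntegrable (by fun_prop) _ _) (intervalIntegrable_sinc_sq _ _) ?_
    intro u hu
    have hu0 : 0 ≤ u := hu.1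
    have hu2 : u ^ 2 ≤ 2.5 := by nlinarith [hu.2]
    have hnn : 0 ≤ 1 - u ^ 2 / 6 + u ^ 4 / 120 - u ^ 6 / 5040 := by
      have h4 : u ^ 6 = u ^ 4 * u ^ 2 := by ring
      have h5 : 0 ≤ u ^ 4 := by positivity
      nlinarith
    refine pow_le_pow_left₀ hnn ?_ 2
    rcases hu0.eq_or_lt with h | h
    · simp [← h]
    · rw [Real.sinc_of_ne_zero h.ne', le_div_iff₀ h]
      have := sub_pow_le_sin u hu0
      nlinarith
  -- the primitive of `p`
  have hd : ∀ u ∈ Set.uIcc (0 : ℝ) 1.5707, HasDerivAt (fun u : ℝ => u ^ 1 / 1 - u ^ 3 / 9 +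
      2 * u ^ 5 / 225 - u ^ 7 / 2205 + u ^ 9 * (41 / 2721600)
      - u ^ 11 / 3326400 + u ^ 13 / 330220800) (p u) u := by
    intro u _
    have hq : ∀ k : ℕ, HasDerivAt (fun u : ℝ => u ^ (k + 1)) (((k + 1 : ℕ) : ℝ) * u ^ k) u := by
      intro k
      simpa using hasDerivAt_pow (k + 1) u
    have := (((((((hq 0).div_const 1).sub ((hq 2).div_const 9)).add
      (((hq 4).const_mul 2).div_const 225)).sub ((hq 6).div_const 2205)).add
      ((hq 8).mul_const (41 / 2721600))).sub ((hq 10).div_const 3326400)).add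
      ((hq 12).div_const 330220800)
    refine this.congr_deriv ?_
    change _ = (1 - u ^ 2 / 6 + u ^ 4 / 120 - u ^ 6 / 5040) ^ 2
    push_cast
    ring
  rw [intervalIntegral.integral_eq_sub_of_hasDerivAt hd
    (Continuous.intervalIntegrable (by fun_prop) _ _)] at hle
  rw [sincMass]
  norm_num at hle ⊢
  linarith

theorem integral_neg_symm_sinc_sq (x : ℝ) :
    ∫ u in (-x)..x, Real.sinc u ^ 2 = sincMass x := by
  rw [← intervalIntegral.integral_add_adjacent_intervals (intervalIntegrable_sinc_sq (-x) 0)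
    (intervalIntegrable_sinc_sq 0 x), sincMass, two_mul]
  congr 1
  have := intervalIntegral.integral_comp_neg (a := 0) (b := x) fun u => Real.sinc u ^ 2
  simp only [Real.sinc_neg, neg_zero] at this
  exact this.symm

/-- The mass of a resonance of half-width `w` around the frequency `e` does not depend on `e`. -/
theorem mul_integral_resonance (t e w : ℝ) :
    t * ∫ γ in (e - w)..(e + w), Real.sinc ((e - γ) * t / 2) ^ 2 = 2 * sincMass (w * t / 2) := by
  have h1 := intervalIntegral.integral_comp_sub_left (a := e - w) (b := e + w)
    (fun x => Real.sinc (x * (t / 2)) ^ 2) e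
  have h2 := intervalIntegral.mul_integral_comp_mul_right (a := -w) (b := w)
    (f := fun x => Real.sinc x ^ 2) (t / 2)
  have h3 : ∀ γ : ℝ, (e - γ) * t / 2 = (e - γ) * (t / 2) := fun γ => by ring
  simp_rw [h3, h1]
  rw [show e - (e + w) = -w by ring, show e - (e - w) = w by ring]
  rw [show -w * (t / 2) = -(w * t / 2) by ring, show w * (t / 2) = w * t / 2 by ring,
    integral_neg_symm_sinc_sq] at h2
  linarith

end Sinc

/-! ### Evolution averaged over the interaction -/

section Evolve

theorem of_integral_mul_mul {Ω m : Type*} [Fintype m] [MeasurableSpace Ω] {ν : Measure Ω}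
    (A B : Matrix m m ℂ) {X : Ω → Matrix m m ℂ} (hX : ∀ a b, Integrable (fun ω => X ω a b) ν) :
    (Matrix.of fun a b => ∫ ω, (A * X ω * B) a b ∂ν) =
      A * (Matrix.of fun a b => ∫ ω, X ω a b ∂ν) * B := by
  ext a b
  simp only [Matrix.of_apply, Matrix.mul_apply, Finset.sum_mul]
  rw [integral_finsetSum _ fun c _ => integrable_finsetSum _ fun c' _ =>
    ((hX c' c).const_mul _).mul_const _]
  refine Finset.sum_congr rfl fun c _ => ?_
  rw [integral_finsetSum _ fun c' _ => ((hX c' c).const_mul _).mul_const _]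
  refine Finset.sum_congr rfl fun c' _ => ?_
  rw [integral_mul_const, integral_const_mul]

variable {n : Type*} [Fintype n] [DecidableEq n]

/-- The evolution `e^{i(K+αG)t} S e^{-i(K+αG)t}` of `S`. -/
noncomputable def evolve (K S : Matrix n n ℂ) (α t : ℝ) (G : Matrix n n ℂ) : Matrix n n ℂ :=
  NormedSpace.exp ((Complex.I * t) • (K + (α : ℂ) • G)) * S *
    NormedSpace.exp (-(Complex.I * t) • (K + (α : ℂ) • G))

theorem unitary_inv (W : Matrix.unitaryGroup n ℂ) :
    (W : Matrix n n ℂ)⁻¹ = (W : Matrix n n ℂ)ᴴ :=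
  Matrix.inv_eq_right_inv (Matrix.mem_unitaryGroup_iff.mp W.2)

theorem unitary_mul_conjTranspose (W : Matrix.unitaryGroup n ℂ) :
    (W : Matrix n n ℂ) * (W : Matrix n n ℂ)ᴴ = 1 := Matrix.mem_unitaryGroup_iff.mp W.2

theorem unitary_conjTranspose_mul (W : Matrix.unitaryGroup n ℂ) :
    (W : Matrix n n ℂ)ᴴ * (W : Matrix n n ℂ) = 1 := Matrix.mem_unitaryGroup_iff'.mp W.2

theorem exp_unitary_conj (W : Matrix.unitaryGroup n ℂ) (A : Matrix n n ℂ) :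
    NormedSpace.exp ((W : Matrix n n ℂ) * A * (W : Matrix n n ℂ)ᴴ) =
      (W : Matrix n n ℂ) * NormedSpace.exp A * (W : Matrix n n ℂ)ᴴ := by
  have h : IsUnit (W : Matrix n n ℂ) :=
    ⟨⟨W, (W : Matrix n n ℂ)ᴴ, unitary_mul_conjTranspose W, unitary_conjTranspose_mul W⟩, rfl⟩
  rw [← unitary_inv]
  exact Matrix.exp_conj _ _ h

theorem evolve_conj (W : Matrix.unitaryGroup n ℂ) (K S : Matrix n n ℂ) (α t : ℝ)
    (G : Matrix n n ℂ) :
    evolve ((W : Matrix n n ℂ) * K * (W : Matrix n n ℂ)ᴴ)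
        ((W : Matrix n n ℂ) * S * (W : Matrix n n ℂ)ᴴ) α t
        ((W : Matrix n n ℂ) * G * (W : Matrix n n ℂ)ᴴ) =
      (W : Matrix n n ℂ) * evolve K S α t G * (W : Matrix n n ℂ)ᴴ := by
  have h : ∀ c : ℂ, c • ((W : Matrix n n ℂ) * K * (W : Matrix n n ℂ)ᴴ +
      (α : ℂ) • ((W : Matrix n n ℂ) * G * (W : Matrix n n ℂ)ᴴ)) =
      (W : Matrix n n ℂ) * (c • (K + (α : ℂ) • G)) * (W : Matrix n n ℂ)ᴴ := by
    intro c
    simp only [Matrix.mul_smul, Matrix.smul_mul, Matrix.mul_add, Matrix.add_mul]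
  have h1 : ∀ X Y Z : Matrix n n ℂ,
      ((W : Matrix n n ℂ) * X * (W : Matrix n n ℂ)ᴴ) *
        ((W : Matrix n n ℂ) * Y * (W : Matrix n n ℂ)ᴴ) *
        ((W : Matrix n n ℂ) * Z * (W : Matrix n n ℂ)ᴴ) =
      (W : Matrix n n ℂ) * (X * Y * Z) * (W : Matrix n n ℂ)ᴴ := by
    intro X Y Z
    calc _ = (W : Matrix n n ℂ) * X * ((W : Matrix n n ℂ)ᴴ * (W : Matrix n n ℂ)) * Y *
          ((W : Matrix n n ℂ)ᴴ * (W : Matrix n n ℂ)) * Z * (W : Matrix n n ℂ)ᴴ := by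
          simp only [Matrix.mul_assoc]
      _ = _ := by
          rw [unitary_conjTranspose_mul]
          simp only [Matrix.mul_one, Matrix.mul_assoc]
  unfold evolve
  rw [h, h, exp_unitary_conj, exp_unitary_conj, h1]

theorem exp_neg_I_smul {A : Matrix n n ℂ} (hA : A.IsHermitian) (t : ℝ) :
    NormedSpace.exp (-(Complex.I * t) • A) = (NormedSpace.exp ((Complex.I * t) • A))ᴴ := by
  rw [← Matrix.exp_conjTranspose, Matrix.conjTranspose_smul, hA.eq]
  simp

section
open scoped Matrix.Norms.L2Operator

theorem norm_entry_le_l2_opNorm (A : Matrix n n ℂ) (a b : n) : ‖A a b‖ ≤ ‖A‖ := by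
  refine abs_le_of_sq_le_sq' ?_ (norm_nonneg _) |>.2
  exact (Finset.single_le_sum (f := fun a => ‖A a b‖ ^ 2) (fun _ _ => by positivity)
    (Finset.mem_univ a)).trans (sum_sq_norm_col_le A b)

theorem norm_evolve_apply_le {K : Matrix n n ℂ} (hK : K.IsHermitian) (S : Matrix n n ℂ) (α t : ℝ)
    {G : Matrix n n ℂ} (hG : G.IsHermitian) (a b : n) : ‖evolve K S α t G a b‖ ≤ ‖S‖ := by
  have hA : (K + (α : ℂ) • G).IsHermitian := by
    refine hK.add ?_
    rw [Matrix.IsHermitian, Matrix.conjTranspose_smul, hG.eq]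
    simp
  refine (norm_entry_le_l2_opNorm _ a b).trans ?_
  have h1 : ‖NormedSpace.exp ((Complex.I * t) • (K + (α : ℂ) • G))‖ ≤ 1 := by
    rw [I_mul_ofReal_smul]
    exact l2_opNorm_le_one_of_mem_unitary (exp_I_smul_mem_unitary hA t)
  unfold evolve
  rw [exp_neg_I_smul hA]
  refine (norm_mul_le _ _).trans ((mul_le_of_le_one_right (norm_nonneg _) ?_).trans
    ((norm_mul_le _ _).trans (mul_le_of_le_one_left (norm_nonneg _) h1)))
  rwa [Matrix.l2_opNorm_conjTranspose]

theorem continuous_matrix_exp : Continuous fun A : Matrix n n ℂ => NormedSpace.exp A :=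
  letI : NormedAlgebra ℚ (Matrix n n ℂ) := NormedAlgebra.restrictScalars ℚ ℂ _
  NormedSpace.exp_continuous

end

theorem continuous_evolve (K S : Matrix n n ℂ) (α t : ℝ) : Continuous (evolve K S α t) := by
  unfold evolve
  refine Continuous.matrix_mul (Continuous.matrix_mul ?_ continuous_const) ?_
  · exact continuous_matrix_exp.comp (by fun_prop)
  · exact continuous_matrix_exp.comp (by fun_prop)

theorem integrable_evolve {K : Matrix n n ℂ} (hK : K.IsHermitian) (S : Matrix n n ℂ) (α t : ℝ)
    (a b : n) :
    Integrable (fun ω => evolve K S α t (interaction ω) a b) (interactionLaw n) := by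
  refine Integrable.of_bound (Continuous.aestronglyMeasurable ?_) _
    (Eventually.of_forall fun ω => norm_evolve_apply_le hK S α t (isHermitian_interaction ω) a b)
  exact Continuous.matrix_elem ((continuous_evolve K S α t).comp continuous_interaction) a b

/-- Expectation of the evolution over the random interaction, as a single integral. -/
theorem interactionExpectation_evolve {K : Matrix n n ℂ} (hK : K.IsHermitian) (S : Matrix n n ℂ)
    (α t : ℝ) :
    interactionExpectation (evolve K S α t) =
      Matrix.of fun a b => ∫ ω, evolve K S α t (interaction ω) a b ∂interactionLaw n := by
  ext a b
  exact interactionExpectation_apply a b (integrable_evolve hK S α t a b)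

/-- Covariance of the averaged evolution, inherited from the conjugation invariance of the random
interaction. -/
theorem interactionExpectation_evolve_conj (W : Matrix.unitaryGroup n ℂ) {K : Matrix n n ℂ}
    (hK : K.IsHermitian) (S : Matrix n n ℂ) (α t : ℝ) :
    interactionExpectation (evolve ((W : Matrix n n ℂ) * K * (W : Matrix n n ℂ)ᴴ)
        ((W : Matrix n n ℂ) * S * (W : Matrix n n ℂ)ᴴ) α t) =
      (W : Matrix n n ℂ) * interactionExpectation (evolve K S α t) * (W : Matrix n n ℂ)ᴴ := by
  rw [interactionExpectation_evolve (Matrix.isHermitian_mul_mul_conjTranspose _ hK),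
    interactionExpectation_evolve hK, ← of_integral_mul_mul _ _ (integrable_evolve hK S α t)]
  ext a b
  simp only [Matrix.of_apply]
  rw [← integral_interaction_conj W fun G => evolve ((W : Matrix n n ℂ) * K * (W : Matrix n n ℂ)ᴴ)
    ((W : Matrix n n ℂ) * S * (W : Matrix n n ℂ)ᴴ) α t G a b]
  simp_rw [evolve_conj]

/-- Expected transition probability from `b` to `a` over the random interaction. -/
noncomputable def meanTransitionProb (h : n → ℝ) (α t : ℝ) (a b : n) : ℝ :=
  ∫ ω, transitionProb h α t (interaction ω) a b ∂interactionLaw n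

theorem continuous_transitionProb (α t : ℝ) (a b : n) :
    Continuous fun x : (n → ℝ) × Matrix n n ℂ => transitionProb x.1 α t x.2 a b := by
  unfold transitionProb
  refine Complex.continuous_normSq.comp (Continuous.matrix_elem ?_ a b)
  have h1 : Continuous fun x : (n → ℝ) × Matrix n n ℂ => Matrix.diagonal fun k => (x.1 k : ℂ) :=
    Continuous.matrix_diagonal (by fun_prop)
  exact continuous_matrix_exp.comp (by fun_prop)

theorem integrable_transitionProb (h : n → ℝ) (α t : ℝ) (a b : n) :
    Integrable (fun ω => transitionProb h α t (interaction ω) a b) (interactionLaw n) := by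
  refine Integrable.of_bound (C := 1) (Continuous.aestronglyMeasurable ?_)
    (Eventually.of_forall fun ω => ?_)
  · exact (continuous_transitionProb α t a b).comp
      (continuous_const.prodMk continuous_interaction)
  · rw [Real.norm_eq_abs, abs_of_nonneg (transitionProb_nonneg t a b)]
    exact transitionProb_le_one (isHermitian_interaction ω) t a b

theorem continuous_meanTransitionProb (α t : ℝ) (a b : n) :
    Continuous fun h : n → ℝ => meanTransitionProb h α t a b := by
  unfold meanTransitionProb
  refine continuous_of_dominated (bound := fun _ => 1) (fun h =>
    (integrable_transitionProb h α t a b).aestronglyMeasurable) (fun h =>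
      Eventually.of_forall fun ω => ?_) (integrable_const _) (Eventually.of_forall fun ω => ?_)
  · rw [Real.norm_eq_abs, abs_of_nonneg (transitionProb_nonneg t a b)]
    exact transitionProb_le_one (isHermitian_interaction ω) t a b
  · exact (continuous_transitionProb α t a b).comp (continuous_id.prodMk continuous_const)

theorem meanTransitionProb_nonneg (h : n → ℝ) (α t : ℝ) (a b : n) :
    0 ≤ meanTransitionProb h α t a b :=
  integral_nonneg fun _ => transitionProb_nonneg t a b

theorem sum_meanTransitionProb (h : n → ℝ) (α t : ℝ) (b : n) :
    ∑ a, meanTransitionProb h α t a b = 1 := by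
  unfold meanTransitionProb
  rw [← integral_finsetSum _ fun a _ => integrable_transitionProb h α t a b]
  simp_rw [sum_transitionProb (isHermitian_interaction _)]
  simp

/-- Averaging over the random interaction turns a diagonal matrix into a diagonal matrix: the
off-diagonal entries change sign under conjugation by the reflection of one coordinate. -/
theorem interactionExpectation_evolve_diagonal (h : n → ℝ) (μ : n → ℝ) (α t : ℝ) :
    interactionExpectation (evolve (Matrix.diagonal fun k => (h k : ℂ))
      (Matrix.diagonal fun k => (μ k : ℂ)) α t) =
      Matrix.diagonal fun a => ((∑ b, meanTransitionProb h α t a b * μ b : ℝ) : ℂ) := by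
  have hK := isHermitian_diagonal_ofReal h
  ext a b
  rcases eq_or_ne a b with rfl | hab
  · rw [interactionExpectation_evolve hK, Matrix.diagonal_apply_eq, Matrix.of_apply]
    have h1 : ∀ ω : Matrix.unitaryGroup n ℂ × (n → ℝ),
        evolve (Matrix.diagonal fun k => (h k : ℂ)) (Matrix.diagonal fun k => (μ k : ℂ)) α t
          (interaction ω) a a =
        ((∑ b, transitionProb h α t (interaction ω) a b * μ b : ℝ) : ℂ) := by
      intro ω
      unfold evolve
      rw [exp_neg_I_smul (isHermitian_diagonal_add_smul (isHermitian_interaction ω)),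
        Matrix.mul_apply]
      push_cast
      refine Finset.sum_congr rfl fun b _ => ?_
      rw [Matrix.mul_diagonal, Matrix.conjTranspose_apply, transitionProb,
        Complex.normSq_eq_conj_mul_self]
      change _ = star _ * _ * _
      ring
    simp_rw [h1]
    rw [integral_complex_ofReal, integral_finsetSum _ fun b _ =>
      (integrable_transitionProb h α t a b).mul_const _]
    simp_rw [integral_mul_const]
    rfl
  · rw [Matrix.diagonal_apply_ne _ hab]
    -- `R` commutes with both diagonal matrices, so that the average commutes with `R`.
    set R : Matrix n n ℂ := Matrix.diagonal fun k => if k = a then (-1 : ℂ) else 1 with hR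
    have hRH : Rᴴ = R := by
      rw [hR, Matrix.diagonal_conjTranspose]
      congr 1
      funext k
      by_cases hk : k = a <;> simp [hk]
    have hRR : R * R = 1 := by
      rw [hR, Matrix.diagonal_mul_diagonal, ← Matrix.diagonal_one]
      congr 1
      funext k
      by_cases hk : k = a <;> simp [hk]
    have hRU : R ∈ Matrix.unitaryGroup n ℂ := by
      rw [Matrix.mem_unitaryGroup_iff, Matrix.star_eq_conjTranspose, hRH, hRR]
    have hcomm : ∀ x : n → ℂ, R * Matrix.diagonal x * Rᴴ = Matrix.diagonal x := by
      intro x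
      rw [hRH, hR, Matrix.diagonal_mul_diagonal, Matrix.diagonal_mul_diagonal]
      congr 1
      funext k
      by_cases hk : k = a <;> simp [hk]
    have h2 := interactionExpectation_evolve_conj ⟨R, hRU⟩ hK
      (Matrix.diagonal fun k => (μ k : ℂ)) α t
    simp only [hcomm] at h2
    have h3 := congrFun (congrFun h2 a) b
    rw [hRH, hR, Matrix.mul_diagonal, Matrix.diagonal_mul] at h3
    simp only [if_true, if_neg hab.symm, mul_one, neg_one_mul] at h3
    exact self_eq_neg.mp h3

end Evolve

/-! ### The channel in the energy eigenbasis -/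

section Channel

variable {d : ℕ} {H : Matrix (Fin d) (Fin d) ℂ}

/-- The matrix that is diagonal in the eigenbasis of the system Hamiltonian, with the given
eigenvalues. -/
noncomputable def eigDiag (hH : H.IsHermitian) (p : Fin d → ℝ) : Matrix (Fin d) (Fin d) ℂ :=
  (hH.eigenvectorUnitary : Matrix (Fin d) (Fin d) ℂ) * Matrix.diagonal (fun i => (p i : ℂ)) *
    (hH.eigenvectorUnitary : Matrix (Fin d) (Fin d) ℂ)ᴴ

theorem eigDiag_eigenvalues (hH : H.IsHermitian) : eigDiag hH hH.eigenvalues = H := by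
  conv_rhs => rw [hH.spectral_theorem]
  rfl

/-- The energies of system and environment. -/
noncomputable def jointEnergy (hH : H.IsHermitian) (γ : ℝ) (a : Fin d × Fin 2) : ℝ :=
  hH.eigenvalues a.1 + ![0, γ] a.2

/-- The populations `q(0), q(1)` of the environment qubit. -/
noncomputable def envPop (β : ℝ≥0∞) (γ : ℝ) : Fin 2 → ℝ := ![q₀ β γ, q₁ β γ]

theorem boltzmann_nonneg (β : ℝ≥0∞) (γ : ℝ) : 0 ≤ boltzmann β γ := by
  unfold boltzmann
  split_ifs <;> positivity

theorem q₀_add_q₁ (β : ℝ≥0∞) (γ : ℝ) : q₀ β γ + q₁ β γ = 1 := by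
  have := boltzmann_nonneg β γ
  unfold q₀ q₁
  field_simp

theorem q₀_nonneg (β : ℝ≥0∞) (γ : ℝ) : 0 ≤ q₀ β γ := by
  have := boltzmann_nonneg β γ
  unfold q₀
  positivity

theorem q₁_nonneg (β : ℝ≥0∞) (γ : ℝ) : 0 ≤ q₁ β γ := by
  have := boltzmann_nonneg β γ
  unfold q₁
  positivity

theorem envPop_nonneg (β : ℝ≥0∞) (γ : ℝ) (k : Fin 2) : 0 ≤ envPop β γ k := by
  fin_cases k
  · exact q₀_nonneg β γ
  · exact q₁_nonneg β γ

theorem sum_envPop (β : ℝ≥0∞) (γ : ℝ) : ∑ k, envPop β γ k = 1 := by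
  rw [Fin.sum_univ_two]
  exact q₀_add_q₁ β γ

theorem measurable_boltzmann (β : ℝ≥0∞) : Measurable (boltzmann β) := by
  unfold boltzmann
  split_ifs
  · exact Measurable.ite measurableSet_Ioi measurable_const measurable_const
  · fun_prop

theorem measurable_q₀ (β : ℝ≥0∞) : Measurable (q₀ β) :=
  measurable_const.div (measurable_const.add (measurable_boltzmann β))

theorem measurable_q₁ (β : ℝ≥0∞) : Measurable (q₁ β) :=
  (measurable_boltzmann β).div (measurable_const.add (measurable_boltzmann β))

theorem measurable_envPop (β : ℝ≥0∞) (k : Fin 2) : Measurable fun γ => envPop β γ k := by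
  fin_cases k
  · exact measurable_q₀ β
  · exact measurable_q₁ β

/-- The stochastic matrix of the channel `Φ_γ` on the eigenstates of the system Hamiltonian. -/
noncomputable def channelMatrix (hH : H.IsHermitian) (β : ℝ≥0∞) (α t γ : ℝ) :
    Matrix (Fin d) (Fin d) ℝ :=
  Matrix.of fun j i => ∑ l, ∑ k, meanTransitionProb (jointEnergy hH γ) α t (j, l) (i, k) *
    envPop β γ k

/-- The stochastic matrix of the averaged channel. -/
noncomputable def avgChannelMatrix (hH : H.IsHermitian) (β : ℝ≥0∞) (α t : ℝ) :
    Matrix (Fin d) (Fin d) ℝ :=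
  Matrix.of fun j i => ⨍ γ in Set.Icc 0 (4 * specNorm H), channelMatrix hH β α t γ j i

theorem kronecker_one_mem_unitaryGroup (P : Matrix.unitaryGroup (Fin d) ℂ) :
    ((P : Matrix (Fin d) (Fin d) ℂ) ⊗ₖ (1 : Matrix (Fin 2) (Fin 2) ℂ)) ∈
      Matrix.unitaryGroup (Fin d × Fin 2) ℂ := by
  rw [Matrix.mem_unitaryGroup_iff, Matrix.star_eq_conjTranspose, Matrix.conjTranspose_kronecker,
    ← Matrix.mul_kronecker_mul, unitary_mul_conjTranspose, Matrix.conjTranspose_one,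
    Matrix.mul_one, Matrix.one_kronecker_one]

theorem conj_kronecker (P X : Matrix (Fin d) (Fin d) ℂ) (Y : Matrix (Fin 2) (Fin 2) ℂ) :
    (P * X * Pᴴ) ⊗ₖ Y = (P ⊗ₖ (1 : Matrix (Fin 2) (Fin 2) ℂ)) * (X ⊗ₖ Y) *
      (P ⊗ₖ (1 : Matrix (Fin 2) (Fin 2) ℂ))ᴴ := by
  rw [Matrix.conjTranspose_kronecker, Matrix.conjTranspose_one, ← Matrix.mul_kronecker_mul,
    ← Matrix.mul_kronecker_mul, Matrix.one_mul, Matrix.mul_one]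

theorem partialTraceRight_conj_diagonal (P : Matrix (Fin d) (Fin d) ℂ) (x : Fin d × Fin 2 → ℂ) :
    partialTraceRight ((P ⊗ₖ (1 : Matrix (Fin 2) (Fin 2) ℂ)) * Matrix.diagonal x *
      (P ⊗ₖ (1 : Matrix (Fin 2) (Fin 2) ℂ))ᴴ) =
      P * Matrix.diagonal (fun j => ∑ l, x (j, l)) * Pᴴ := by
  ext i j
  simp only [partialTraceRight, Matrix.of_apply]
  rw [Matrix.mul_apply]
  simp_rw [Matrix.mul_apply (N := (P ⊗ₖ (1 : Matrix (Fin 2) (Fin 2) ℂ))ᴴ), Matrix.mul_diagonal,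
    Matrix.conjTranspose_apply, Matrix.kroneckerMap_apply, Fintype.sum_prod_type]
  rw [Finset.sum_comm]
  refine Finset.sum_congr rfl fun m _ => ?_
  rw [Finset.mul_sum, Finset.sum_mul]
  refine Finset.sum_congr rfl fun l _ => ?_
  rw [Finset.sum_eq_single l]
  · simp
  · intro k _ hk
    simp [Matrix.one_apply_ne hk.symm]
  · simp

theorem totalHamiltonian_eq (hH : H.IsHermitian) (γ : ℝ) :
    totalHamiltonian H γ =
      ((hH.eigenvectorUnitary : Matrix (Fin d) (Fin d) ℂ) ⊗ₖ (1 : Matrix (Fin 2) (Fin 2) ℂ)) *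
        Matrix.diagonal (fun a => (jointEnergy hH γ a : ℂ)) *
      ((hH.eigenvectorUnitary : Matrix (Fin d) (Fin d) ℂ) ⊗ₖ (1 : Matrix (Fin 2) (Fin 2) ℂ))ᴴ := by
  have h1 : (Matrix.diagonal (fun a => (jointEnergy hH γ a : ℂ)) :
      Matrix (Fin d × Fin 2) (Fin d × Fin 2) ℂ) =
      (Matrix.diagonal fun i => (hH.eigenvalues i : ℂ)) ⊗ₖ (1 : Matrix (Fin 2) (Fin 2) ℂ) +
        (1 : Matrix (Fin d) (Fin d) ℂ) ⊗ₖ envHamiltonian γ := by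
    rw [envHamiltonian, ← Matrix.diagonal_one, ← Matrix.diagonal_one,
      Matrix.diagonal_kronecker_diagonal, Matrix.diagonal_kronecker_diagonal, Matrix.diagonal_add]
    congr 1
    funext ⟨i, k⟩
    fin_cases k <;> simp [jointEnergy]
  rw [h1, Matrix.mul_add, Matrix.add_mul, ← conj_kronecker, ← conj_kronecker, Matrix.mul_one,
    unitary_mul_conjTranspose]
  change _ = eigDiag hH hH.eigenvalues ⊗ₖ _ + _
  rw [eigDiag_eigenvalues]
  rfl

/-- On states diagonal in the eigenbasis, the channel acts through its stochastic matrix. -/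
theorem channel_eigDiag (hH : H.IsHermitian) (β : ℝ≥0∞) (α t γ : ℝ) (p : Fin d → ℝ) :
    channel H β α t γ (eigDiag hH p) = eigDiag hH (channelMatrix hH β α t γ *ᵥ p) := by
  have h1 : eigDiag hH p ⊗ₖ envState β γ =
      ((hH.eigenvectorUnitary : Matrix (Fin d) (Fin d) ℂ) ⊗ₖ (1 : Matrix (Fin 2) (Fin 2) ℂ)) *
        Matrix.diagonal (fun a : Fin d × Fin 2 => ((p a.1 * envPop β γ a.2 : ℝ) : ℂ)) *
      ((hH.eigenvectorUnitary : Matrix (Fin d) (Fin d) ℂ) ⊗ₖ (1 : Matrix (Fin 2) (Fin 2) ℂ))ᴴ := by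
    rw [eigDiag, conj_kronecker, envState, Matrix.diagonal_kronecker_diagonal]
    congr 3
    funext ⟨i, k⟩
    fin_cases k <;> simp [envPop]
  have h2 : jointEvolution H β α t γ (eigDiag hH p) =
      evolve (totalHamiltonian H γ) (eigDiag hH p ⊗ₖ envState β γ) α t := rfl
  rw [channel, h2, h1, totalHamiltonian_eq hH]
  have h3 := interactionExpectation_evolve_conj
    ⟨_, kronecker_one_mem_unitaryGroup hH.eigenvectorUnitary⟩
    (isHermitian_diagonal_ofReal (jointEnergy hH γ))
    (Matrix.diagonal (fun a : Fin d × Fin 2 => ((p a.1 * envPop β γ a.2 : ℝ) : ℂ))) α t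
  simp only at h3
  rw [h3, interactionExpectation_evolve_diagonal, partialTraceRight_conj_diagonal, eigDiag]
  congr 3
  funext j
  rw [← Complex.ofReal_sum]
  congr 1
  simp only [channelMatrix, Matrix.mulVec, dotProduct, Matrix.of_apply, Fintype.sum_prod_type,
    Finset.sum_mul]
  rw [Finset.sum_comm]
  refine Finset.sum_congr rfl fun i _ => Finset.sum_congr rfl fun l _ =>
    Finset.sum_congr rfl fun k _ => ?_
  ring

theorem channelMatrix_nonneg (hH : H.IsHermitian) (β : ℝ≥0∞) (α t γ : ℝ) (j i : Fin d) :
    0 ≤ channelMatrix hH β α t γ j i := by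
  rw [channelMatrix, Matrix.of_apply]
  exact Finset.sum_nonneg fun _ _ => Finset.sum_nonneg fun k _ =>
    mul_nonneg (meanTransitionProb_nonneg _ _ _ _ _) (envPop_nonneg β γ k)

theorem sum_channelMatrix (hH : H.IsHermitian) (β : ℝ≥0∞) (α t γ : ℝ) (i : Fin d) :
    ∑ j, channelMatrix hH β α t γ j i = 1 := by
  have h1 : ∀ k, ∑ j, ∑ l, meanTransitionProb (jointEnergy hH γ) α t (j, l) (i, k) = 1 := by
    intro k
    rw [← sum_meanTransitionProb (jointEnergy hH γ) α t (i, k), Fintype.sum_prod_type]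
  calc ∑ j, channelMatrix hH β α t γ j i
      = ∑ k, (∑ j, ∑ l, meanTransitionProb (jointEnergy hH γ) α t (j, l) (i, k)) *
          envPop β γ k := by
        simp only [channelMatrix, Matrix.of_apply, Finset.sum_mul]
        refine Eq.trans ?_ Finset.sum_comm
        exact Finset.sum_congr rfl fun j _ => Finset.sum_comm
    _ = 1 := by simp_rw [h1, one_mul, sum_envPop]

theorem channelMatrix_le_one (hH : H.IsHermitian) (β : ℝ≥0∞) (α t γ : ℝ) (j i : Fin d) :
    channelMatrix hH β α t γ j i ≤ 1 := by
  rw [← sum_channelMatrix hH β α t γ i]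
  exact Finset.single_le_sum (f := fun j => channelMatrix hH β α t γ j i)
    (fun j _ => channelMatrix_nonneg hH β α t γ j i) (Finset.mem_univ j)

theorem measurable_channelMatrix (hH : H.IsHermitian) (β : ℝ≥0∞) (α t : ℝ) (j i : Fin d) :
    Measurable fun γ => channelMatrix hH β α t γ j i := by
  simp only [channelMatrix, Matrix.of_apply]
  refine Finset.measurable_fun_sum _ fun l _ => Finset.measurable_fun_sum _ fun k _ => ?_
  refine Measurable.mul (Continuous.measurable ?_) (measurable_envPop β k)
  refine (continuous_meanTransitionProb α t (j, l) (i, k)).comp (continuous_pi fun a => ?_)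
  refine continuous_const.add ?_
  rcases a with ⟨a, m⟩
  fin_cases m
  · exact continuous_const
  · exact continuous_id

end Channel

/-! ### Eigenvalue differences -/

section Gaps

variable {d : ℕ} {H : Matrix (Fin d) (Fin d) ℂ}

theorem eigDiag_eq_iff (hH : H.IsHermitian) (A : Matrix (Fin d) (Fin d) ℂ) (p : Fin d → ℝ) :
    A = eigDiag hH p ↔ (hH.eigenvectorUnitary : Matrix (Fin d) (Fin d) ℂ)ᴴ * A *
      (hH.eigenvectorUnitary : Matrix (Fin d) (Fin d) ℂ) =
      Matrix.diagonal (fun i => (p i : ℂ)) := by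
  have h1 := unitary_mul_conjTranspose hH.eigenvectorUnitary
  have h2 := unitary_conjTranspose_mul hH.eigenvectorUnitary
  set P : Matrix (Fin d) (Fin d) ℂ := (hH.eigenvectorUnitary : Matrix (Fin d) (Fin d) ℂ) with hP
  constructor
  · rintro rfl
    rw [eigDiag, ← hP]
    calc _ = (Pᴴ * P) * Matrix.diagonal (fun i => (p i : ℂ)) * (Pᴴ * P) := by
          simp only [Matrix.mul_assoc]
      _ = _ := by rw [h2, one_mul, mul_one]
  · intro h
    rw [eigDiag, ← hP, ← h]
    calc A = (P * Pᴴ) * A * (P * Pᴴ) := by rw [h1, one_mul, mul_one]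
      _ = _ := by simp only [Matrix.mul_assoc]

open scoped Matrix.Norms.L2Operator in
theorem abs_eigenvalues_le_specNorm (hH : H.IsHermitian) (i : Fin d) :
    |hH.eigenvalues i| ≤ specNorm H := by
  have h1 : specNorm H = ‖H‖ := rfl
  have h2 := (eigDiag_eq_iff hH H hH.eigenvalues).mp (eigDiag_eigenvalues hH).symm
  have hU := l2_opNorm_le_one_of_mem_unitary hH.eigenvectorUnitary.2
  have hU' : ‖(hH.eigenvectorUnitary : Matrix (Fin d) (Fin d) ℂ)ᴴ‖ ≤ 1 := by
    rwa [Matrix.l2_opNorm_conjTranspose]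
  have h3 : ‖(Matrix.diagonal fun i => (hH.eigenvalues i : ℂ))‖ ≤ ‖H‖ := by
    rw [← h2]
    exact (norm_mul_le _ _).trans ((mul_le_of_le_one_right (norm_nonneg _) hU).trans
      ((norm_mul_le _ _).trans (mul_le_of_le_one_left (norm_nonneg _) hU')))
  rw [Matrix.l2_opNorm_diagonal] at h3
  have h4 := (norm_le_pi_norm (fun i => (hH.eigenvalues i : ℂ)) i).trans h3
  rwa [Complex.norm_real, Real.norm_eq_abs, ← h1] at h4

theorem gapS_le (hH : H.IsHermitian) (i j : Fin d) : gapS hH i j ≤ 2 * specNorm H := by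
  have h1 := abs_le.mp (abs_eigenvalues_le_specNorm hH i)
  have h2 := abs_le.mp (abs_eigenvalues_le_specNorm hH j)
  unfold gapS
  linarith

theorem gapS_self (hH : H.IsHermitian) (i : Fin d) : gapS hH i i = 0 := sub_self _

theorem gapS_swap (hH : H.IsHermitian) (i j : Fin d) : gapS hH j i = -gapS hH i j := by
  unfold gapS; ring

theorem deltaMin_le (hH : H.IsHermitian) {i j k l : Fin d} (h : gapS hH i j ≠ gapS hH k l) :
    deltaMin hH ≤ |gapS hH i j - gapS hH k l| := by
  refine csInf_le ⟨0, ?_⟩ ⟨i, j, k, l, h, rfl⟩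
  rintro x ⟨i, j, k, l, -, rfl⟩
  exact abs_nonneg _

theorem gapS_ne_zero (hH : H.IsHermitian) (hinj : Function.Injective hH.eigenvalues)
    {i j : Fin d} (hij : i ≠ j) : gapS hH i j ≠ 0 :=
  fun h => hij (hinj (sub_eq_zero.mp h))

theorem deltaMin_le_abs_gapS (hH : H.IsHermitian) (hinj : Function.Injective hH.eigenvalues)
    {i j : Fin d} (hij : i ≠ j) : deltaMin hH ≤ |gapS hH i j| := by
  have := deltaMin_le hH (i := i) (j := j) (k := i) (l := i)
    (by rw [gapS_self]; exact gapS_ne_zero hH hinj hij)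
  rwa [gapS_self, sub_zero] at this

theorem deltaMin_pos (hH : H.IsHermitian) (hinj : Function.Injective hH.eigenvalues)
    (hd : 2 ≤ d) : 0 < deltaMin hH := by
  set S : Set ℝ := {x | ∃ i j k l, gapS hH i j ≠ gapS hH k l ∧ x = |gapS hH i j - gapS hH k l|}
    with hS
  have hfin : S.Finite := by
    refine (Set.finite_range fun x : Fin d × Fin d × Fin d × Fin d =>
      |gapS hH x.1 x.2.1 - gapS hH x.2.2.1 x.2.2.2|).subset ?_
    rintro x ⟨i, j, k, l, -, rfl⟩
    exact ⟨(i, j, k, l), rfl⟩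
  have hne : S.Nonempty := by
    have h01 : (⟨0, by omega⟩ : Fin d) ≠ ⟨1, by omega⟩ := by simp
    refine ⟨_, ⟨0, by omega⟩, ⟨1, by omega⟩, ⟨0, by omega⟩, ⟨0, by omega⟩, ?_, rfl⟩
    rw [gapS_self hH ⟨0, by omega⟩]
    exact gapS_ne_zero hH hinj h01
  obtain ⟨i, j, k, l, h1, h2⟩ := hne.csInf_mem hfin
  change 0 < sInf S
  rw [h2]
  exact abs_pos.mpr (sub_ne_zero.mpr h1)

theorem deltaMin_le_two_mul_specNorm (hH : H.IsHermitian)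
    (hinj : Function.Injective hH.eigenvalues) (hd : 2 ≤ d) :
    deltaMin hH ≤ 2 * specNorm H := by
  have h01 : (⟨0, by omega⟩ : Fin d) ≠ ⟨1, by omega⟩ := by simp
  refine (deltaMin_le_abs_gapS hH hinj h01).trans (abs_le.mpr ⟨?_, gapS_le hH _ _⟩)
  have := gapS_le hH (⟨1, by omega⟩ : Fin d) ⟨0, by omega⟩
  rw [gapS_swap] at this
  linarith

theorem specNorm_pos (hH : H.IsHermitian) (hinj : Function.Injective hH.eigenvalues)
    (hd : 2 ≤ d) : 0 < specNorm H := by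
  have h1 := deltaMin_pos hH hinj hd
  have h2 := deltaMin_le_two_mul_specNorm hH hinj hd
  linarith

end Gaps

/-! ### The average over the environment gap -/

section Average

variable {d : ℕ} {H : Matrix (Fin d) (Fin d) ℂ}

/-- The uniform distribution of the environment gap `γ` on `[0, 4‖H_S‖]`. -/
noncomputable def gammaLaw (H : Matrix (Fin d) (Fin d) ℂ) : Measure ℝ :=
  (volume.restrict (Set.Icc 0 (4 * specNorm H)) Set.univ)⁻¹ •
    volume.restrict (Set.Icc 0 (4 * specNorm H))

theorem isProbabilityMeasure_gammaLaw (h : 0 < specNorm H) :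
    IsProbabilityMeasure (gammaLaw H) := by
  have : NeZero (volume.restrict (Set.Icc 0 (4 * specNorm H))) := by
    refine ⟨fun h0 => ?_⟩
    rw [Measure.restrict_eq_zero, Real.volume_Icc, ENNReal.ofReal_eq_zero] at h0
    linarith
  unfold gammaLaw
  infer_instance

theorem integral_gammaLaw (h : 0 < specNorm H) (f : ℝ → ℝ) :
    ∫ γ, f γ ∂gammaLaw H =
      (4 * specNorm H)⁻¹ * ∫ γ in Set.Icc 0 (4 * specNorm H), f γ := by
  have h1 : ∫ γ, f γ ∂gammaLaw H = ⨍ γ in Set.Icc 0 (4 * specNorm H), f γ := rfl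
  rw [h1, setAverage_eq, Real.volume_real_Icc_of_le (by positivity), sub_zero, smul_eq_mul]

/-- The gap `γ = 0`, where the zero-temperature populations are those of the maximally mixed state,
has probability zero. -/
theorem ae_gammaLaw_pos : ∀ᵐ γ ∂gammaLaw H, 0 < γ := by
  unfold gammaLaw
  refine Measure.ae_smul_measure ?_ _
  rw [ae_restrict_iff' measurableSet_Icc]
  have h0 : ∀ᵐ γ : ℝ, γ ≠ 0 := by
    rw [ae_iff]
    simp
  filter_upwards [h0] with γ h1 h2
  exact lt_of_le_of_ne h2.1 h1.symm

theorem avgChannelMatrix_apply (hH : H.IsHermitian) (β : ℝ≥0∞) (α t : ℝ) (j i : Fin d) :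
    avgChannelMatrix hH β α t j i = ∫ γ, channelMatrix hH β α t γ j i ∂gammaLaw H := rfl

theorem integrable_channelMatrix (h : 0 < specNorm H) (hH : H.IsHermitian) (β : ℝ≥0∞) (α t : ℝ)
    (j i : Fin d) : Integrable (fun γ => channelMatrix hH β α t γ j i) (gammaLaw H) := by
  have := isProbabilityMeasure_gammaLaw h
  refine Integrable.of_bound (measurable_channelMatrix hH β α t j i).aestronglyMeasurable 1
    (Eventually.of_forall fun γ => ?_)
  rw [Real.norm_eq_abs, abs_of_nonneg (channelMatrix_nonneg hH β α t γ j i)]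
  exact channelMatrix_le_one hH β α t γ j i

theorem avgChannelMatrix_nonneg (hH : H.IsHermitian) (β : ℝ≥0∞) (α t : ℝ) (j i : Fin d) :
    0 ≤ avgChannelMatrix hH β α t j i := by
  rw [avgChannelMatrix_apply]
  exact integral_nonneg fun γ => channelMatrix_nonneg hH β α t γ j i

theorem sum_avgChannelMatrix (h : 0 < specNorm H) (hH : H.IsHermitian) (β : ℝ≥0∞) (α t : ℝ)
    (i : Fin d) : ∑ j, avgChannelMatrix hH β α t j i = 1 := by
  have := isProbabilityMeasure_gammaLaw h
  simp_rw [avgChannelMatrix_apply]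
  rw [← integral_finsetSum _ fun j _ => integrable_channelMatrix h hH β α t j i]
  simp_rw [sum_channelMatrix]
  simp

/-- On states diagonal in the eigenbasis, the averaged channel acts through its stochastic
matrix. -/
theorem avgChannel_eigDiag (h : 0 < specNorm H) (hH : H.IsHermitian) (β : ℝ≥0∞) (α t : ℝ)
    (p : Fin d → ℝ) :
    avgChannel H β α t (eigDiag hH p) = eigDiag hH (avgChannelMatrix hH β α t *ᵥ p) := by
  have h1 : avgChannel H β α t (eigDiag hH p) = Matrix.of fun a b =>
      ∫ γ, ((hH.eigenvectorUnitary : Matrix (Fin d) (Fin d) ℂ) *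
        Matrix.diagonal (fun i => ((channelMatrix hH β α t γ *ᵥ p) i : ℂ)) *
        (hH.eigenvectorUnitary : Matrix (Fin d) (Fin d) ℂ)ᴴ) a b ∂gammaLaw H := by
    ext a b
    change ∫ γ, channel H β α t γ (eigDiag hH p) a b ∂gammaLaw H = _
    simp_rw [channel_eigDiag]
    rfl
  have hint : ∀ i, Integrable (fun γ => (channelMatrix hH β α t γ *ᵥ p) i) (gammaLaw H) := by
    intro i
    simp only [Matrix.mulVec, dotProduct]
    exact integrable_finsetSum _ fun j _ => (integrable_channelMatrix h hH β α t i j).mul_const _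
  have hval : ∀ i, ∫ γ, (channelMatrix hH β α t γ *ᵥ p) i ∂gammaLaw H =
      (avgChannelMatrix hH β α t *ᵥ p) i := by
    intro i
    simp only [Matrix.mulVec, dotProduct]
    rw [integral_finsetSum _ fun j _ => (integrable_channelMatrix h hH β α t i j).mul_const _]
    simp_rw [integral_mul_const]
    rfl
  rw [h1, of_integral_mul_mul]
  · rw [eigDiag]
    congr 2
    ext a b
    rcases eq_or_ne a b with rfl | hab
    · simp only [Matrix.of_apply, Matrix.diagonal_apply_eq]
      rw [integral_complex_ofReal, hval]
    · simp [Matrix.diagonal_apply_ne _ hab]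
  · intro a b
    rcases eq_or_ne a b with rfl | hab
    · simp only [Matrix.diagonal_apply_eq]
      exact (hint a).ofReal
    · simp [Matrix.diagonal_apply_ne _ hab]

theorem avgChannel_iterate_eigDiag (h : 0 < specNorm H) (hH : H.IsHermitian) (β : ℝ≥0∞) (α t : ℝ)
    (p : Fin d → ℝ) (L : ℕ) :
    (avgChannel H β α t)^[L] (eigDiag hH p) =
      eigDiag hH ((fun v => avgChannelMatrix hH β α t *ᵥ v)^[L] p) := by
  induction L with
  | zero => rfl
  | succ L ih => rw [Function.iterate_succ_apply', ih, avgChannel_eigDiag h,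
      Function.iterate_succ_apply']

end Average

/-! ### On-resonance transition rates -/

section Rates

variable {d : ℕ} {H : Matrix (Fin d) (Fin d) ℂ}

/-- The truncated line shape: `sinc²` in the detuning from the Bohr frequency `e`, cut off at
`δ_min`. -/
noncomputable def lineShape (hH : H.IsHermitian) (t e γ : ℝ) : ℝ :=
  if |e - γ| ≤ deltaMin hH then Real.sinc ((e - γ) * t / 2) ^ 2 else 0

theorem lineShape_nonneg (hH : H.IsHermitian) (t e γ : ℝ) : 0 ≤ lineShape hH t e γ := by
  unfold lineShape
  split_ifs <;> positivity

theorem lineShape_le_one (hH : H.IsHermitian) (t e γ : ℝ) : lineShape hH t e γ ≤ 1 := by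
  unfold lineShape
  split_ifs
  · exact sinc_sq_le_one _
  · exact zero_le_one

theorem lineShape_neg (hH : H.IsHermitian) (t e γ : ℝ) :
    lineShape hH t (-e) (-γ) = lineShape hH t e γ := by
  unfold lineShape
  rw [show -e - -γ = -(e - γ) by ring, abs_neg, show -(e - γ) * t / 2 = -((e - γ) * t / 2) by ring,
    Real.sinc_neg]

theorem measurable_lineShape (hH : H.IsHermitian) (t e : ℝ) : Measurable (lineShape hH t e) := by
  unfold lineShape
  refine Measurable.ite (measurableSet_le (by fun_prop) measurable_const) ?_ measurable_const
  exact (continuous_sinc_sq.comp (by fun_prop : Continuous fun γ : ℝ => (e - γ) * t / 2)).measurable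

theorem onResonanceRate_eq (hH : H.IsHermitian) (β : ℝ≥0∞) (α t γ : ℝ) (i j : Fin d) :
    onResonanceRate hH β α t γ i j = alphaTildeSq d α t *
      (q₀ β γ * lineShape hH t (gapS hH i j) γ + q₁ β γ * lineShape hH t (gapS hH i j) (-γ)) := by
  unfold onResonanceRate lineShape
  rw [sub_neg_eq_add]
  split_ifs <;> ring

theorem alphaTildeSq_nonneg (d : ℕ) (α t : ℝ) : 0 ≤ alphaTildeSq d α t := by
  unfold alphaTildeSq; positivity

theorem onResonanceRate_nonneg (hH : H.IsHermitian) (β : ℝ≥0∞) (α t γ : ℝ) (i j : Fin d) :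
    0 ≤ onResonanceRate hH β α t γ i j := by
  rw [onResonanceRate_eq]
  exact mul_nonneg (alphaTildeSq_nonneg _ _ _) (add_nonneg
    (mul_nonneg (q₀_nonneg β γ) (lineShape_nonneg hH _ _ _))
    (mul_nonneg (q₁_nonneg β γ) (lineShape_nonneg hH _ _ _)))

theorem q₀_le_one (β : ℝ≥0∞) (γ : ℝ) : q₀ β γ ≤ 1 := by
  linarith [q₀_add_q₁ β γ, q₁_nonneg β γ]

theorem q₁_le_one (β : ℝ≥0∞) (γ : ℝ) : q₁ β γ ≤ 1 := by
  linarith [q₀_add_q₁ β γ, q₀_nonneg β γ]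

theorem onResonanceRate_le (hH : H.IsHermitian) (β : ℝ≥0∞) (α t γ : ℝ) (i j : Fin d) :
    onResonanceRate hH β α t γ i j ≤ alphaTildeSq d α t := by
  rw [onResonanceRate_eq]
  refine mul_le_of_le_one_right (alphaTildeSq_nonneg _ _ _) ?_
  rw [← q₀_add_q₁ β γ]
  exact add_le_add (mul_le_of_le_one_right (q₀_nonneg β γ) (lineShape_le_one hH _ _ _))
    (mul_le_of_le_one_right (q₁_nonneg β γ) (lineShape_le_one hH _ _ _))

theorem measurable_onResonanceRate (hH : H.IsHermitian) (β : ℝ≥0∞) (α t : ℝ) (i j : Fin d) :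
    Measurable fun γ => onResonanceRate hH β α t γ i j := by
  simp_rw [onResonanceRate_eq]
  exact measurable_const.mul (((measurable_q₀ β).mul (measurable_lineShape hH _ _)).add
    ((measurable_q₁ β).mul ((measurable_lineShape hH _ _).comp measurable_neg)))

theorem integrable_onResonanceRate (h : 0 < specNorm H) (hH : H.IsHermitian) (β : ℝ≥0∞)
    (α t : ℝ) (i j : Fin d) :
    Integrable (fun γ => onResonanceRate hH β α t γ i j) (gammaLaw H) := by
  have := isProbabilityMeasure_gammaLaw h
  refine Integrable.of_bound (measurable_onResonanceRate hH β α t i j).aestronglyMeasurable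
    (alphaTildeSq d α t) (Eventually.of_forall fun γ => ?_)
  rw [Real.norm_eq_abs, abs_of_nonneg (onResonanceRate_nonneg hH β α t γ i j)]
  exact onResonanceRate_le hH β α t γ i j

/-- The averaged on-resonance transition rate from `i` to `j`. -/
noncomputable def avgRate (hH : H.IsHermitian) (β : ℝ≥0∞) (α t : ℝ) (i j : Fin d) : ℝ :=
  ∫ γ, onResonanceRate hH β α t γ i j ∂gammaLaw H

theorem avgRate_nonneg (hH : H.IsHermitian) (β : ℝ≥0∞) (α t : ℝ) (i j : Fin d) :
    0 ≤ avgRate hH β α t i j :=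
  integral_nonneg fun γ => onResonanceRate_nonneg hH β α t γ i j

theorem avgTransitionMatrix_of_ne (hH : H.IsHermitian) (β : ℝ≥0∞) (α t : ℝ) {j i : Fin d}
    (hji : j ≠ i) : avgTransitionMatrix hH β α t j i = avgRate hH β α t i j := by
  change ∫ γ, transitionMatrix hH β α t γ j i ∂gammaLaw H = _
  simp only [transitionMatrix, Matrix.of_apply, if_neg hji]
  rfl

theorem avgTransitionMatrix_self (h : 0 < specNorm H) (hH : H.IsHermitian) (β : ℝ≥0∞) (α t : ℝ)
    (i : Fin d) : avgTransitionMatrix hH β α t i i =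
      -∑ k ∈ Finset.univ.erase i, avgRate hH β α t i k := by
  change ∫ γ, transitionMatrix hH β α t γ i i ∂gammaLaw H = _
  simp only [transitionMatrix, Matrix.of_apply, if_true]
  rw [integral_neg, integral_finsetSum _ fun k _ => integrable_onResonanceRate h hH β α t i k]
  rfl

theorem sum_avgTransitionMatrix (h : 0 < specNorm H) (hH : H.IsHermitian) (β : ℝ≥0∞) (α t : ℝ)
    (i : Fin d) : ∑ j, avgTransitionMatrix hH β α t j i = 0 := by
  rw [← Finset.add_sum_erase _ _ (Finset.mem_univ i), avgTransitionMatrix_self h,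
    Finset.sum_congr rfl fun j hj => avgTransitionMatrix_of_ne hH β α t (Finset.ne_of_mem_erase hj)]
  ring

theorem isGenerator_avgTransitionMatrix (h : 0 < specNorm H) (hH : H.IsHermitian) (β : ℝ≥0∞)
    (α t : ℝ) : IsGenerator (avgTransitionMatrix hH β α t) :=
  ⟨fun _ _ hij => by
    rw [avgTransitionMatrix_of_ne hH β α t hij]; exact avgRate_nonneg hH β α t _ _,
    sum_avgTransitionMatrix h hH β α t⟩

/-- The scale `α² t / (2 ‖H_S‖ (dim + 1))` of the transition rates. -/
noncomputable def rateScale (H : Matrix (Fin d) (Fin d) ℂ) (α t : ℝ) : ℝ :=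
  α ^ 2 * t / (2 * specNorm H * (2 * d + 1))

/-- For `γ > 0`, a transition that releases the energy `e ≥ δ_min` is not resonant with one that
takes energy out of the environment. -/
theorem lineShape_neg_gamma (hH : H.IsHermitian) (t : ℝ) {e γ : ℝ} (he : deltaMin hH ≤ e)
    (hγ : 0 < γ) : lineShape hH t e (-γ) = 0 := by
  unfold lineShape
  rw [if_neg]
  rw [sub_neg_eq_add, not_le]
  exact lt_of_lt_of_le (by linarith) (le_abs_self _)

/-- The total rate of a resonance whose window `[e - δ_min, e + δ_min]` lies in the support of `γ` is
independent of its position `e`. -/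
theorem alphaTildeSq_mul_integral_lineShape (hH : H.IsHermitian) (h : 0 < specNorm H) (α t : ℝ)
    {e : ℝ} (hδ : 0 ≤ deltaMin hH) (he : deltaMin hH ≤ e) (he' : e + deltaMin hH ≤ 4 * specNorm H) :
    alphaTildeSq d α t * ∫ γ, lineShape hH t e γ ∂gammaLaw H =
      rateScale H α t * sincMass (deltaMin hH * t / 2) := by
  have h1 : ∫ γ in Set.Icc 0 (4 * specNorm H), lineShape hH t e γ =
      ∫ γ in (e - deltaMin hH)..(e + deltaMin hH), Real.sinc ((e - γ) * t / 2) ^ 2 := by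
    rw [intervalIntegral.integral_of_le (by linarith), ← integral_Icc_eq_integral_Ioc]
    have h2 : lineShape hH t e = Set.indicator (Set.Icc (e - deltaMin hH) (e + deltaMin hH))
        fun γ => Real.sinc ((e - γ) * t / 2) ^ 2 := by
      funext γ
      unfold lineShape
      rw [Set.indicator_apply]
      congr 1
      rw [abs_le, Set.mem_Icc, eq_iff_iff]
      constructor <;> rintro ⟨h3, h4⟩ <;> constructor <;> linarith
    rw [h2, setIntegral_indicator measurableSet_Icc, Set.inter_eq_right.mpr]
    exact Set.Icc_subset_Icc (by linarith) he'
  rw [integral_gammaLaw h, h1]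
  have h3 := mul_integral_resonance t e (deltaMin hH)
  rw [alphaTildeSq, rateScale]
  calc _ = α ^ 2 * t / (2 * d + 1) * (4 * specNorm H)⁻¹ * (t *
        ∫ γ in (e - deltaMin hH)..(e + deltaMin hH), Real.sinc ((e - γ) * t / 2) ^ 2) := by ring
    _ = _ := by
      rw [h3]
      field_simp
      ring

theorem integrable_mul_lineShape (h : 0 < specNorm H) (hH : H.IsHermitian) (t e : ℝ) {q : ℝ → ℝ}
    (hq : Measurable q) (h0 : ∀ γ, 0 ≤ q γ) (h1 : ∀ γ, q γ ≤ 1) :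
    Integrable (fun γ => q γ * lineShape hH t e γ) (gammaLaw H) := by
  have := isProbabilityMeasure_gammaLaw h
  refine Integrable.of_bound (hq.mul (measurable_lineShape hH t e)).aestronglyMeasurable 1
    (Eventually.of_forall fun γ => ?_)
  rw [Real.norm_eq_abs, abs_of_nonneg (mul_nonneg (h0 γ) (lineShape_nonneg hH _ _ _))]
  exact mul_le_one₀ (h1 γ) (lineShape_nonneg hH _ _ _) (lineShape_le_one hH _ _ _)

theorem deltaMin_le_gapS (hH : H.IsHermitian) (hinj : Function.Injective hH.eigenvalues)
    {i j : Fin d} (hij : 0 < gapS hH i j) : deltaMin hH ≤ gapS hH i j := by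
  have hne : i ≠ j := by
    rintro rfl
    rw [gapS_self] at hij
    exact hij.false
  have := deltaMin_le_abs_gapS hH hinj hne
  rwa [abs_of_pos hij] at this

theorem avgRate_down (hH : H.IsHermitian) (hinj : Function.Injective hH.eigenvalues)
    (β : ℝ≥0∞) (α t : ℝ) {i j : Fin d} (hij : 0 < gapS hH i j) : avgRate hH β α t i j =
    alphaTildeSq d α t * ∫ γ, q₀ β γ * lineShape hH t (gapS hH i j) γ ∂gammaLaw H := by
  rw [← integral_const_mul, avgRate]
  refine integral_congr_ae ?_
  filter_upwards [ae_gammaLaw_pos] with γ hγ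
  rw [onResonanceRate_eq, lineShape_neg_gamma hH t (deltaMin_le_gapS hH hinj hij) hγ, mul_zero,
    add_zero]

theorem avgRate_up (hH : H.IsHermitian) (hinj : Function.Injective hH.eigenvalues)
    (β : ℝ≥0∞) (α t : ℝ) {i j : Fin d} (hij : 0 < gapS hH i j) : avgRate hH β α t j i =
    alphaTildeSq d α t * ∫ γ, q₁ β γ * lineShape hH t (gapS hH i j) γ ∂gammaLaw H := by
  rw [← integral_const_mul, avgRate]
  refine integral_congr_ae ?_
  filter_upwards [ae_gammaLaw_pos] with γ hγ
  have h1 : lineShape hH t (gapS hH j i) γ = 0 := by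
    rw [gapS_swap, ← lineShape_neg, neg_neg]
    exact lineShape_neg_gamma hH t (deltaMin_le_gapS hH hinj hij) hγ
  have h2 : lineShape hH t (gapS hH j i) (-γ) = lineShape hH t (gapS hH i j) γ := by
    rw [gapS_swap, lineShape_neg]
  rw [onResonanceRate_eq, h1, h2, mul_zero, zero_add]

end Rates

/-! ### Bounds on the rates and the gap -/

section RateBounds

variable {d : ℕ} {H : Matrix (Fin d) (Fin d) ℂ}

theorem boltzmann_le_one (β : ℝ≥0∞) {γ : ℝ} (hγ : 0 ≤ γ) : boltzmann β γ ≤ 1 := by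
  unfold boltzmann
  split_ifs
  · exact zero_le_one
  · exact le_rfl
  · refine Real.exp_le_one_iff.mpr ?_
    have := mul_nonneg (ENNReal.toReal_nonneg (a := β)) hγ
    linarith

theorem half_le_q₀ (β : ℝ≥0∞) {γ : ℝ} (hγ : 0 ≤ γ) : 1 / 2 ≤ q₀ β γ := by
  have h0 := boltzmann_nonneg β γ
  exact one_div_le_one_div_of_le (by linarith) (by linarith [boltzmann_le_one β hγ])

theorem q₁_top {γ : ℝ} (hγ : 0 < γ) : q₁ ⊤ γ = 0 := by
  simp [q₁, boltzmann, hγ]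

/-- The windows of all Bohr frequencies lie in the support `[0, 4‖H_S‖]` of `γ`. -/
theorem gapS_add_deltaMin_le (hH : H.IsHermitian) (hinj : Function.Injective hH.eigenvalues)
    (hd : 2 ≤ d) (i j : Fin d) : gapS hH i j + deltaMin hH ≤ 4 * specNorm H := by
  linarith [gapS_le hH i j, deltaMin_le_two_mul_specNorm hH hinj hd]

theorem integral_lineShape_gapS (hH : H.IsHermitian) (hinj : Function.Injective hH.eigenvalues)
    (hd : 2 ≤ d) (α t : ℝ) {i j : Fin d} (hij : 0 < gapS hH i j) :
    alphaTildeSq d α t * ∫ γ, lineShape hH t (gapS hH i j) γ ∂gammaLaw H =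
      rateScale H α t * sincMass (deltaMin hH * t / 2) :=
  alphaTildeSq_mul_integral_lineShape hH (specNorm_pos hH hinj hd) α t
    (deltaMin_pos hH hinj hd).le (deltaMin_le_gapS hH hinj hij)
    (gapS_add_deltaMin_le hH hinj hd i j)

/-- Since `q(0) + q(1) = 1`, the sum of the rates between two levels depends neither on the levels
nor on the temperature. -/
theorem avgRate_add_avgRate (hH : H.IsHermitian) (hinj : Function.Injective hH.eigenvalues)
    (hd : 2 ≤ d) (β : ℝ≥0∞) (α t : ℝ) {i j : Fin d} (hij : i ≠ j) :
    avgRate hH β α t i j + avgRate hH β α t j i =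
      rateScale H α t * sincMass (deltaMin hH * t / 2) := by
  have h := specNorm_pos hH hinj hd
  wlog hpos : 0 < gapS hH i j generalizing i j with hw
  · rw [add_comm]
    refine hw hij.symm ?_
    rw [gapS_swap]
    have := gapS_ne_zero hH hinj hij
    exact neg_pos.mpr (lt_of_le_of_ne (not_lt.mp hpos) this)
  rw [avgRate_down hH hinj β α t hpos, avgRate_up hH hinj β α t hpos, ← mul_add,
    ← integral_add
      (integrable_mul_lineShape h hH t _ (measurable_q₀ β) (q₀_nonneg β) (q₀_le_one β))
      (integrable_mul_lineShape h hH t _ (measurable_q₁ β) (q₁_nonneg β) (q₁_le_one β)),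
    ← integral_lineShape_gapS hH hinj hd α t hpos]
  simp_rw [← add_mul, q₀_add_q₁, one_mul]

theorem integrable_lineShape (h : 0 < specNorm H) (hH : H.IsHermitian) (t e : ℝ) :
    Integrable (lineShape hH t e) (gammaLaw H) := by
  simpa using integrable_mul_lineShape h hH t e (q := fun _ => 1) measurable_const
    (fun _ => zero_le_one) (fun _ => le_rfl)

/-- Transitions to a lower level have at least half the total rate, as `q(0) ≥ 1/2`. -/
theorem half_le_avgRate (hH : H.IsHermitian) (hinj : Function.Injective hH.eigenvalues)
    (hd : 2 ≤ d) (β : ℝ≥0∞) (α t : ℝ) {i j : Fin d} (hij : 0 < gapS hH i j) :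
    rateScale H α t * sincMass (deltaMin hH * t / 2) / 2 ≤ avgRate hH β α t i j := by
  have h := specNorm_pos hH hinj hd
  rw [avgRate_down hH hinj β α t hij, ← integral_lineShape_gapS hH hinj hd α t hij, mul_div_assoc]
  refine mul_le_mul_of_nonneg_left ?_ (alphaTildeSq_nonneg d α t)
  rw [div_eq_inv_mul, ← integral_const_mul]
  refine integral_mono_ae ((integrable_lineShape h hH t _).const_mul _)
    (integrable_mul_lineShape h hH t _ (measurable_q₀ β) (q₀_nonneg β) (q₀_le_one β)) ?_
  filter_upwards [ae_gammaLaw_pos] with γ hγ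
  refine mul_le_mul_of_nonneg_right ?_ (lineShape_nonneg _ _ _ _)
  rw [inv_eq_one_div]
  exact half_le_q₀ β hγ.le

theorem avgRate_top_up (hH : H.IsHermitian) (hinj : Function.Injective hH.eigenvalues)
    (α t : ℝ) {i j : Fin d} (hij : 0 < gapS hH i j) : avgRate hH ⊤ α t j i = 0 := by
  rw [avgRate_up hH hinj ⊤ α t hij, integral_eq_zero_of_ae, mul_zero]
  filter_upwards [ae_gammaLaw_pos] with γ hγ
  rw [q₁_top hγ, zero_mul, Pi.zero_apply]

theorem avgRate_top_down (hH : H.IsHermitian) (hinj : Function.Injective hH.eigenvalues)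
    (hd : 2 ≤ d) (α t : ℝ) {i j : Fin d} (hij : 0 < gapS hH i j) :
    avgRate hH ⊤ α t i j = rateScale H α t * sincMass (deltaMin hH * t / 2) := by
  have hne : i ≠ j := by
    rintro rfl
    rw [gapS_self] at hij
    exact hij.false
  rw [← avgRate_add_avgRate hH hinj hd ⊤ α t hne, avgRate_top_up hH hinj α t hij, add_zero]

theorem gapS_pos_of_ground (hH : H.IsHermitian) (hinj : Function.Injective hH.eigenvalues)
    {g : Fin d} (hg : ∀ j, hH.eigenvalues g ≤ hH.eigenvalues j) {j : Fin d} (hj : j ≠ g) :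
    0 < gapS hH j g :=
  sub_pos.mpr (lt_of_le_of_ne (hg j) fun h => hj (hinj h.symm))

/-- The matrix `𝔼_γ T_γ` in the time unit `2‖H_S‖(dim + 1) / (α² t)`. -/
noncomputable def rescaledMatrix (hH : H.IsHermitian) (β : ℝ≥0∞) (α t : ℝ) :
    Matrix (Fin d) (Fin d) ℝ :=
  (rateScale H α t)⁻¹ • avgTransitionMatrix hH β α t

theorem rescaledGap_eq (hH : H.IsHermitian) (β : ℝ≥0∞) (α t : ℝ) :
    rescaledGap hH β α t = spectralGap (rescaledMatrix hH β α t) := by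
  rw [rescaledGap, rescaledMatrix, rateScale, inv_div]

theorem rateScale_pos (h : 0 < specNorm H) {α t : ℝ} (hα : α ≠ 0) (ht : 0 < t) :
    0 < rateScale H α t := by
  unfold rateScale
  positivity

theorem rescaledMatrix_of_ne (hH : H.IsHermitian) (β : ℝ≥0∞) (α t : ℝ) {j i : Fin d}
    (hji : j ≠ i) :
    rescaledMatrix hH β α t j i = (rateScale H α t)⁻¹ * avgRate hH β α t i j := by
  rw [rescaledMatrix, Matrix.smul_apply, avgTransitionMatrix_of_ne hH β α t hji, smul_eq_mul]

theorem isGenerator_rescaledMatrix (h : 0 < specNorm H) (hH : H.IsHermitian) (β : ℝ≥0∞)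
    {α t : ℝ} (hα : α ≠ 0) (ht : 0 < t) : IsGenerator (rescaledMatrix hH β α t) := by
  have hκ := rateScale_pos h hα ht
  refine ⟨fun j i hji => ?_, fun i => ?_⟩
  · rw [rescaledMatrix_of_ne hH β α t hji]
    exact mul_nonneg (inv_nonneg.mpr hκ.le) (avgRate_nonneg _ _ _ _ _ _)
  · simp only [rescaledMatrix, Matrix.smul_apply]
    rw [← Finset.smul_sum, sum_avgTransitionMatrix h, smul_zero]

theorem half_le_rescaledMatrix_ground (hH : H.IsHermitian)
    (hinj : Function.Injective hH.eigenvalues) (hd : 2 ≤ d) (β : ℝ≥0∞) {α t : ℝ} (hα : α ≠ 0)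
    (ht : 0 < t) {g : Fin d} (hg : ∀ j, hH.eigenvalues g ≤ hH.eigenvalues j) {j : Fin d}
    (hj : j ≠ g) : sincMass (deltaMin hH * t / 2) / 2 ≤ rescaledMatrix hH β α t g j := by
  have hκ := rateScale_pos (specNorm_pos hH hinj hd) hα ht
  rw [rescaledMatrix_of_ne hH β α t hj.symm, inv_mul_eq_div, le_div_iff₀ hκ]
  have := half_le_avgRate hH hinj hd β α t (gapS_pos_of_ground hH hinj hg hj)
  linarith

theorem resonance_pos (hH : H.IsHermitian) (hinj : Function.Injective hH.eigenvalues)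
    (hd : 2 ≤ d) {t : ℝ} (ht : 0 < t) : 0 < sincMass (deltaMin hH * t / 2) :=
  sincMass_pos (by have := deltaMin_pos hH hinj hd; positivity)

theorem exists_ground (hH : H.IsHermitian) (hd : 2 ≤ d) :
    ∃ g : Fin d, ∀ j, hH.eigenvalues g ≤ hH.eigenvalues j := by
  have : Nonempty (Fin d) := ⟨⟨0, by omega⟩⟩
  exact Finite.exists_min hH.eigenvalues

/-- Every excited level decays to the ground state at least at half the total rate, so that
Doeblin's bound applies. -/
theorem half_le_rescaledGap (hH : H.IsHermitian) (hinj : Function.Injective hH.eigenvalues)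
    (hd : 2 ≤ d) (β : ℝ≥0∞) {α t : ℝ} (hα : α ≠ 0) (ht : 0 < t) :
    sincMass (deltaMin hH * t / 2) / 2 ≤ rescaledGap hH β α t := by
  obtain ⟨g, hg⟩ := exists_ground hH hd
  have hr := resonance_pos hH hinj hd ht
  rw [rescaledGap_eq]
  exact (isGenerator_rescaledMatrix (specNorm_pos hH hinj hd) hH β hα ht).le_spectralGap
    (g := g) (by positivity)
    (fun j hj => half_le_rescaledMatrix_ground hH hinj hd β hα ht hg hj) (by simpa using hd)

/-- The trace of the generator is fixed by the total rates between pairs of levels, whence an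
upper bound on the gap. -/
theorem rescaledGap_le (hH : H.IsHermitian) (hinj : Function.Injective hH.eigenvalues)
    (hd : 2 ≤ d) (β : ℝ≥0∞) {α t : ℝ} (hα : α ≠ 0) (ht : 0 < t) :
    rescaledGap hH β α t ≤ d * sincMass (deltaMin hH * t / 2) / 2 := by
  have h := specNorm_pos hH hinj hd
  have hκ := rateScale_pos h hα ht
  set r := sincMass (deltaMin hH * t / 2) with hr
  set κ := rateScale H α t with hκd
  have h1 := spectralGap_mul_le_neg_trace (Q := rescaledMatrix hH β α t) (by simpa using hd)
    (isGenerator_rescaledMatrix h hH β hα ht).colSum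
  have h2 : -(rescaledMatrix hH β α t).trace =
      κ⁻¹ * ∑ i, ∑ k ∈ Finset.univ.erase i, avgRate hH β α t i k := by
    simp only [Matrix.trace, Matrix.diag_apply, rescaledMatrix, Matrix.smul_apply, smul_eq_mul,
      avgTransitionMatrix_self h hH β α t]
    rw [← Finset.mul_sum, Finset.sum_neg_distrib, mul_neg, neg_neg]
  have hoff : ∀ f : Fin d → Fin d → ℝ, ∑ i, ∑ k ∈ Finset.univ.erase i, f i k =
      ∑ i, ∑ k, if k ≠ i then f i k else 0 := by
    intro f
    refine Finset.sum_congr rfl fun i _ => ?_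
    rw [← Finset.sum_filter]
    refine Finset.sum_congr ?_ fun _ _ => rfl
    ext k
    simp
  -- Each of the unordered pairs of levels contributes `κ r` to the trace.
  have h3 : 2 * ∑ i, ∑ k ∈ Finset.univ.erase i, avgRate hH β α t i k =
      d * ((d - 1) * (κ * r)) := by
    have h4 : ∑ i, ∑ k ∈ Finset.univ.erase i, avgRate hH β α t i k =
        ∑ i, ∑ k ∈ Finset.univ.erase i, avgRate hH β α t k i := by
      rw [hoff, hoff, Finset.sum_comm]
      simp_rw [ne_comm]
    rw [two_mul]
    nth_rewrite 2 [h4]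
    rw [← Finset.sum_add_distrib]
    have h5 : ∀ i : Fin d, ∑ k ∈ Finset.univ.erase i, avgRate hH β α t i k +
        ∑ k ∈ Finset.univ.erase i, avgRate hH β α t k i = (d - 1) * (κ * r) := by
      intro i
      rw [← Finset.sum_add_distrib, Finset.sum_congr rfl fun k hk =>
        avgRate_add_avgRate hH hinj hd β α t (Finset.ne_of_mem_erase hk).symm, Finset.sum_const,
        Finset.card_erase_of_mem (Finset.mem_univ i), Finset.card_fin, nsmul_eq_mul,
        Nat.cast_sub (by omega), Nat.cast_one]
    rw [Finset.sum_congr rfl fun i _ => h5 i]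
    simp
  rw [← rescaledGap_eq, h2, Fintype.card_fin] at h1
  have hd1 : (0 : ℝ) < (d : ℝ) - 1 := by
    have : (2 : ℝ) ≤ d := by exact_mod_cast hd
    linarith
  have h6 : κ⁻¹ * ∑ i, ∑ k ∈ Finset.univ.erase i, avgRate hH β α t i k =
      d * r / 2 * (d - 1) := by
    rw [inv_mul_eq_div, div_eq_iff hκ.ne']
    linarith
  rw [h6] at h1
  exact le_of_mul_le_mul_right h1 hd1

theorem rescaledGap_pos (hH : H.IsHermitian) (hinj : Function.Injective hH.eigenvalues)
    (hd : 2 ≤ d) (β : ℝ≥0∞) {α t : ℝ} (hα : α ≠ 0) (ht : 0 < t) : 0 < rescaledGap hH β α t := by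
  have := half_le_rescaledGap hH hinj hd β hα ht
  have := resonance_pos hH hinj hd ht
  linarith

theorem rescaledGap_le_two_mul (hH : H.IsHermitian) (hinj : Function.Injective hH.eigenvalues)
    (hd : 2 ≤ d) (β : ℝ≥0∞) {α t : ℝ} (hα : α ≠ 0) (ht : 0 < t) :
    rescaledGap hH β α t ≤ 2 * d := by
  have h1 := rescaledGap_le hH hinj hd β hα ht
  have h2 := sincMass_le_four (deltaMin hH * t / 2)
  have h3 : (0 : ℝ) ≤ d := Nat.cast_nonneg d
  nlinarith

end RateBounds

/-! ### Continuity of the gap -/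

section Continuity

variable {d : ℕ} {H : Matrix (Fin d) (Fin d) ℂ}

/-- The resonance profile: the transition rate in units of `α̃²`. -/
noncomputable def rateProfile (hH : H.IsHermitian) (β : ℝ≥0∞) (t : ℝ) (i j : Fin d) (γ : ℝ) : ℝ :=
  q₀ β γ * lineShape hH t (gapS hH i j) γ + q₁ β γ * lineShape hH t (gapS hH i j) (-γ)

theorem avgRate_eq (hH : H.IsHermitian) (β : ℝ≥0∞) (α t : ℝ) (i j : Fin d) :
    avgRate hH β α t i j = alphaTildeSq d α t * ∫ γ, rateProfile hH β t i j γ ∂gammaLaw H := by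
  rw [← integral_const_mul, avgRate]
  simp_rw [onResonanceRate_eq]
  rfl

theorem abs_rateProfile_le_one (hH : H.IsHermitian) (β : ℝ≥0∞) (t : ℝ) (i j : Fin d) (γ : ℝ) :
    ‖rateProfile hH β t i j γ‖ ≤ 1 := by
  have h0 := q₀_nonneg β γ
  have h1 := q₁_nonneg β γ
  rw [rateProfile, Real.norm_eq_abs, abs_of_nonneg (add_nonneg
    (mul_nonneg h0 (lineShape_nonneg _ _ _ _)) (mul_nonneg h1 (lineShape_nonneg _ _ _ _))),
    ← q₀_add_q₁ β γ]
  exact add_le_add (mul_le_of_le_one_right h0 (lineShape_le_one _ _ _ _))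
    (mul_le_of_le_one_right h1 (lineShape_le_one _ _ _ _))

theorem measurable_rateProfile (hH : H.IsHermitian) (β : ℝ≥0∞) (t : ℝ) (i j : Fin d) :
    Measurable (rateProfile hH β t i j) :=
  ((measurable_q₀ β).mul (measurable_lineShape hH _ _)).add
    ((measurable_q₁ β).mul ((measurable_lineShape hH _ _).comp measurable_neg))

theorem tendsto_integral_rateProfile {ι : Type*} {l : Filter ι} [l.IsCountablyGenerated]
    (h : 0 < specNorm H) (hH : H.IsHermitian) {b : ι → ℝ≥0∞} {β : ℝ≥0∞} {s : ι → ℝ} {t : ℝ}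
    (i j : Fin d)
    (hlim : ∀ γ, 0 < γ → Tendsto (fun x => rateProfile hH (b x) (s x) i j γ) l
      (𝓝 (rateProfile hH β t i j γ))) :
    Tendsto (fun x => ∫ γ, rateProfile hH (b x) (s x) i j γ ∂gammaLaw H) l
      (𝓝 (∫ γ, rateProfile hH β t i j γ ∂gammaLaw H)) := by
  have := isProbabilityMeasure_gammaLaw h
  refine tendsto_integral_filter_of_dominated_convergence (fun _ => 1)
    (Eventually.of_forall fun x => (measurable_rateProfile hH _ _ i j).aestronglyMeasurable)
    (Eventually.of_forall fun x => Eventually.of_forall fun γ =>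
      abs_rateProfile_le_one hH _ _ i j γ) (integrable_const _) ?_
  filter_upwards [ae_gammaLaw_pos] with γ hγ using hlim γ hγ

/-- The rescaled generator depends continuously on the rate profiles. -/
theorem tendsto_rescaledMatrix {ι : Type*} {l : Filter ι} (h : 0 < specNorm H)
    (hH : H.IsHermitian) {α : ℝ} {b : ι → ℝ≥0∞} {β : ℝ≥0∞} {s : ι → ℝ} {t : ℝ} (hα : α ≠ 0)
    (ht : 0 < t) (hs : Tendsto s l (𝓝 t))
    (hlim : ∀ i j, Tendsto (fun x => ∫ γ, rateProfile hH (b x) (s x) i j γ ∂gammaLaw H) l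
      (𝓝 (∫ γ, rateProfile hH β t i j γ ∂gammaLaw H))) :
    Tendsto (fun x => rescaledMatrix hH (b x) α (s x)) l (𝓝 (rescaledMatrix hH β α t)) := by
  have hrate : ∀ i j, Tendsto (fun x => avgRate hH (b x) α (s x) i j) l
      (𝓝 (avgRate hH β α t i j)) := by
    intro i j
    simp_rw [avgRate_eq]
    refine Tendsto.mul ?_ (hlim i j)
    have hc : Continuous fun t : ℝ => alphaTildeSq d α t := by unfold alphaTildeSq; fun_prop
    exact (hc.tendsto t).comp hs
  have hκ : Tendsto (fun x => (rateScale H α (s x))⁻¹) l (𝓝 (rateScale H α t)⁻¹) := by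
    refine Tendsto.inv₀ ?_ (rateScale_pos h hα ht).ne'
    have hc : Continuous fun t : ℝ => rateScale H α t := by unfold rateScale; fun_prop
    exact (hc.tendsto t).comp hs
  refine tendsto_pi_nhds.mpr fun j => tendsto_pi_nhds.mpr fun i => ?_
  refine hκ.mul ?_
  rcases eq_or_ne j i with rfl | hji
  · simp_rw [avgTransitionMatrix_self h]
    exact (tendsto_finsetSum _ fun k _ => hrate j k).neg
  · simp_rw [avgTransitionMatrix_of_ne hH _ _ _ hji]
    exact hrate i j

theorem tendsto_rescaledGap {ι : Type*} {l : Filter ι} (hH : H.IsHermitian)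
    (hinj : Function.Injective hH.eigenvalues) (hd : 2 ≤ d) {α : ℝ}
    {b : ι → ℝ≥0∞} {β : ℝ≥0∞} {s : ι → ℝ} {t : ℝ} (hα : α ≠ 0) (ht : 0 < t)
    (h : Tendsto (fun x => rescaledMatrix hH (b x) α (s x)) l (𝓝 (rescaledMatrix hH β α t))) :
    Tendsto (fun x => rescaledGap hH (b x) α (s x)) l (𝓝 (rescaledGap hH β α t)) := by
  have hsn := specNorm_pos hH hinj hd
  simp_rw [rescaledGap_eq]
  refine tendsto_spectralGap (by simpa using hd) (fun x i => ?_)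
    (isGenerator_rescaledMatrix hsn hH β hα ht).colSum h
  simp only [rescaledMatrix, Matrix.smul_apply]
  rw [← Finset.smul_sum, sum_avgTransitionMatrix hsn, smul_zero]

theorem continuous_lineShape_time (hH : H.IsHermitian) (e γ : ℝ) :
    Continuous fun t => lineShape hH t e γ := by
  unfold lineShape
  split_ifs
  · exact continuous_sinc_sq.comp (by fun_prop : Continuous fun t : ℝ => (e - γ) * t / 2)
  · exact continuous_const

theorem continuousOn_rescaledGap (hH : H.IsHermitian) (hinj : Function.Injective hH.eigenvalues)
    (hd : 2 ≤ d) (β : ℝ≥0∞) {α : ℝ} (hα : α ≠ 0) :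
    ContinuousOn (fun t => rescaledGap hH β α t) (Set.Ioi 0) := by
  intro t ht
  have hsn := specNorm_pos hH hinj hd
  refine ContinuousAt.continuousWithinAt ?_
  refine tendsto_rescaledGap (b := fun _ => β) hH hinj hd hα ht
    (tendsto_rescaledMatrix (b := fun _ => β) hsn hH hα ht tendsto_id fun i j => ?_)
  refine tendsto_integral_rateProfile (b := fun _ => β) hsn hH i j fun γ _ => ?_
  refine Continuous.tendsto (f := fun t => rateProfile hH β t i j γ) ?_ t
  exact (continuous_const.mul (continuous_lineShape_time hH _ _)).add
    (continuous_const.mul (continuous_lineShape_time hH _ _))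

theorem tendsto_boltzmann_atTop {γ : ℝ} (hγ : 0 < γ) :
    Tendsto (fun β : ℝ≥0 => boltzmann β γ) atTop (𝓝 (boltzmann ⊤ γ)) := by
  have h1 : boltzmann ⊤ γ = 0 := by simp [boltzmann, hγ]
  have h2 : ∀ β : ℝ≥0, boltzmann β γ = Real.exp (-(β * γ : ℝ)) := by
    intro β
    simp [boltzmann]
  simp_rw [h1, h2]
  refine Real.tendsto_exp_neg_atTop_nhds_zero.comp ?_
  exact (NNReal.tendsto_coe_atTop.mpr tendsto_id).atTop_mul_const hγ

theorem tendsto_rescaledMatrix_atTop (h : 0 < specNorm H) (hH : H.IsHermitian) {α t : ℝ}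
    (hα : α ≠ 0) (ht : 0 < t) :
    Tendsto (fun β : ℝ≥0 => rescaledMatrix hH β α t) atTop (𝓝 (rescaledMatrix hH ⊤ α t)) := by
  refine tendsto_rescaledMatrix (s := fun _ => t) h hH hα ht tendsto_const_nhds fun i j => ?_
  refine tendsto_integral_rateProfile (s := fun _ => t) h hH i j fun γ hγ => ?_
  have hb := tendsto_boltzmann_atTop hγ
  -- `q(0)` and `q(1)` are continuous functions of the Boltzmann factor.
  have hne : 1 + boltzmann ⊤ γ ≠ 0 := by
    have := boltzmann_nonneg ⊤ γ
    positivity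
  have h0 : Tendsto (fun β : ℝ≥0 => q₀ β γ) atTop (𝓝 (q₀ ⊤ γ)) :=
    tendsto_const_nhds.div (tendsto_const_nhds.add hb) hne
  have h1 : Tendsto (fun β : ℝ≥0 => q₁ β γ) atTop (𝓝 (q₁ ⊤ γ)) :=
    hb.div (tendsto_const_nhds.add hb) hne
  exact (h0.mul_const _).add (h1.mul_const _)

/-- The rescaled gap does not depend on the interaction strength. -/
theorem rescaledGap_eq_of_ne_zero (h : 0 < specNorm H) (hH : H.IsHermitian) (β : ℝ≥0∞) {α t : ℝ}
    (hα : α ≠ 0) : rescaledGap hH β α t = rescaledGap hH β 1 t := by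
  rw [rescaledGap_eq, rescaledGap_eq]
  congr 1
  have h1 : ∀ i j, (rateScale H α t)⁻¹ * avgRate hH β α t i j =
      (rateScale H 1 t)⁻¹ * avgRate hH β 1 t i j := by
    intro i j
    rw [avgRate_eq, avgRate_eq, ← mul_assoc, ← mul_assoc]
    congr 1
    rw [rateScale, rateScale, alphaTildeSq, alphaTildeSq]
    rcases eq_or_ne t 0 with rfl | ht
    · simp
    · field_simp
  ext j i
  rcases eq_or_ne j i with rfl | hji
  · simp only [rescaledMatrix, Matrix.smul_apply, avgTransitionMatrix_self h, smul_eq_mul, mul_neg,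
      Finset.mul_sum, h1]
  · rw [rescaledMatrix_of_ne hH β α t hji, rescaledMatrix_of_ne hH β 1 t hji, h1]

end Continuity

/-! ### States commuting with the Hamiltonian -/

section States

variable {d : ℕ} {H : Matrix (Fin d) (Fin d) ℂ}

theorem eigDiag_sub (hH : H.IsHermitian) (p q : Fin d → ℝ) :
    eigDiag hH p - eigDiag hH q = eigDiag hH (p - q) := by
  unfold eigDiag
  rw [← Matrix.sub_mul, ← Matrix.mul_sub, Matrix.diagonal_sub]
  simp

theorem eigDiag_mul (hH : H.IsHermitian) (p q : Fin d → ℝ) :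
    eigDiag hH p * eigDiag hH q = eigDiag hH (p * q) := by
  rw [eigDiag_eq_iff]
  have h1 := (eigDiag_eq_iff hH _ p).mp rfl
  have h2 := (eigDiag_eq_iff hH _ q).mp rfl
  have h3 := unitary_mul_conjTranspose hH.eigenvectorUnitary
  set P : Matrix (Fin d) (Fin d) ℂ := (hH.eigenvectorUnitary : Matrix (Fin d) (Fin d) ℂ) with hP
  calc Pᴴ * (eigDiag hH p * eigDiag hH q) * P
      = Pᴴ * eigDiag hH p * (P * Pᴴ) * eigDiag hH q * P := by
        rw [h3, mul_one]; simp only [Matrix.mul_assoc]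
    _ = (Pᴴ * eigDiag hH p * P) * (Pᴴ * eigDiag hH q * P) := by simp only [Matrix.mul_assoc]
    _ = _ := by rw [h1, h2, Matrix.diagonal_mul_diagonal]; simp

theorem eigDiag_injective (hH : H.IsHermitian) : Function.Injective (eigDiag hH) := by
  intro p q h
  have h1 := (eigDiag_eq_iff hH _ q).mp h
  rw [(eigDiag_eq_iff hH _ p).mp rfl] at h1
  funext i
  exact_mod_cast congrFun (Matrix.diagonal_injective h1) i

theorem conjTranspose_eigDiag (hH : H.IsHermitian) (p : Fin d → ℝ) :
    (eigDiag hH p)ᴴ = eigDiag hH p :=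
  Matrix.isHermitian_mul_mul_conjTranspose _ (isHermitian_diagonal_ofReal p)

theorem charpoly_eigDiag (hH : H.IsHermitian) (p : Fin d → ℝ) :
    (eigDiag hH p).charpoly.roots = Finset.univ.val.map fun i => (p i : ℂ) := by
  rw [eigDiag, Matrix.charpoly_mul_comm, ← Matrix.mul_assoc, unitary_conjTranspose_mul, one_mul,
    Matrix.charpoly_diagonal]
  have h := Polynomial.roots_multiset_prod_X_sub_C (Finset.univ.val.map fun i => (p i : ℂ))
  rwa [Multiset.map_map] at h

/-- For matrices diagonal in the eigenbasis, the trace norm is the `ℓ¹` norm. -/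
theorem traceNorm_eigDiag (hH : H.IsHermitian) (x : Fin d → ℝ) :
    traceNorm (eigDiag hH x) = ∑ i, |x i| := by
  have h1 : (eigDiag hH x)ᴴ * eigDiag hH x = eigDiag hH (x * x) := by
    rw [conjTranspose_eigDiag, eigDiag_mul]
  have h2 := (Matrix.isHermitian_conjTranspose_mul_self
    (eigDiag hH x)).roots_charpoly_eq_eigenvalues
  have h2 := (charpoly_eigDiag hH (x * x)).symm.trans ((congrArg (fun A =>
    A.charpoly.roots) h1).symm.trans h2)
  have h3 := congrArg (fun s : Multiset ℂ => (s.map fun z : ℂ => √z.re).sum) h2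
  simp only [Multiset.map_map, Function.comp_def] at h3
  unfold traceNorm
  refine Eq.trans ?_ (h3.symm.trans ?_)
  · rfl
  · refine Finset.sum_congr rfl fun i _ => ?_
    rw [Complex.ofReal_re, Pi.mul_apply, Real.sqrt_mul_self_eq_abs]

theorem trace_eigDiag (hH : H.IsHermitian) (p : Fin d → ℝ) :
    (eigDiag hH p).trace = ((∑ i, p i : ℝ) : ℂ) := by
  rw [eigDiag, Matrix.trace_mul_comm, ← Matrix.mul_assoc, unitary_conjTranspose_mul, one_mul,
    Matrix.trace_diagonal, Complex.ofReal_sum]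

/-- Since the spectrum is simple, the states commuting with the Hamiltonian are the mixtures of
its eigenstates. -/
theorem isState_and_commute_iff (hH : H.IsHermitian) (hinj : Function.Injective hH.eigenvalues)
    (ρ : Matrix (Fin d) (Fin d) ℂ) : IsState ρ ∧ Commute ρ H ↔
      ∃ p : Fin d → ℝ, (∀ i, 0 ≤ p i) ∧ ∑ i, p i = 1 ∧ ρ = eigDiag hH p := by
  constructor
  · rintro ⟨⟨hpos, htr⟩, hcomm⟩
    have hPP := unitary_mul_conjTranspose hH.eigenvectorUnitary
    have hD := (eigDiag_eq_iff hH H hH.eigenvalues).mp (eigDiag_eigenvalues hH).symm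
    have hBpos := hpos.conjTranspose_mul_mul_same
      (hH.eigenvectorUnitary : Matrix (Fin d) (Fin d) ℂ)
    set P : Matrix (Fin d) (Fin d) ℂ := (hH.eigenvectorUnitary : Matrix (Fin d) (Fin d) ℂ) with hP
    set B := Pᴴ * ρ * P with hB
    set D : Matrix (Fin d) (Fin d) ℂ := Matrix.diagonal fun i => (hH.eigenvalues i : ℂ) with hDd
    -- In the eigenbasis `ρ` becomes `B` and `H` becomes `D`; the entry `(i, j)` of `BD = DB` reads
    -- `B i j (λ_j - λ_i) = 0`.
    have hBD : B * D = D * B := by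
      rw [hB, ← hD]
      calc Pᴴ * ρ * P * (Pᴴ * H * P) = Pᴴ * ρ * (P * Pᴴ) * H * P := by
            simp only [Matrix.mul_assoc]
        _ = Pᴴ * (ρ * H) * P := by rw [hPP, mul_one]; simp only [Matrix.mul_assoc]
        _ = Pᴴ * H * (P * Pᴴ) * ρ * P := by
            rw [hcomm.eq, hPP, mul_one]; simp only [Matrix.mul_assoc]
        _ = Pᴴ * H * P * (Pᴴ * ρ * P) := by simp only [Matrix.mul_assoc]
    have hoff : ∀ i j, i ≠ j → B i j = 0 := by
      intro i j hij
      have h1 := congrFun (congrFun hBD i) j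
      rw [Matrix.mul_diagonal, Matrix.diagonal_mul] at h1
      have h2 : B i j * ((hH.eigenvalues j : ℂ) - hH.eigenvalues i) = 0 := by
        rw [mul_sub, h1]; ring
      rcases mul_eq_zero.mp h2 with h3 | h3
      · exact h3
      · exact absurd (hinj (by exact_mod_cast sub_eq_zero.mp h3)) hij.symm
    have hdiag : ∀ i, 0 ≤ B i i := fun i => hBpos.diag_nonneg
    have hre : ∀ i, B i i = ((B i i).re : ℂ) := fun i =>
      Complex.ext rfl (by simpa using (Complex.nonneg_iff.mp (hdiag i)).2.symm)
    have heq : ρ = eigDiag hH fun i => (B i i).re := by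
      rw [eigDiag_eq_iff, ← hP, ← hB]
      ext i j
      rcases eq_or_ne i j with rfl | hij
      · rw [Matrix.diagonal_apply_eq]; exact hre i
      · rw [Matrix.diagonal_apply_ne _ hij, hoff i j hij]
    refine ⟨_, fun i => (Complex.nonneg_iff.mp (hdiag i)).1, ?_, heq⟩
    rw [heq, trace_eigDiag] at htr
    exact_mod_cast htr
  · rintro ⟨p, hp, hsum, rfl⟩
    refine ⟨⟨?_, ?_⟩, ?_⟩
    · refine Matrix.PosSemidef.mul_mul_conjTranspose_same ?_ _
      rw [Matrix.posSemidef_diagonal_iff]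
      exact fun i => by exact_mod_cast hp i
    · rw [trace_eigDiag, hsum, Complex.ofReal_one]
    · have h1 : eigDiag hH p * eigDiag hH hH.eigenvalues =
          eigDiag hH hH.eigenvalues * eigDiag hH p := by
        rw [eigDiag_mul, eigDiag_mul, mul_comm]
      rw [eigDiag_eigenvalues] at h1
      exact h1

theorem eigDiag_apply (hH : H.IsHermitian) (p : Fin d → ℝ) (a b : Fin d) :
    eigDiag hH p a b = ∑ j, (hH.eigenvectorBasis j a) * p j * star (hH.eigenvectorBasis j b) := by
  rw [eigDiag, Matrix.mul_apply]
  refine Finset.sum_congr rfl fun j _ => ?_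
  rw [Matrix.mul_diagonal, Matrix.conjTranspose_apply]
  rfl

theorem eigenProj_eq (hH : H.IsHermitian) (i : Fin d) :
    eigenProj hH i = eigDiag hH (Pi.single i 1) := by
  ext a b
  rw [eigDiag_apply, Finset.sum_eq_single i]
  · simp [eigenProj, Matrix.vecMulVec_apply]
  · intro j _ hj
    simp [Pi.single_eq_of_ne hj]
  · simp

theorem expectation_eigDiag (hH : H.IsHermitian) (p : Fin d → ℝ) (i : Fin d) :
    star ⇑(hH.eigenvectorBasis i) ⬝ᵥ (eigDiag hH p *ᵥ ⇑(hH.eigenvectorBasis i)) = (p i : ℂ) := by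
  have h1 := congrFun (congrFun ((eigDiag_eq_iff hH _ p).mp rfl) i) i
  rw [Matrix.diagonal_apply_eq, Matrix.mul_assoc, Matrix.mul_apply] at h1
  rw [← h1]
  refine Finset.sum_congr rfl fun a _ => ?_
  rw [Matrix.conjTranspose_apply, Matrix.mul_apply]
  rfl

theorem avgOnResonanceMap_eigDiag (hH : H.IsHermitian) (β : ℝ≥0∞) (α t : ℝ) (p : Fin d → ℝ) :
    avgOnResonanceMap hH β α t (eigDiag hH p) =
      eigDiag hH (avgTransitionMatrix hH β α t *ᵥ p) := by
  unfold avgOnResonanceMap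
  simp_rw [expectation_eigDiag, eigenProj]
  ext a b
  rw [Finset.sum_comm, eigDiag_apply, Matrix.sum_apply]
  refine Finset.sum_congr rfl fun j _ => ?_
  rw [Matrix.sum_apply]
  simp only [Matrix.smul_apply, Matrix.vecMulVec_apply, Matrix.mulVec, dotProduct,
    Complex.ofReal_sum, Complex.ofReal_mul, smul_eq_mul, Finset.mul_sum, Finset.sum_mul,
    Pi.star_apply]
  refine Finset.sum_congr rfl fun i _ => ?_
  ring

theorem isFixedState_iff (hH : H.IsHermitian) (hinj : Function.Injective hH.eigenvalues)
    (β : ℝ≥0∞) (α t : ℝ) (ρ : Matrix (Fin d) (Fin d) ℂ) : IsFixedState hH β α t ρ ↔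
      ∃ p : Fin d → ℝ, (∀ i, 0 ≤ p i) ∧ ∑ i, p i = 1 ∧ ρ = eigDiag hH p ∧
        avgTransitionMatrix hH β α t *ᵥ p = 0 := by
  have h0 : eigDiag hH 0 = 0 := by simp [eigDiag]
  unfold IsFixedState
  rw [← and_assoc, isState_and_commute_iff hH hinj]
  constructor
  · rintro ⟨⟨p, hp, hsum, rfl⟩, h⟩
    refine ⟨p, hp, hsum, rfl, ?_⟩
    rw [avgOnResonanceMap_eigDiag, add_eq_left, ← h0] at h
    exact eigDiag_injective hH h
  · rintro ⟨p, hp, hsum, rfl, h⟩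
    refine ⟨⟨p, hp, hsum, rfl⟩, ?_⟩
    rw [avgOnResonanceMap_eigDiag, h, h0, add_zero]

theorem half_le_avgTransitionMatrix_ground (hH : H.IsHermitian)
    (hinj : Function.Injective hH.eigenvalues) (hd : 2 ≤ d) (β : ℝ≥0∞) (α t : ℝ)
    {g : Fin d} (hg : ∀ j, hH.eigenvalues g ≤ hH.eigenvalues j) {j : Fin d} (hj : j ≠ g) :
    rateScale H α t * sincMass (deltaMin hH * t / 2) / 2 ≤ avgTransitionMatrix hH β α t g j := by
  rw [avgTransitionMatrix_of_ne hH β α t hj.symm]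
  exact half_le_avgRate hH hinj hd β α t (gapS_pos_of_ground hH hinj hg hj)

theorem existsUnique_isFixedState (hH : H.IsHermitian) (hinj : Function.Injective hH.eigenvalues)
    (hd : 2 ≤ d) (β : ℝ≥0∞) {α t : ℝ} (hα : α ≠ 0) (ht : 0 < t) :
    ∃! ρ : Matrix (Fin d) (Fin d) ℂ, IsFixedState hH β α t ρ := by
  have h := specNorm_pos hH hinj hd
  obtain ⟨g, hg⟩ := exists_ground hH hd
  have hc : 0 < rateScale H α t * sincMass (deltaMin hH * t / 2) / 2 := by
    have := rateScale_pos h hα ht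
    have := resonance_pos hH hinj hd ht
    positivity
  have hgen := isGenerator_avgTransitionMatrix h hH β α t
  have hT := fun j hj => half_le_avgTransitionMatrix_ground hH hinj hd β α t hg (j := j) hj
  obtain ⟨p, hp, hsum, hp0⟩ := hgen.exists_stationary hc hT
  refine ⟨eigDiag hH p, (isFixedState_iff hH hinj β α t _).mpr ⟨p, hp, hsum, rfl, hp0⟩, ?_⟩
  rintro ρ hρ
  obtain ⟨q, hq, hqsum, rfl, hq0⟩ := (isFixedState_iff hH hinj β α t _).mp hρ
  congr 1
  refine sub_eq_zero.mp (hgen.eq_zero_of_mulVec_eq_zero hc hT (v := q - p) ?_ ?_)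
  · simp [hqsum, hsum]
  · rw [Matrix.mulVec_sub, hq0, hp0, sub_zero]

end States

/-! ### The channel as a perturbed Markov chain -/

section SecondOrder

theorem sum_abs_integral_le {Ω ι : Type*} [MeasurableSpace Ω] {ν : Measure Ω} (s : Finset ι)
    {f : ι → Ω → ℝ} {B : Ω → ℝ} (hf : ∀ a ∈ s, Integrable (f a) ν) (hB : Integrable B ν)
    (h : ∀ ω, ∑ a ∈ s, |f a ω| ≤ B ω) : ∑ a ∈ s, |∫ ω, f a ω ∂ν| ≤ ∫ ω, B ω ∂ν := by
  calc ∑ a ∈ s, |∫ ω, f a ω ∂ν| ≤ ∑ a ∈ s, ∫ ω, |f a ω| ∂ν :=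
        Finset.sum_le_sum fun a _ => abs_integral_le_integral_abs
    _ = ∫ ω, ∑ a ∈ s, |f a ω| ∂ν := (integral_finsetSum _ fun a ha => (hf a ha).abs).symm
    _ ≤ ∫ ω, B ω ∂ν := integral_mono (integrable_finsetSum _ fun a ha => (hf a ha).abs) hB h

open scoped Matrix.Norms.L2Operator in
/-- Averaging second-order perturbation theory over the interaction: the Haar average fixes the
squared matrix elements, the Gaussian third moments control the error. -/
theorem sum_abs_meanTransitionProb_sub_le {n : Type*} [Fintype n] [DecidableEq n] (h : n → ℝ)
    {α t : ℝ} (hα : 0 ≤ α) (ht : 0 ≤ t) (b : n) :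
    ∑ a ∈ Finset.univ.erase b, |meanTransitionProb h α t a b -
      (α * t) ^ 2 * (1 / (Fintype.card n + 1)) * Real.sinc ((h a - h b) * t / 2) ^ 2| ≤
      2 * (α * t) ^ 3 * (Fintype.card n * (2 * √(Real.pi / 2))) := by
  have hint : ∀ a, Integrable (fun ω => transitionProb h α t (interaction ω) a b -
      (α * t) ^ 2 * Complex.normSq (interaction ω a b) * Real.sinc ((h a - h b) * t / 2) ^ 2)
      (interactionLaw n) := fun a => (integrable_transitionProb h α t a b).sub
    (((integrable_normSq_interaction a b).const_mul _).mul_const _)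
  have hval : ∀ a ∈ Finset.univ.erase b, meanTransitionProb h α t a b -
      (α * t) ^ 2 * (1 / (Fintype.card n + 1)) * Real.sinc ((h a - h b) * t / 2) ^ 2 =
      ∫ ω, (transitionProb h α t (interaction ω) a b - (α * t) ^ 2 *
        Complex.normSq (interaction ω a b) * Real.sinc ((h a - h b) * t / 2) ^ 2)
        ∂interactionLaw n := by
    intro a ha
    rw [integral_sub (integrable_transitionProb h α t a b)
      (((integrable_normSq_interaction a b).const_mul _).mul_const _), integral_mul_const,
      integral_const_mul, integral_normSq_interaction (Finset.ne_of_mem_erase ha)]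
    rfl
  rw [Finset.sum_congr rfl fun a ha => congrArg abs (hval a ha)]
  refine (sum_abs_integral_le (B := fun ω => 2 * (α * t) ^ 3 * ∑ k, |ω.2 k| ^ 3) _
    (fun a _ => hint a) (integrable_sum_abs_pow_three.const_mul _) fun ω => ?_).trans ?_
  · refine (sum_abs_transitionProb_sub_le (isHermitian_interaction ω) hα ht b).trans ?_
    rw [mul_pow, ← mul_assoc]
    exact mul_le_mul_of_nonneg_left (norm_interaction_pow_three_le ω) (by positivity)
  · rw [integral_const_mul]
    exact mul_le_mul_of_nonneg_left integral_sum_abs_pow_three_le (by positivity)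

variable {d : ℕ} {H : Matrix (Fin d) (Fin d) ℂ}

/-- The second-order transition rates of the channel, resonant or not. -/
noncomputable def secondOrderRate (hH : H.IsHermitian) (β : ℝ≥0∞) (α t γ : ℝ) (i j : Fin d) : ℝ :=
  alphaTildeSq d α t * (Real.sinc (gapS hH i j * t / 2) ^ 2 +
    q₀ β γ * Real.sinc ((gapS hH i j - γ) * t / 2) ^ 2 +
    q₁ β γ * Real.sinc ((gapS hH i j + γ) * t / 2) ^ 2)

/-- The second-order rate as a sum over the initial and final states of the environment. -/
theorem secondOrderRate_eq_sum (hH : H.IsHermitian) (β : ℝ≥0∞) (α t γ : ℝ) (i j : Fin d) :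
    secondOrderRate hH β α t γ i j = ∑ k, ∑ l,
      (α * t) ^ 2 * (1 / (Fintype.card (Fin d × Fin 2) + 1)) *
        Real.sinc ((jointEnergy hH γ (j, l) - jointEnergy hH γ (i, k)) * t / 2) ^ 2 *
        envPop β γ k := by
  have hneg : ∀ x y : ℝ, y = -x → Real.sinc y = Real.sinc x := by
    rintro x y rfl
    exact Real.sinc_neg x
  have hcard : ((Fintype.card (Fin d × Fin 2) : ℕ) : ℝ) = 2 * d := by
    simp [mul_comm]
  simp only [Fin.sum_univ_two, jointEnergy, envPop, Matrix.cons_val_zero, Matrix.cons_val_one,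
    Matrix.cons_val_fin_one, hcard]
  rw [hneg (gapS hH i j * t / 2)
      ((hH.eigenvalues j + 0 - (hH.eigenvalues i + 0)) * t / 2) (by unfold gapS; ring),
    hneg (gapS hH i j * t / 2)
      ((hH.eigenvalues j + γ - (hH.eigenvalues i + γ)) * t / 2) (by unfold gapS; ring),
    hneg ((gapS hH i j - γ) * t / 2)
      ((hH.eigenvalues j + γ - (hH.eigenvalues i + 0)) * t / 2) (by unfold gapS; ring),
    hneg ((gapS hH i j + γ) * t / 2)
      ((hH.eigenvalues j + 0 - (hH.eigenvalues i + γ)) * t / 2) (by unfold gapS; ring),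
    secondOrderRate, alphaTildeSq]
  have h01 := q₀_add_q₁ β γ
  rw [← eq_sub_iff_add_eq] at h01
  rw [h01]
  ring

theorem sum_abs_channelMatrix_sub_le (hH : H.IsHermitian) (β : ℝ≥0∞) {α t : ℝ} (hα : 0 ≤ α)
    (ht : 0 ≤ t) (γ : ℝ) (i : Fin d) :
    ∑ j ∈ Finset.univ.erase i,
      |channelMatrix hH β α t γ j i - secondOrderRate hH β α t γ i j| ≤
      8 * √(Real.pi / 2) * d * (α * t) ^ 3 := by
  set F : Fin 2 → Fin d × Fin 2 → ℝ := fun k a =>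
    meanTransitionProb (jointEnergy hH γ) α t a (i, k) -
      (α * t) ^ 2 * (1 / (Fintype.card (Fin d × Fin 2) + 1)) *
        Real.sinc ((jointEnergy hH γ a - jointEnergy hH γ (i, k)) * t / 2) ^ 2 with hF
  have h1 : ∀ j, channelMatrix hH β α t γ j i - secondOrderRate hH β α t γ i j =
      ∑ k, (∑ l, F k (j, l)) * envPop β γ k := by
    intro j
    rw [secondOrderRate_eq_sum, channelMatrix, Matrix.of_apply, Finset.sum_comm,
      ← Finset.sum_sub_distrib]
    refine Finset.sum_congr rfl fun k _ => ?_
    rw [← Finset.sum_sub_distrib, Finset.sum_mul]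
    exact Finset.sum_congr rfl fun l _ => by rw [hF]; ring
  have h2 : ∀ k, ∑ j ∈ Finset.univ.erase i, ∑ l, |F k (j, l)| ≤
      8 * √(Real.pi / 2) * d * (α * t) ^ 3 := by
    intro k
    have h3 := sum_abs_meanTransitionProb_sub_le (jointEnergy hH γ) hα ht (i, k)
    have h4 : 2 * (α * t) ^ 3 * (Fintype.card (Fin d × Fin 2) * (2 * √(Real.pi / 2))) =
        8 * √(Real.pi / 2) * d * (α * t) ^ 3 := by
      simp only [Fintype.card_prod, Fintype.card_fin, Nat.cast_mul, Nat.cast_ofNat]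
      ring
    rw [h4] at h3
    refine le_trans ?_ h3
    rw [← Finset.sum_product']
    refine Finset.sum_le_sum_of_subset_of_nonneg ?_ fun _ _ _ => abs_nonneg _
    rintro ⟨j, l⟩ hjl
    simp only [Finset.mem_product, Finset.mem_erase, Finset.mem_univ, and_true] at hjl ⊢
    exact fun h => hjl (Prod.ext_iff.mp h).1
  calc ∑ j ∈ Finset.univ.erase i,
        |channelMatrix hH β α t γ j i - secondOrderRate hH β α t γ i j|
      ≤ ∑ j ∈ Finset.univ.erase i, ∑ k, (∑ l, |F k (j, l)|) * envPop β γ k := by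
        refine Finset.sum_le_sum fun j _ => ?_
        rw [h1]
        refine (Finset.abs_sum_le_sum_abs _ _).trans (Finset.sum_le_sum fun k _ => ?_)
        rw [abs_mul, abs_of_nonneg (envPop_nonneg β γ k)]
        exact mul_le_mul_of_nonneg_right (Finset.abs_sum_le_sum_abs _ _) (envPop_nonneg β γ k)
    _ = ∑ k, (∑ j ∈ Finset.univ.erase i, ∑ l, |F k (j, l)|) * envPop β γ k := by
        rw [Finset.sum_comm]; simp_rw [Finset.sum_mul]
    _ ≤ ∑ k, 8 * √(Real.pi / 2) * d * (α * t) ^ 3 * envPop β γ k :=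
        Finset.sum_le_sum fun k _ => mul_le_mul_of_nonneg_right (h2 k) (envPop_nonneg β γ k)
    _ = _ := by rw [← Finset.mul_sum, sum_envPop, mul_one]

/-- Detuned transitions are suppressed: `sinc²(x) ≤ 1/x²`. -/
theorem alphaTildeSq_mul_sinc_sq_le (d : ℕ) (α t : ℝ) {ω δ : ℝ} (hδ : 0 < δ) (hω : δ ≤ |ω|) :
    alphaTildeSq d α t * Real.sinc (ω * t / 2) ^ 2 ≤ 4 * α ^ 2 / (δ ^ 2 * (2 * d + 1)) := by
  have h1 : t ^ 2 * Real.sinc (ω * t / 2) ^ 2 ≤ 4 / δ ^ 2 := by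
    have hω0 : ω ≠ 0 := abs_pos.mp (hδ.trans_le hω)
    have h2 : (t * Real.sinc (ω * t / 2)) * ω = 2 * Real.sin (ω * t / 2) := by
      rcases eq_or_ne t 0 with rfl | ht
      · simp
      · rw [Real.sinc_of_ne_zero (by positivity)]
        field_simp
    have h3 : (t * Real.sinc (ω * t / 2)) ^ 2 * ω ^ 2 ≤ 4 := by
      rw [← mul_pow, h2, mul_pow]
      nlinarith [Real.sin_sq_le_one (ω * t / 2)]
    rw [le_div_iff₀ (by positivity), ← mul_pow]
    refine le_trans (mul_le_mul_of_nonneg_left ?_ (sq_nonneg _)) h3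
    rw [← sq_abs ω]
    exact pow_le_pow_left₀ hδ.le hω 2
  have h4 : (0 : ℝ) < 2 * d + 1 := by positivity
  calc alphaTildeSq d α t * Real.sinc (ω * t / 2) ^ 2
      = α ^ 2 / (2 * d + 1) * (t ^ 2 * Real.sinc (ω * t / 2) ^ 2) := by
        unfold alphaTildeSq; ring
    _ ≤ α ^ 2 / (2 * d + 1) * (4 / δ ^ 2) := mul_le_mul_of_nonneg_left h1 (by positivity)
    _ = _ := by field_simp

/-- The rates discarded by the on-resonance dynamics, including those of transitions that leave the
environment unchanged, are detuned by at least `δ_min`. -/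
theorem abs_secondOrderRate_sub_le (hH : H.IsHermitian) (hinj : Function.Injective hH.eigenvalues)
    (hd : 2 ≤ d) (β : ℝ≥0∞) (α t γ : ℝ) {i j : Fin d} (hij : i ≠ j) :
    |secondOrderRate hH β α t γ i j - onResonanceRate hH β α t γ i j| ≤
      8 * α ^ 2 / (deltaMin hH ^ 2 * (2 * d + 1)) := by
  have hδ := deltaMin_pos hH hinj hd
  set A := alphaTildeSq d α t with hA
  set B := 4 * α ^ 2 / (deltaMin hH ^ 2 * (2 * d + 1)) with hB
  have hA0 : 0 ≤ A := alphaTildeSq_nonneg d α t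
  have hB0 : 0 ≤ B := by positivity
  have hoff : ∀ e γ : ℝ,
      0 ≤ A * (Real.sinc ((e - γ) * t / 2) ^ 2 - lineShape hH t e γ) ∧
      A * (Real.sinc ((e - γ) * t / 2) ^ 2 - lineShape hH t e γ) ≤ B := by
    intro e γ
    unfold lineShape
    split_ifs with h
    · simp [hB0]
    · rw [sub_zero]
      exact ⟨by positivity, alphaTildeSq_mul_sinc_sq_le d α t hδ (not_le.mp h).le⟩
  have h1 : secondOrderRate hH β α t γ i j - onResonanceRate hH β α t γ i j =
      A * Real.sinc (gapS hH i j * t / 2) ^ 2 +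
      q₀ β γ * (A * (Real.sinc ((gapS hH i j - γ) * t / 2) ^ 2 -
        lineShape hH t (gapS hH i j) γ)) +
      q₁ β γ * (A * (Real.sinc ((gapS hH i j - -γ) * t / 2) ^ 2 -
        lineShape hH t (gapS hH i j) (-γ))) := by
    rw [secondOrderRate, onResonanceRate_eq, ← hA, sub_neg_eq_add]
    ring
  have h2 := alphaTildeSq_mul_sinc_sq_le d α t hδ (deltaMin_le_abs_gapS hH hinj hij)
  rw [← hA, ← hB] at h2
  have h3 := hoff (gapS hH i j) γ
  have h4 := hoff (gapS hH i j) (-γ)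
  have hq0 := q₀_nonneg β γ
  have hq1 := q₁_nonneg β γ
  have hq := q₀_add_q₁ β γ
  have h5 : 8 * α ^ 2 / (deltaMin hH ^ 2 * (2 * d + 1)) = B + (q₀ β γ * B + q₁ β γ * B) := by
    rw [← add_mul, hq, hB]; ring
  rw [h1, h5, abs_of_nonneg, add_assoc]
  · exact add_le_add h2 (add_le_add (mul_le_mul_of_nonneg_left h3.2 hq0)
      (mul_le_mul_of_nonneg_left h4.2 hq1))
  · have := mul_nonneg hq0 h3.1
    have := mul_nonneg hq1 h4.1
    positivity

/-- The distance between the channel and the dynamics `1 + 𝔼_γ 𝒯_on`, in the `ℓ¹` norm. -/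
noncomputable def channelError (hH : H.IsHermitian) (α t : ℝ) : ℝ :=
  8 * (α ^ 2 / deltaMin hH ^ 2) + 16 * √(Real.pi / 2) * d * (α * t) ^ 3

/-- The columns of the difference sum to zero, so that the diagonal entry is bounded by the
off-diagonal ones and accounts for a factor of `2`. -/
theorem sum_abs_avgChannelMatrix_sub_le (hH : H.IsHermitian)
    (hinj : Function.Injective hH.eigenvalues) (hd : 2 ≤ d) (β : ℝ≥0∞) {α t : ℝ} (hα : 0 ≤ α)
    (ht : 0 ≤ t) (i : Fin d) :
    ∑ j, |(avgChannelMatrix hH β α t - 1 - avgTransitionMatrix hH β α t) j i| ≤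
      channelError hH α t := by
  have h := specNorm_pos hH hinj hd
  have hδ := deltaMin_pos hH hinj hd
  have := isProbabilityMeasure_gammaLaw h
  set E := avgChannelMatrix hH β α t - 1 - avgTransitionMatrix hH β α t with hE
  have hcol : ∑ j, E j i = 0 := by
    simp only [hE, Matrix.sub_apply, Finset.sum_sub_distrib]
    rw [sum_avgChannelMatrix h, sum_avgTransitionMatrix h]
    simp [Matrix.one_apply]
  have hoff : ∑ j ∈ Finset.univ.erase i, |E j i| ≤ channelError hH α t / 2 := by
    have h1 : ∀ j ∈ Finset.univ.erase i, E j i =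
        ∫ γ, (channelMatrix hH β α t γ j i - onResonanceRate hH β α t γ i j) ∂gammaLaw H := by
      intro j hj
      have hji := Finset.ne_of_mem_erase hj
      rw [integral_sub (integrable_channelMatrix h hH β α t j i)
        (integrable_onResonanceRate h hH β α t i j), ← avgChannelMatrix_apply]
      simp only [hE, Matrix.sub_apply]
      rw [avgTransitionMatrix_of_ne hH β α t hji, Matrix.one_apply_ne hji, sub_zero]
      rfl
    rw [Finset.sum_congr rfl fun j hj => congrArg abs (h1 j hj)]
    refine (sum_abs_integral_le (B := fun _ => channelError hH α t / 2) _ (fun j _ =>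
      (integrable_channelMatrix h hH β α t j i).sub
        (integrable_onResonanceRate h hH β α t i j)) (integrable_const _) fun γ => ?_).trans ?_
    · have h2 := sum_abs_channelMatrix_sub_le hH β hα ht γ i
      have h3 : ∑ j ∈ Finset.univ.erase i,
          |secondOrderRate hH β α t γ i j - onResonanceRate hH β α t γ i j| ≤
          4 * (α ^ 2 / deltaMin hH ^ 2) := by
        refine (Finset.sum_le_sum fun j hj => abs_secondOrderRate_sub_le hH hinj hd β α t γ
          (Finset.ne_of_mem_erase hj).symm).trans ?_
        rw [Finset.sum_const, Finset.card_erase_of_mem (Finset.mem_univ i), Finset.card_fin,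
          nsmul_eq_mul, Nat.cast_sub (by omega), Nat.cast_one]
        have h4 : (0 : ℝ) < 2 * d + 1 := by positivity
        have h5 : ((d : ℝ) - 1) * (8 * α ^ 2 / (deltaMin hH ^ 2 * (2 * d + 1))) =
            8 * (α ^ 2 / deltaMin hH ^ 2) * (((d : ℝ) - 1) / (2 * d + 1)) := by
          field_simp
        have h6 : ((d : ℝ) - 1) / (2 * d + 1) ≤ 1 / 2 := by
          rw [div_le_iff₀ h4]; linarith
        rw [h5]
        have h7 : 0 ≤ α ^ 2 / deltaMin hH ^ 2 := by positivity
        nlinarith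
      calc ∑ j ∈ Finset.univ.erase i,
            |channelMatrix hH β α t γ j i - onResonanceRate hH β α t γ i j|
          ≤ ∑ j ∈ Finset.univ.erase i,
            (|channelMatrix hH β α t γ j i - secondOrderRate hH β α t γ i j| +
              |secondOrderRate hH β α t γ i j - onResonanceRate hH β α t γ i j|) :=
            by
            exact Finset.sum_le_sum fun j _ => abs_sub_le (channelMatrix hH β α t γ j i) _ _
        _ ≤ 8 * √(Real.pi / 2) * d * (α * t) ^ 3 + 4 * (α ^ 2 / deltaMin hH ^ 2) := by
            rw [Finset.sum_add_distrib]
            exact add_le_add h2 h3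
        _ = channelError hH α t / 2 := by unfold channelError; ring
    · simp
  rw [← Finset.add_sum_erase _ _ (Finset.mem_univ i)] at hcol ⊢
  have h1 : |E i i| ≤ ∑ j ∈ Finset.univ.erase i, |E j i| := by
    rw [eq_neg_of_add_eq_zero_left hcol, abs_neg]
    exact Finset.abs_sum_le_sum_abs _ _
  linarith

/-- One step of the channel agrees with one step of the Markov chain up to `channelError`. -/
theorem sum_abs_channel_step_sub_le (hH : H.IsHermitian)
    (hinj : Function.Injective hH.eigenvalues) (hd : 2 ≤ d) (β : ℝ≥0∞) {α t : ℝ} (hα : 0 ≤ α)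
    (ht : 0 ≤ t) (v : Fin d → ℝ) :
    ∑ j, |(avgChannelMatrix hH β α t *ᵥ v - v - avgTransitionMatrix hH β α t *ᵥ v) j| ≤
      channelError hH α t * ∑ i, |v i| := by
  set E := avgChannelMatrix hH β α t - 1 - avgTransitionMatrix hH β α t with hE
  have h1 : avgChannelMatrix hH β α t *ᵥ v - v - avgTransitionMatrix hH β α t *ᵥ v = E *ᵥ v := by
    rw [hE, Matrix.sub_mulVec, Matrix.sub_mulVec, Matrix.one_mulVec]
  rw [h1]
  calc ∑ j, |(E *ᵥ v) j| ≤ ∑ j, ∑ i, |E j i| * |v i| := by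
        refine Finset.sum_le_sum fun j _ => ?_
        change |∑ i, E j i * v i| ≤ _
        exact (Finset.abs_sum_le_sum_abs (fun i => E j i * v i) _).trans
          (Finset.sum_le_sum fun i _ => (abs_mul (E j i) (v i)).le)
    _ = ∑ i, (∑ j, |E j i|) * |v i| := by
        rw [Finset.sum_comm]
        exact Finset.sum_congr rfl fun i _ => (Finset.sum_mul _ _ _).symm
    _ ≤ ∑ i, channelError hH α t * |v i| := by
        refine Finset.sum_le_sum fun i _ => ?_
        exact mul_le_mul_of_nonneg_right (sum_abs_avgChannelMatrix_sub_le hH hinj hd β hα ht i)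
          (abs_nonneg _)
    _ = _ := by rw [Finset.mul_sum]

end SecondOrder

/-! ### Gibbs states -/

section Gibbs

variable {d : ℕ} {H : Matrix (Fin d) (Fin d) ℂ}

/-- The Gibbs weights of the energy levels. -/
noncomputable def gibbsPop (hH : H.IsHermitian) (β : ℝ) (i : Fin d) : ℝ :=
  (∑ k, Real.exp (-β * hH.eigenvalues k))⁻¹ * Real.exp (-β * hH.eigenvalues i)

theorem gibbsPop_nonneg (hH : H.IsHermitian) (β : ℝ) (i : Fin d) : 0 ≤ gibbsPop hH β i := by
  unfold gibbsPop
  have : 0 ≤ ∑ k, Real.exp (-β * hH.eigenvalues k) := Finset.sum_nonneg fun _ _ =>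
    (Real.exp_pos _).le
  positivity

theorem sum_gibbsPop (hH : H.IsHermitian) (hd : 2 ≤ d) (β : ℝ) : ∑ i, gibbsPop hH β i = 1 := by
  have : Nonempty (Fin d) := ⟨⟨0, by omega⟩⟩
  simp only [gibbsPop]
  rw [← Finset.mul_sum]
  refine inv_mul_cancel₀ (ne_of_gt ?_)
  exact Finset.sum_pos (fun _ _ => Real.exp_pos _) Finset.univ_nonempty

theorem gibbsState_eq (hH : H.IsHermitian) (β : ℝ) :
    gibbsState H β = eigDiag hH (gibbsPop hH β) := by
  have h1 : NormedSpace.exp (-(β : ℂ) • H) =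
      eigDiag hH fun i => Real.exp (-β * hH.eigenvalues i) := by
    have h2 : -(β : ℂ) • H = (hH.eigenvectorUnitary : Matrix (Fin d) (Fin d) ℂ) *
        Matrix.diagonal (fun i => ((-β * hH.eigenvalues i : ℝ) : ℂ)) *
        (hH.eigenvectorUnitary : Matrix (Fin d) (Fin d) ℂ)ᴴ := by
      conv_lhs => rw [← eigDiag_eigenvalues hH]
      rw [eigDiag, ← Matrix.smul_mul, ← Matrix.mul_smul, ← Matrix.diagonal_smul]
      congr 3
      funext i
      simp
    rw [h2, exp_unitary_conj, Matrix.exp_diagonal, eigDiag]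
    congr 3
    funext i
    rw [Pi.exp_def, ← Complex.exp_eq_exp_ℂ, Complex.ofReal_exp]
  rw [gibbsState, h1, trace_eigDiag, eigDiag, eigDiag, ← Matrix.smul_mul, ← Matrix.mul_smul,
    ← Matrix.diagonal_smul]
  congr 3
  funext i
  simp [gibbsPop]

/-- Approximate detailed balance at resonance: for `|γ - Δ| ≤ δ` the upward and downward flows
between two levels at distance `Δ` cancel up to a factor `e^{βδ}`. -/
theorem abs_gibbsPop_flow_le (hH : H.IsHermitian) (β : ℝ≥0) {i j : Fin d} {γ δ : ℝ}
    (hγ : |gapS hH i j - γ| ≤ δ) :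
    |gibbsPop hH β i * q₀ β γ - gibbsPop hH β j * q₁ β γ| ≤
      gibbsPop hH β i * Real.exp (β * δ) := by
  have hp := gibbsPop_nonneg hH β i
  have hq0 := q₀_nonneg β γ
  have hq1 := q₀_le_one β γ
  have hb : boltzmann β γ = Real.exp (-β * γ) := by simp [boltzmann]
  have hq : q₁ β γ = q₀ β γ * Real.exp (-β * γ) := by
    rw [q₁, q₀, hb]; ring
  have hpj : gibbsPop hH β j = gibbsPop hH β i * Real.exp (β * gapS hH i j) := by
    rw [gibbsPop, gibbsPop, mul_assoc, ← Real.exp_add]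
    congr 2
    unfold gapS
    ring
  have h1 : gibbsPop hH β i * q₀ β γ - gibbsPop hH β j * q₁ β γ =
      gibbsPop hH β i * (q₀ β γ * (1 - Real.exp (β * (gapS hH i j - γ)))) := by
    rw [hq, hpj, show (β : ℝ) * (gapS hH i j - γ) = β * gapS hH i j + -β * γ by ring, Real.exp_add]
    ring
  have hδ : 0 ≤ δ := (abs_nonneg _).trans hγ
  have h2 : Real.exp (β * (gapS hH i j - γ)) ≤ Real.exp (β * δ) :=
    Real.exp_le_exp.mpr (mul_le_mul_of_nonneg_left ((le_abs_self _).trans hγ) β.coe_nonneg)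
  have h3 : 1 ≤ Real.exp (β * δ) := Real.one_le_exp (mul_nonneg β.coe_nonneg hδ)
  have h4 : |1 - Real.exp (β * (gapS hH i j - γ))| ≤ Real.exp (β * δ) := by
    rw [abs_le]
    constructor <;> linarith [Real.exp_pos (β * (gapS hH i j - γ))]
  rw [h1, abs_mul, abs_mul, abs_of_nonneg hp, abs_of_nonneg hq0]
  exact mul_le_mul_of_nonneg_left ((mul_le_of_le_one_left (abs_nonneg _) hq1).trans h4) hp

/-- The net flow between two levels in the Gibbs state, bounded pointwise in `γ` by approximate
detailed balance. -/
theorem abs_avgRate_flow_le (hH : H.IsHermitian) (hinj : Function.Injective hH.eigenvalues)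
    (hd : 2 ≤ d) (β : ℝ≥0) (α t : ℝ) {i j : Fin d} (hij : i ≠ j) :
    |avgRate hH β α t i j * gibbsPop hH β i - avgRate hH β α t j i * gibbsPop hH β j| ≤
      (gibbsPop hH β i + gibbsPop hH β j) *
        (Real.exp (β * deltaMin hH) * (rateScale H α t * sincMass (deltaMin hH * t / 2))) := by
  have h := specNorm_pos hH hinj hd
  wlog hpos : 0 < gapS hH i j generalizing i j with hw
  · rw [abs_sub_comm, add_comm (gibbsPop hH β i)]
    refine hw hij.symm ?_
    rw [gapS_swap]
    exact neg_pos.mpr (lt_of_le_of_ne (not_lt.mp hpos) (gapS_ne_zero hH hinj hij))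
  set A := alphaTildeSq d α t with hA
  have hA0 : 0 ≤ A := alphaTildeSq_nonneg d α t
  have hi0 := integrable_mul_lineShape h hH t (gapS hH i j) (measurable_q₀ β) (q₀_nonneg β)
    (q₀_le_one β)
  have hi1 := integrable_mul_lineShape h hH t (gapS hH i j) (measurable_q₁ β) (q₁_nonneg β)
    (q₁_le_one β)
  have hl := integrable_lineShape h hH t (gapS hH i j)
  have h1 : avgRate hH β α t i j * gibbsPop hH β i - avgRate hH β α t j i * gibbsPop hH β j =
      A * ∫ γ, (gibbsPop hH β i * q₀ β γ - gibbsPop hH β j * q₁ β γ) *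
        lineShape hH t (gapS hH i j) γ ∂gammaLaw H := by
    have h2 : ∀ γ, (gibbsPop hH β i * q₀ β γ - gibbsPop hH β j * q₁ β γ) *
        lineShape hH t (gapS hH i j) γ =
        gibbsPop hH β i * (q₀ β γ * lineShape hH t (gapS hH i j) γ) -
        gibbsPop hH β j * (q₁ β γ * lineShape hH t (gapS hH i j) γ) := fun γ => by ring
    simp_rw [h2]
    rw [integral_sub (hi0.const_mul _) (hi1.const_mul _), integral_const_mul, integral_const_mul,
      avgRate_down hH hinj β α t hpos, avgRate_up hH hinj β α t hpos]
    ring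
  have h3 : |∫ γ, (gibbsPop hH β i * q₀ β γ - gibbsPop hH β j * q₁ β γ) *
        lineShape hH t (gapS hH i j) γ ∂gammaLaw H| ≤
      gibbsPop hH β i * Real.exp (β * deltaMin hH) *
        ∫ γ, lineShape hH t (gapS hH i j) γ ∂gammaLaw H := by
    rw [← integral_const_mul, ← Real.norm_eq_abs]
    refine norm_integral_le_of_norm_le (hl.const_mul _) (Eventually.of_forall fun γ => ?_)
    rw [Real.norm_eq_abs, abs_mul, abs_of_nonneg (lineShape_nonneg hH t (gapS hH i j) γ)]
    unfold lineShape
    split_ifs with hγ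
    · exact mul_le_mul_of_nonneg_right (abs_gibbsPop_flow_le hH β hγ) (sq_nonneg _)
    · simp
  rw [h1, abs_mul, abs_of_nonneg hA0]
  have h4 := integral_lineShape_gapS hH hinj hd α t hpos
  have h5 : 0 ≤ ∫ γ, lineShape hH t (gapS hH i j) γ ∂gammaLaw H :=
    integral_nonneg fun γ => lineShape_nonneg _ _ _ _
  calc A * |∫ γ, (gibbsPop hH β i * q₀ β γ - gibbsPop hH β j * q₁ β γ) *
        lineShape hH t (gapS hH i j) γ ∂gammaLaw H|
      ≤ A * (gibbsPop hH β i * Real.exp (β * deltaMin hH) *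
        ∫ γ, lineShape hH t (gapS hH i j) γ ∂gammaLaw H) := mul_le_mul_of_nonneg_left h3 hA0
    _ = gibbsPop hH β i * (Real.exp (β * deltaMin hH) *
        (A * ∫ γ, lineShape hH t (gapS hH i j) γ ∂gammaLaw H)) := by ring
    _ ≤ _ := by
      rw [← h4]
      refine mul_le_mul_of_nonneg_right ?_ (by positivity)
      linarith [gibbsPop_nonneg hH β j]

/-- The change of the population of `j` is the sum of the net flows into `j`. -/
theorem avgTransitionMatrix_mulVec (h : 0 < specNorm H) (hH : H.IsHermitian) (β : ℝ≥0∞) (α t : ℝ)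
    (p : Fin d → ℝ) (j : Fin d) :
    (avgTransitionMatrix hH β α t *ᵥ p) j = ∑ i ∈ Finset.univ.erase j,
      (avgRate hH β α t i j * p i - avgRate hH β α t j i * p j) := by
  have hoff : ∑ i ∈ Finset.univ.erase j, avgTransitionMatrix hH β α t j i * p i =
      ∑ i ∈ Finset.univ.erase j, avgRate hH β α t i j * p i :=
    Finset.sum_congr rfl fun i hi => by
      rw [avgTransitionMatrix_of_ne hH β α t (Finset.ne_of_mem_erase hi).symm]
  rw [Matrix.mulVec, dotProduct, ← Finset.add_sum_erase _ _ (Finset.mem_univ j), hoff,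
    avgTransitionMatrix_self h, Finset.sum_sub_distrib, ← Finset.sum_mul]
  ring

/-- The Gibbs weights are nearly stationary for the on-resonance Markov chain. -/
theorem sum_abs_avgTransitionMatrix_gibbsPop_le (hH : H.IsHermitian)
    (hinj : Function.Injective hH.eigenvalues) (hd : 2 ≤ d) (β : ℝ≥0) (α : ℝ) {t : ℝ}
    (ht : 0 ≤ t) :
    ∑ j, |(avgTransitionMatrix hH β α t *ᵥ gibbsPop hH β) j| ≤
      α ^ 2 * t * Real.exp (β * deltaMin hH) * (specNorm H)⁻¹ * Real.pi := by
  have h := specNorm_pos hH hinj hd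
  have hδ := deltaMin_pos hH hinj hd
  set r := sincMass (deltaMin hH * t / 2) with hr
  have hr0 : 0 ≤ r := sincMass_nonneg (by positivity)
  set K := Real.exp (β * deltaMin hH) * (rateScale H α t * r) with hK
  have hd1 : ∀ c : Fin d → ℝ, ∑ j, ∑ i ∈ Finset.univ.erase j, c j = (d - 1) * ∑ j, c j := by
    intro c
    rw [Finset.mul_sum]
    refine Finset.sum_congr rfl fun j _ => ?_
    rw [Finset.sum_const, Finset.card_erase_of_mem (Finset.mem_univ j), Finset.card_fin,
      nsmul_eq_mul, Nat.cast_sub (by omega), Nat.cast_one]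
  have hcount : ∑ j, ∑ i ∈ Finset.univ.erase j, (gibbsPop hH β i + gibbsPop hH β j) =
      2 * (d - 1) := by
    have h1 : ∀ j, ∑ i ∈ Finset.univ.erase j, gibbsPop hH β i = 1 - gibbsPop hH β j := by
      intro j
      rw [← sum_gibbsPop hH hd β, ← Finset.add_sum_erase _ _ (Finset.mem_univ j)]
      ring
    simp_rw [Finset.sum_add_distrib]
    rw [hd1, Finset.sum_congr rfl fun j _ => h1 j, Finset.sum_sub_distrib, sum_gibbsPop hH hd]
    simp
    ring
  calc ∑ j, |(avgTransitionMatrix hH β α t *ᵥ gibbsPop hH β) j|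
      ≤ ∑ j, ∑ i ∈ Finset.univ.erase j, (gibbsPop hH β i + gibbsPop hH β j) * K := by
        refine Finset.sum_le_sum fun j _ => ?_
        rw [avgTransitionMatrix_mulVec h]
        refine (Finset.abs_sum_le_sum_abs _ _).trans (Finset.sum_le_sum fun i hi => ?_)
        exact abs_avgRate_flow_le hH hinj hd β α t (Finset.ne_of_mem_erase hi)
    _ = 2 * (d - 1) * K := by
        simp_rw [← Finset.sum_mul]
        rw [hcount]
    _ = α ^ 2 * t * Real.exp (β * deltaMin hH) * (specNorm H)⁻¹ *
          (r * ((d - 1) / (2 * d + 1))) := by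
        rw [hK, rateScale]
        field_simp
    _ ≤ _ := by
        refine mul_le_mul_of_nonneg_left ?_ (by positivity)
        have h4 : (0 : ℝ) < 2 * d + 1 := by positivity
        have h6 : ((d : ℝ) - 1) / (2 * d + 1) ≤ 1 / 2 := by
          rw [div_le_iff₀ h4]; linarith
        have h7 : r * (((d : ℝ) - 1) / (2 * d + 1)) ≤ r * (1 / 2) :=
          mul_le_mul_of_nonneg_left h6 hr0
        -- `r (d - 1) / (2d + 1) ≤ 4 / 2 < π`
        have h8 := sincMass_le_four (deltaMin hH * t / 2)
        linarith [Real.pi_gt_three]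

theorem traceNorm_gibbsState_sub_le (hH : H.IsHermitian)
    (hinj : Function.Injective hH.eigenvalues) (hd : 2 ≤ d) (β : ℝ≥0) {α t : ℝ} (hα : 0 ≤ α)
    (ht : 0 ≤ t) :
    traceNorm (gibbsState H β - avgChannel H β α t (gibbsState H β)) ≤
      α ^ 2 * t * Real.exp (β * deltaMin hH) * (specNorm H)⁻¹ * Real.pi + channelError hH α t := by
  have h := specNorm_pos hH hinj hd
  set p := gibbsPop hH β with hp
  rw [gibbsState_eq hH, avgChannel_eigDiag h, eigDiag_sub, traceNorm_eigDiag]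
  have h1 := sum_abs_channel_step_sub_le hH hinj hd β hα ht p
  have h2 := sum_abs_avgTransitionMatrix_gibbsPop_le hH hinj hd β α ht
  have h3 : ∑ i, |p i| = 1 := by
    rw [← sum_gibbsPop hH hd β]
    exact Finset.sum_congr rfl fun i _ => abs_of_nonneg (gibbsPop_nonneg hH β i)
  rw [h3, mul_one] at h1
  refine le_trans ?_ (add_le_add h2 h1)
  rw [← Finset.sum_add_distrib]
  refine Finset.sum_le_sum fun i _ => ?_
  have h4 : (p - avgChannelMatrix hH β α t *ᵥ p) i =
      -((avgTransitionMatrix hH β α t *ᵥ p) i +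
        (avgChannelMatrix hH β α t *ᵥ p - p - avgTransitionMatrix hH β α t *ᵥ p) i) := by
    simp only [Pi.sub_apply]; ring
  rw [h4, abs_neg]
  exact abs_add_le _ _

end Gibbs

/-! ### Mixing of perturbed Markov chains -/

section Perturbation

variable {n : Type*} [Fintype n]

/-- The distance of two states is at most `2`. -/
theorem sum_abs_sub_le_two {p q : n → ℝ} (hp : ∀ i, 0 ≤ p i)
    (hq : ∀ i, 0 ≤ q i) (hpsum : ∑ i, p i = 1) (hqsum : ∑ i, q i = 1) :
    ∑ i, |(p - q) i| ≤ 2 := by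
  have h1 : ∑ i, |(p - q) i| ≤ ∑ i, (p i + q i) := Finset.sum_le_sum fun i _ => by
    rw [Pi.sub_apply, abs_le]
    constructor <;> linarith [hp i, hq i]
  rw [Finset.sum_add_distrib, hpsum, hqsum] at h1
  linarith

theorem iterate_mulVec_mem {M : Matrix n n ℝ} (hM : ∀ i j, 0 ≤ M i j)
    (hMsum : ∀ j, ∑ i, M i j = 1) {p : n → ℝ} (hp : ∀ i, 0 ≤ p i) (hpsum : ∑ i, p i = 1) (L : ℕ) :
    (∀ i, 0 ≤ ((fun v => M *ᵥ v)^[L] p) i) ∧ ∑ i, ((fun v => M *ᵥ v)^[L] p) i = 1 := by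
  induction L with
  | zero => exact ⟨hp, hpsum⟩
  | succ L ih =>
    rw [Function.iterate_succ_apply']
    refine ⟨fun i => ?_, ?_⟩
    · exact Finset.sum_nonneg fun j _ => mul_nonneg (hM i j) (ih.1 j)
    · rw [sum_mulVec_of_colSum hMsum, ih.2, mul_one]

variable [DecidableEq n]

/-- Convergence of a perturbed Markov chain: if `K` satisfies Doeblin's condition and one step of
the chain `M` differs from one step of `K` by at most `η`, then `M` mixes to the stationary
distribution of `K` up to `η / c`. -/
theorem sum_abs_iterate_sub_le {K M : Matrix n n ℝ} {c η : ℝ} (hc : 0 < c) (hc1 : c ≤ 1) (g : n)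
    (hK : ∀ i j, 0 ≤ K i j) (hKsum : ∀ j, ∑ i, K i j = 1) (hg : ∀ j, c ≤ K g j)
    (hM : ∀ i j, 0 ≤ M i j) (hMsum : ∀ j, ∑ i, M i j = 1)
    (hKM : ∀ v : n → ℝ, ∑ i, |(M *ᵥ v - K *ᵥ v) i| ≤ η * ∑ i, |v i|)
    {p q : n → ℝ} (hp : ∀ i, 0 ≤ p i) (hpsum : ∑ i, p i = 1) (hqsum : ∑ i, q i = 1)
    (hq : ∀ i, 0 ≤ q i) (hKq : K *ᵥ q = q) (L : ℕ) :
    ∑ i, |((fun v => M *ᵥ v)^[L] p - q) i| ≤ 2 * (1 - c) ^ L + η / c := by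
  have hstep := iterate_mulVec_mem hM hMsum hp hpsum
  have hη : 0 ≤ η := by
    have h := (Finset.sum_nonneg fun _ _ => abs_nonneg _).trans (hKM p)
    rwa [Finset.sum_congr rfl fun i _ => abs_of_nonneg (hp i), hpsum, mul_one] at h
  induction L with
  | zero =>
    have h1 := sum_abs_sub_le_two hp hq hpsum hqsum
    have : 0 ≤ η / c := by positivity
    simp only [Function.iterate_zero, id, pow_zero]
    linarith
  | succ L ih =>
    rw [Function.iterate_succ_apply']
    set w := (fun v => M *ᵥ v)^[L] p with hw
    obtain ⟨hw0, hw1⟩ := hstep L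
    have h1 : ∑ i, |(K *ᵥ (w - q)) i| ≤ (1 - c) * ∑ i, |(w - q) i| := by
      refine sum_abs_mulVec_le_of_minorized g hK hKsum hg ?_
      simp only [Pi.sub_apply, Finset.sum_sub_distrib]
      rw [hw1, hqsum, sub_self]
    have h2 := hKM w
    rw [Finset.sum_congr rfl fun i _ => abs_of_nonneg (hw0 i), hw1, mul_one] at h2
    have h3 : ∀ i, (M *ᵥ w - q) i = (K *ᵥ (w - q)) i + (M *ᵥ w - K *ᵥ w) i := by
      intro i
      rw [Matrix.mulVec_sub, hKq]
      simp only [Pi.sub_apply]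
      ring
    calc ∑ i, |(M *ᵥ w - q) i|
        ≤ ∑ i, |(K *ᵥ (w - q)) i| + ∑ i, |(M *ᵥ w - K *ᵥ w) i| := by
          rw [← Finset.sum_add_distrib]
          exact Finset.sum_le_sum fun i _ => by rw [h3]; exact abs_add_le _ _
      _ ≤ (1 - c) * (2 * (1 - c) ^ L + η / c) + η :=
          add_le_add (h1.trans (mul_le_mul_of_nonneg_left ih (by linarith))) h2
      _ = 2 * (1 - c) ^ (L + 1) + η / c := by
          field_simp
          ring

end Perturbation

/-! ### Parameter settings -/

section Parameters

variable {d : ℕ} {H : Matrix (Fin d) (Fin d) ℂ}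

/-- The equation for `t` is solved by the intermediate value theorem, as `t` times the gap at
time `t` is continuous and ranges over all positive numbers. -/
theorem exists_isParameterSetting (hH : H.IsHermitian) (hinj : Function.Injective hH.eigenvalues)
    (hd : 2 ≤ d) (β : ℝ≥0∞) {ε : ℝ} (hε : 0 < ε) : ∃ α t : ℝ, IsParameterSetting hH β ε α t := by
  have h := specNorm_pos hH hinj hd
  have hδ := deltaMin_pos hH hinj hd
  have hd' : (2 : ℝ) ≤ d := by exact_mod_cast hd
  set T : ℝ := d ^ 2 * specNorm H / (ε * deltaMin hH ^ 2) with hT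
  have hT0 : 0 < T := by positivity
  -- The gap at time `t` does not depend on `α`, so it may be evaluated at `α = 1`.
  set f : ℝ → ℝ := fun t => t * rescaledGap hH β 1 t with hf
  set t₁ : ℝ := T / (2 * d) with ht₁
  set t₂ : ℝ := max (Real.pi / deltaMin hH) T with ht₂
  have h1 : 0 < t₁ := by positivity
  have h2 : 0 < t₂ := lt_of_lt_of_le hT0 (le_max_right _ _)
  have h12 : t₁ ≤ t₂ := by
    refine (div_le_self hT0.le ?_).trans (le_max_right _ _)
    linarith
  have hf1 : f t₁ ≤ T := by
    have := rescaledGap_le_two_mul hH hinj hd β one_ne_zero h1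
    calc f t₁ ≤ t₁ * (2 * d) := mul_le_mul_of_nonneg_left this h1.le
      _ = T := by rw [ht₁]; field_simp
  have hf2 : T ≤ f t₂ := by
    have h3 := half_le_rescaledGap hH hinj hd β one_ne_zero h2
    have h4 : 2.43 ≤ sincMass (deltaMin hH * t₂ / 2) := by
      refine le_sincMass_of_pi_div_two_le ?_
      have h5 : Real.pi / deltaMin hH ≤ t₂ := le_max_left _ _
      rw [div_le_iff₀ hδ] at h5
      linarith
    calc T ≤ t₂ * 1 := by rw [mul_one]; exact le_max_right _ _
      _ ≤ f t₂ := mul_le_mul_of_nonneg_left (by linarith) h2.le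
  have hcont : ContinuousOn f (Set.Icc t₁ t₂) := by
    refine continuousOn_id.mul ((continuousOn_rescaledGap hH hinj hd β one_ne_zero).mono ?_)
    exact fun t ht => h1.trans_le ht.1
  obtain ⟨t, ht, hft⟩ := intermediate_value_Icc h12 hcont ⟨hf1, hf2⟩
  have ht0 : 0 < t := h1.trans_le ht.1
  have hlam := rescaledGap_pos hH hinj hd β one_ne_zero ht0
  set lam := rescaledGap hH β 1 t with hlamd
  have hα : 0 < deltaMin hH ^ 4 * ε ^ 3 * lam ^ 3 / (d ^ 7 * specNorm H ^ 3) := by positivity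
  refine ⟨_, t, hα, ht0, ?_, ?_⟩
  · rw [rescaledGap_eq_of_ne_zero h hH β hα.ne']
  · rw [rescaledGap_eq_of_ne_zero h hH β hα.ne', ← hlamd,
      ← mul_right_cancel_iff_of_pos hlam]
    change t * lam = _
    rw [show t * lam = T from hft, hT]
    field_simp

/-- The consequences of a parameter setting used in the convergence proof, in terms of the step
scale `X`. -/
theorem IsParameterSetting.scales (hH : H.IsHermitian) (hinj : Function.Injective hH.eigenvalues)
    (hd : 2 ≤ d) {β : ℝ≥0∞} {ε α t : ℝ} (hε : 0 < ε) (hp : IsParameterSetting hH β ε α t) :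
    0 < rescaledGap hH β α t ∧ 0 < stepScale hH ε (rescaledGap hH β α t) ∧
    α ^ 2 * t * (rescaledGap hH β α t * stepScale hH ε (rescaledGap hH β α t)) =
      d ^ 2 * specNorm H ∧
    channelError hH α t = ε * (8 + 16 * √(Real.pi / 2)) /
      stepScale hH ε (rescaledGap hH β α t) ∧
    stepScale hH ε (rescaledGap hH β α t) * t = timeScale hH ε (rescaledGap hH β α t) ∧
    d ^ 8 ≤ 4096 * ε ^ 5 * stepScale hH ε (rescaledGap hH β α t) := by
  obtain ⟨hα0, ht0, hα, ht⟩ := hp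
  have h := specNorm_pos hH hinj hd
  have hδ := deltaMin_pos hH hinj hd
  have hδ2 := deltaMin_le_two_mul_specNorm hH hinj hd
  have hlam := rescaledGap_pos hH hinj hd β hα0.ne' ht0
  have hlam2 := rescaledGap_le_two_mul hH hinj hd β hα0.ne' ht0
  have hd0 : (0 : ℝ) < d := by
    have : (2 : ℝ) ≤ d := by exact_mod_cast hd
    linarith
  unfold channelError stepScale timeScale
  generalize rescaledGap hH β α t = lam at *
  generalize deltaMin hH = δ at *
  generalize specNorm H = s at *
  generalize (d : ℝ) = D at *
  subst hα
  subst ht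
  refine ⟨hlam, by positivity, by field_simp, by field_simp, by field_simp, ?_⟩
  -- The bounds `δ_min ≤ 2‖H_S‖` and `λ ≤ 2d` on the denominator of `X` give the factor
  -- `2⁶ · 2⁶ = 4096`.
  have h1 : δ ^ 6 ≤ (2 * s) ^ 6 := pow_le_pow_left₀ hδ.le hδ2 6
  have h2 : lam ^ 6 ≤ (2 * D) ^ 6 := pow_le_pow_left₀ hlam.le hlam2 6
  have h3 : δ ^ 6 * lam ^ 6 ≤ (2 * s) ^ 6 * (2 * D) ^ 6 :=
    mul_le_mul h1 h2 (by positivity) (by positivity)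
  rw [show 4096 * ε ^ 5 * (D ^ 14 * s ^ 6 / (ε ^ 5 * δ ^ 6 * lam ^ 6)) =
    4096 * D ^ 14 * s ^ 6 / (δ ^ 6 * lam ^ 6) by field_simp, le_div_iff₀ (by positivity)]
  calc D ^ 8 * (δ ^ 6 * lam ^ 6) ≤ D ^ 8 * ((2 * s) ^ 6 * (2 * D) ^ 6) :=
        mul_le_mul_of_nonneg_left h3 (by positivity)
    _ = _ := by ring

theorem half_le_log_two_add {x : ℝ} (hx : 0 ≤ x) : 1 / 2 ≤ Real.log (2 + x) := by
  have h1 : Real.log 2 ≤ Real.log (2 + x) := Real.log_le_log (by norm_num) (by linarith)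
  linarith [Real.log_two_gt_d9]

/-- Bounds on the rates in a parameter setting with `ε < 1/4`, where `X` is the step scale, `κ` the
rate scale, `lam` the gap and `r` the resonance mass. The lower bound on `X` makes a single step of
the chain lazy. -/
theorem rate_bounds_of_scales {D κ lam r X ε : ℝ} (hd2 : 2 ≤ D) (hκ0 : 0 < κ) (hlam : 0 < lam)
    (hr0 : 0 < r) (hX : 0 < X) (hε : 0 < ε) (hε4 : ε < 1 / 4)
    (hκlam : κ * lam * (2 * X * (2 * D + 1)) = D ^ 2) (hlamr : r / 2 ≤ lam)
    (hrlam : lam ≤ D * r / 2) (hXd : D ^ 8 ≤ 4096 * ε ^ 5 * X) :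
    1 / (5 * X) ≤ κ * r / 2 ∧ (D - 1) * (κ * r) ≤ 1 / 2 ∧ 16 ≤ X ∧ 1 / X ≤ ε := by
  have hd0 : 0 < D := by linarith
  have hc : 1 / (5 * X) ≤ κ * r / 2 := by
    have h1 : κ * lam ≤ κ * (D * r / 2) := mul_le_mul_of_nonneg_left hrlam hκ0.le
    rw [div_le_iff₀ (by positivity)]
    have h2 : D ^ 2 ≤ κ * (D * r / 2) * (2 * X * (2 * D + 1)) := by
      rw [← hκlam]
      exact mul_le_mul_of_nonneg_right h1 (by positivity)
    have h3 : D * D ≤ D * (κ * r / 2 * (2 * X * (2 * D + 1))) := by linarith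
    have h4 := le_of_mul_le_mul_left h3 hd0
    have h5 : 0 ≤ κ * r / 2 * X := by positivity
    nlinarith
  have hε5 : ε ^ 5 ≤ ε / 256 := by
    have h1 : ε ^ 4 ≤ (1 / 4) ^ 4 := pow_le_pow_left₀ hε.le hε4.le 4
    have h2 := mul_le_mul_of_nonneg_left h1 hε.le
    linarith
  have hX64 : 1 ≤ 16 * ε ^ 5 * X := by
    have h1 : (2 : ℝ) ^ 8 ≤ D ^ 8 := pow_le_pow_left₀ (by norm_num) hd2 8
    linarith
  have hXε : 1 ≤ ε * X / 16 := by
    have := mul_le_mul_of_nonneg_right hε5 hX.le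
    linarith
  have hX16 : 16 ≤ X := by
    have := mul_le_mul_of_nonneg_right hε4.le hX.le
    linarith
  refine ⟨hc, ?_, hX16, ?_⟩
  · have h1 : κ * r ≤ κ * (2 * lam) := mul_le_mul_of_nonneg_left (by linarith) hκ0.le
    have h3 : D ^ 8 ≤ 4 * X := by
      have := mul_le_mul_of_nonneg_right (show ε ^ 5 ≤ 1 / 1024 by linarith) hX.le
      linarith
    have h5 : 64 * D ^ 2 ≤ D ^ 8 := by
      have h6 : (2 : ℝ) ^ 6 ≤ D ^ 6 := pow_le_pow_left₀ (by norm_num) hd2 6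
      have := mul_le_mul_of_nonneg_right h6 (sq_nonneg D)
      linarith
    have h7 : κ * lam * (2 * D + 1) ≤ 1 / 32 := by
      have h8 : κ * lam * (2 * D + 1) * (2 * X) ≤ 1 / 32 * (2 * X) := by linarith
      exact le_of_mul_le_mul_right h8 (by positivity)
    have h9 : (D - 1) * (κ * r) ≤ (D - 1) * (κ * (2 * lam)) :=
      mul_le_mul_of_nonneg_left h1 (by linarith)
    have h10 : 0 < κ * lam := by positivity
    linarith
  · rw [div_le_iff₀ hX]
    linarith

/-- For `ε < 1/4` the dynamics `1 + 𝔼_γ 𝒯_on` is a stochastic matrix satisfying Doeblin's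
condition. -/
theorem one_add_avgTransitionMatrix_stochastic (hH : H.IsHermitian)
    (hinj : Function.Injective hH.eigenvalues) (hd : 2 ≤ d) (β : ℝ≥0∞) {α t c : ℝ} {g : Fin d}
    (hg : ∀ j, hH.eigenvalues g ≤ hH.eigenvalues j) (hc2 : c ≤ 1 / 2)
    (hc : c ≤ rateScale H α t * sincMass (deltaMin hH * t / 2) / 2)
    (hout : (d - 1) * (rateScale H α t * sincMass (deltaMin hH * t / 2)) ≤ 1 / 2) :
    (∀ i j, 0 ≤ (1 + avgTransitionMatrix hH β α t) i j) ∧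
    (∀ j, ∑ i, (1 + avgTransitionMatrix hH β α t) i j = 1) ∧
    ∀ j, c ≤ (1 + avgTransitionMatrix hH β α t) g j := by
  have h := specNorm_pos hH hinj hd
  have hdiag : ∀ i, 1 / 2 ≤ 1 + avgTransitionMatrix hH β α t i i := by
    intro i
    have h1 : ∑ k ∈ Finset.univ.erase i, avgRate hH β α t i k ≤
        (d - 1) * (rateScale H α t * sincMass (deltaMin hH * t / 2)) := by
      refine (Finset.sum_le_card_nsmul _ _ (rateScale H α t * sincMass (deltaMin hH * t / 2))
        fun k hk => ?_).trans (le_of_eq ?_)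
      · have h2 := avgRate_add_avgRate hH hinj hd β α t (Finset.ne_of_mem_erase hk).symm
        have h3 := avgRate_nonneg hH β α t k i
        linarith
      · rw [Finset.card_erase_of_mem (Finset.mem_univ i), Finset.card_fin,
          nsmul_eq_mul, Nat.cast_sub (by omega), Nat.cast_one]
    rw [avgTransitionMatrix_self h]
    linarith
  refine ⟨fun i j => ?_, fun j => ?_, fun j => ?_⟩
  · rw [Matrix.add_apply]
    rcases eq_or_ne i j with rfl | hij
    · rw [Matrix.one_apply_eq]
      linarith [hdiag i]
    · rw [Matrix.one_apply_ne hij, zero_add, avgTransitionMatrix_of_ne hH β α t hij]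
      exact avgRate_nonneg _ _ _ _ _ _
  · simp only [Matrix.add_apply, Finset.sum_add_distrib]
    rw [sum_avgTransitionMatrix h]
    simp [Matrix.one_apply]
  · rw [Matrix.add_apply]
    rcases eq_or_ne g j with rfl | hij
    · rw [Matrix.one_apply_eq]
      exact hc2.trans (hdiag g)
    · rw [Matrix.one_apply_ne hij, zero_add]
      exact hc.trans (half_le_avgTransitionMatrix_ground hH hinj hd β α t hg hij.symm)

/-- After `L ≥ 5 X log (2 + X)` contractions by `1 - 1/(5X)` at most `1/X` is left. -/
theorem one_sub_pow_le_one_div {X : ℝ} (hX : 1 ≤ X) {L : ℕ}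
    (hL : 5 * X * Real.log (2 + X) ≤ L) : (1 - 1 / (5 * X)) ^ L ≤ 1 / X := by
  have h4 : 1 - 1 / (5 * X) ≤ Real.exp (-(1 / (5 * X))) := by
    linarith [Real.add_one_le_exp (-(1 / (5 * X)))]
  have h5 : 0 ≤ 1 - 1 / (5 * X) := by
    rw [sub_nonneg, div_le_one (by positivity)]; linarith
  refine (pow_le_pow_left₀ h5 h4 L).trans ?_
  rw [← Real.exp_nat_mul]
  have h7 : (L : ℝ) * -(1 / (5 * X)) ≤ -Real.log (2 + X) := by
    rw [mul_neg, neg_le_neg_iff, mul_one_div, le_div_iff₀ (by positivity)]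
    linarith
  refine (Real.exp_le_exp.mpr h7).trans ?_
  rw [Real.exp_neg, Real.exp_log (by positivity), inv_eq_one_div]
  exact one_div_le_one_div_of_le (by linarith) (by linarith)

/-- After `5 X log (2 + X)` interactions the error is `O(ε log (2 + X))`. -/
theorem traceNorm_iterate_le (hH : H.IsHermitian) (hinj : Function.Injective hH.eigenvalues)
    (hd : 2 ≤ d) {β : ℝ≥0∞} {ε α t : ℝ} (hε : 0 < ε)
    (hset : IsParameterSetting hH β ε α t) {ρ ρfix : Matrix (Fin d) (Fin d) ℂ} (hρ : IsState ρ)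
    (hcomm : Commute ρ H) (hfix : IsFixedState hH β α t ρfix) :
    traceNorm (ρfix -
      (avgChannel H β α t)^[numSteps hH 5 1 ε (rescaledGap hH β α t)] ρ) ≤
      2000 * ε * polylog 1 (stepScale hH ε (rescaledGap hH β α t)) := by
  have h := specNorm_pos hH hinj hd
  have hδ := deltaMin_pos hH hinj hd
  obtain ⟨hlam, hX, hκ, herr, -, hXd⟩ := hset.scales hH hinj hd hε
  obtain ⟨hα0, ht0, -, -⟩ := hset
  obtain ⟨p, hp, hpsum, rfl⟩ := (isState_and_commute_iff hH hinj ρ).mp ⟨hρ, hcomm⟩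
  obtain ⟨q, hq, hqsum, rfl, hTq⟩ := (isFixedState_iff hH hinj β α t ρfix).mp hfix
  have hlamr := half_le_rescaledGap hH hinj hd β hα0.ne' ht0
  have hrlam := rescaledGap_le hH hinj hd β hα0.ne' ht0
  rw [avgChannel_iterate_eigDiag h, eigDiag_sub, traceNorm_eigDiag]
  set lam := rescaledGap hH β α t with hlamd
  set X := stepScale hH ε lam with hXdef
  set L := numSteps hH 5 1 ε lam with hL
  set M := avgChannelMatrix hH β α t with hMd
  set T := avgTransitionMatrix hH β α t with hTd
  set κ := rateScale H α t with hκd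
  set r := sincMass (deltaMin hH * t / 2) with hr
  have hMnn := avgChannelMatrix_nonneg hH β α t
  have hMsum := sum_avgChannelMatrix h hH β α t
  have hlog := half_le_log_two_add hX.le
  obtain ⟨hw0, hw1⟩ := iterate_mulVec_mem hMnn hMsum hp hpsum L
  have hd2 : (2 : ℝ) ≤ d := by exact_mod_cast hd
  have hd0 : (0 : ℝ) < d := by linarith
  rw [polylog, pow_one]
  -- For `ε ≥ 1/4` the trivial bound `2` suffices, as `log (2 + X) ≥ 1/2`.
  rcases le_or_gt (1 / 4) ε with hε4 | hε4
  · refine (sum_abs_sub_le_two hq hw0 hqsum hw1).trans ?_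
    nlinarith
  have hκ0 : 0 < κ := rateScale_pos h hα0.ne' ht0
  have hr0 : 0 < r := resonance_pos hH hinj hd ht0
  have hκlam : κ * lam * (2 * X * (2 * d + 1)) = d ^ 2 := by
    have h1 : κ * (2 * specNorm H * (2 * d + 1)) = α ^ 2 * t := by
      rw [hκd, rateScale]; field_simp
    rw [← h1] at hκ
    refine mul_right_cancel₀ h.ne' ?_
    rw [← hκ]
    ring
  obtain ⟨hc, hout, hX16, hXε⟩ :=
    rate_bounds_of_scales hd2 hκ0 hlam hr0 hX hε hε4 hκlam hlamr hrlam hXd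
  obtain ⟨g, hg⟩ := exists_ground hH hd
  have hc2 : 1 / (5 * X) ≤ 1 / 2 := one_div_le_one_div_of_le (by norm_num) (by linarith)
  obtain ⟨hK0, hK1, hKg⟩ := one_add_avgTransitionMatrix_stochastic hH hinj hd β hg hc2 hc hout
  have hKM : ∀ v : Fin d → ℝ, ∑ i, |(M *ᵥ v - (1 + T) *ᵥ v : Fin d → ℝ) i| ≤
      channelError hH α t * ∑ i, |v i| := by
    intro v
    have h1 := sum_abs_channel_step_sub_le hH hinj hd β hα0.le ht0.le v
    rwa [sub_sub, show v + avgTransitionMatrix hH β α t *ᵥ v = (1 + T) *ᵥ v by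
      rw [Matrix.add_mulVec, Matrix.one_mulVec]] at h1
  have hKq : (1 + T) *ᵥ q = q := by
    rw [Matrix.add_mulVec, Matrix.one_mulVec, hTq, add_zero]
  have hbound := sum_abs_iterate_sub_le (by positivity) (by linarith) g hK0 hK1 hKg hMnn hMsum
    hKM hp hpsum hqsum hq hKq L
  have h1 : ∑ i, |(q - (fun v => M *ᵥ v)^[L] p) i| =
      ∑ i, |((fun v => M *ᵥ v)^[L] p - q) i| :=
    Finset.sum_congr rfl fun i _ => by rw [Pi.sub_apply, Pi.sub_apply, abs_sub_comm]
  rw [h1]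
  refine hbound.trans ?_
  have h2 : channelError hH α t / (1 / (5 * X)) ≤ 200 * ε := by
    have hs : √(Real.pi / 2) ≤ 2 := by
      rw [Real.sqrt_le_left (by norm_num)]
      linarith [Real.pi_le_four]
    rw [herr, show ε * (8 + 16 * √(Real.pi / 2)) / X / (1 / (5 * X)) =
      5 * ε * (8 + 16 * √(Real.pi / 2)) by field_simp]
    nlinarith
  have h3 : (1 - 1 / (5 * X)) ^ L ≤ 1 / X := by
    refine one_sub_pow_le_one_div (by linarith) ?_
    have := Nat.le_ceil (5 * X * polylog 1 X)
    rw [polylog, pow_one] at this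
    rw [hL, numSteps, ← hXdef, polylog, pow_one]
    exact this
  nlinarith

theorem numSteps_le (hH : H.IsHermitian) (hinj : Function.Injective hH.eigenvalues)
    (hd : 2 ≤ d) {β : ℝ≥0∞} {ε α t : ℝ} (hε : 0 < ε) (hε2 : ε ≤ 2)
    (hset : IsParameterSetting hH β ε α t) :
    (numSteps hH 5 1 ε (rescaledGap hH β α t) : ℝ) ≤
      2000 * stepScale hH ε (rescaledGap hH β α t) *
        polylog 1 (stepScale hH ε (rescaledGap hH β α t)) := by
  obtain ⟨-, hX, -, -, -, hXd⟩ := hset.scales hH hinj hd hε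
  have hd2 : (2 : ℝ) ≤ d := by exact_mod_cast hd
  have hlog := half_le_log_two_add hX.le
  unfold numSteps
  set X := stepScale hH ε (rescaledGap hH β α t) with hXdef
  rw [polylog, pow_one]
  have h1 : 1 ≤ 512 * X := by
    have h2 : (2 : ℝ) ^ 8 ≤ d ^ 8 := pow_le_pow_left₀ (by norm_num) hd2 8
    have h3 : ε ^ 5 ≤ 2 ^ 5 := pow_le_pow_left₀ hε.le hε2 5
    nlinarith
  have h4 := Nat.ceil_lt_add_one (a := 5 * X * Real.log (2 + X)) (by positivity)
  nlinarith

end Parameters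

/-! ### Zero temperature -/

section GroundState

variable {d : ℕ} {H : Matrix (Fin d) (Fin d) ℂ}

/-- At zero temperature there are no transitions out of the ground state. -/
theorem rescaledMatrix_top_ground (hH : H.IsHermitian) (hinj : Function.Injective hH.eigenvalues)
    (hd : 2 ≤ d) {g : Fin d} (hg : ∀ j, hH.eigenvalues g ≤ hH.eigenvalues j) {α t : ℝ}
    (hα : α ≠ 0) (ht : 0 < t) (j : Fin d) : rescaledMatrix hH ⊤ α t j g = 0 := by
  have h := specNorm_pos hH hinj hd
  have hoff : ∀ j, j ≠ g → rescaledMatrix hH ⊤ α t j g = 0 := by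
    intro j hj
    rw [rescaledMatrix_of_ne hH ⊤ α t hj,
      avgRate_top_up hH hinj α t (gapS_pos_of_ground hH hinj hg hj), mul_zero]
  rcases eq_or_ne j g with rfl | hj
  · have h1 := (isGenerator_rescaledMatrix h hH ⊤ hα ht).colSum j
    rwa [← Finset.add_sum_erase _ _ (Finset.mem_univ j), Finset.sum_eq_zero fun i hi =>
      hoff i (Finset.ne_of_mem_erase hi), add_zero] at h1
  · exact hoff j hj

theorem rescaledMatrix_mulVec_eq_zero_iff (h : 0 < specNorm H) (hH : H.IsHermitian) (β : ℝ≥0∞)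
    {α t : ℝ} (hα : α ≠ 0) (ht : 0 < t) (p : Fin d → ℝ) :
    rescaledMatrix hH β α t *ᵥ p = 0 ↔ avgTransitionMatrix hH β α t *ᵥ p = 0 := by
  rw [rescaledMatrix, Matrix.smul_mulVec, smul_eq_zero_iff_right
    (inv_ne_zero (rateScale_pos h hα ht).ne')]

theorem isFixedState_top_ground (hH : H.IsHermitian) (hinj : Function.Injective hH.eigenvalues)
    (hd : 2 ≤ d) {g : Fin d} (hg : ∀ j, hH.eigenvalues g ≤ hH.eigenvalues j) {α t : ℝ}
    (hα : α ≠ 0) (ht : 0 < t) : IsFixedState hH ⊤ α t (eigenProj hH g) := by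
  rw [isFixedState_iff hH hinj]
  refine ⟨Pi.single g 1, fun i => ?_, by simp, eigenProj_eq hH g, ?_⟩
  · rw [Pi.single_apply]
    split_ifs <;> norm_num
  · rw [← rescaledMatrix_mulVec_eq_zero_iff (specNorm_pos hH hinj hd) hH ⊤ hα ht,
      Matrix.mulVec_single_one]
    funext j
    exact rescaledMatrix_top_ground hH hinj hd hg hα ht j

/-- At zero temperature every level decays to the ground state at the maximal rate `r`, so the gap
is at least `r`; the first excited state decays only to the ground state, which gives the
eigenvalue `-r`. -/
theorem rescaledGap_top (hH : H.IsHermitian) (hinj : Function.Injective hH.eigenvalues)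
    (hd : 2 ≤ d) {α t : ℝ} (hα : α ≠ 0) (ht : 0 < t) :
    rescaledGap hH ⊤ α t = sincMass (deltaMin hH * t / 2) := by
  have h := specNorm_pos hH hinj hd
  have hκ := rateScale_pos h hα ht
  have hr := resonance_pos hH hinj hd ht
  obtain ⟨g, hg⟩ := exists_ground hH hd
  set r := sincMass (deltaMin hH * t / 2) with hrd
  set Q := rescaledMatrix hH ⊤ α t with hQ
  have hgen : IsGenerator Q := isGenerator_rescaledMatrix h hH ⊤ hα ht
  have hdown : ∀ j, j ≠ g → Q g j = r := by
    intro j hj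
    rw [hQ, rescaledMatrix_of_ne hH ⊤ α t hj.symm,
      avgRate_top_down hH hinj hd α t (gapS_pos_of_ground hH hinj hg hj),
      inv_mul_cancel_left₀ hκ.ne']
  rw [rescaledGap_eq, ← hQ]
  refine le_antisymm ?_ (hgen.le_spectralGap hr (fun j hj => (hdown j hj).ge) (by simpa using hd))
  have hne : (Finset.univ.erase g).Nonempty := by
    rw [← Finset.card_pos, Finset.card_erase_of_mem (Finset.mem_univ g), Finset.card_fin]
    omega
  -- the first excited state
  obtain ⟨f, hf, hfmin⟩ := Finset.exists_min_image _ hH.eigenvalues hne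
  have hfg : f ≠ g := Finset.ne_of_mem_erase hf
  have hzero : ∀ j, j ≠ g → j ≠ f → Q j f = 0 := by
    intro j hjg hjf
    have h1 : 0 < gapS hH j f := sub_pos.mpr (lt_of_le_of_ne
      (hfmin j (Finset.mem_erase.mpr ⟨hjg, Finset.mem_univ j⟩)) fun h => hjf (hinj h.symm))
    rw [hQ, rescaledMatrix_of_ne hH ⊤ α t hjf, avgRate_top_up hH hinj α t h1, mul_zero]
  have hff : Q f f = -r := by
    have h1 := hgen.colSum f
    rw [← Finset.add_sum_erase _ _ (Finset.mem_univ f), Finset.sum_eq_single g] at h1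
    · rw [hdown f hfg] at h1
      linarith
    · intro j hj hjg
      exact hzero j hjg (Finset.ne_of_mem_erase hj)
    · intro hj
      exact absurd (Finset.mem_erase.mpr ⟨hfg.symm, Finset.mem_univ g⟩) hj
  refine spectralGap_le_of_mulVec_eq (v := Pi.single f 1 - Pi.single g 1) ?_ hr.ne' ?_
  · intro h0
    have h1 := congrFun h0 f
    simp [hfg] at h1
  · funext j
    rw [Matrix.mulVec_sub, Matrix.mulVec_single_one, Matrix.mulVec_single_one]
    simp only [Pi.sub_apply, Pi.smul_apply, Matrix.col_apply, smul_eq_mul]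
    rw [show Q j g = 0 from rescaledMatrix_top_ground hH hinj hd hg hα ht j]
    rcases eq_or_ne j f with rfl | hjf
    · simp [hff, hfg]
    · rcases eq_or_ne j g with rfl | hjg
      · simp [hdown f hfg, hfg.symm]
      · simp [hzero j hjg hjf, hjf, hjg]

theorem tendsto_rescaledGap_atTop (hH : H.IsHermitian)
    (hinj : Function.Injective hH.eigenvalues) (hd : 2 ≤ d) {α t : ℝ} (hα : α ≠ 0) (ht : 0 < t) :
    Tendsto (fun β : ℝ≥0 => rescaledGap hH β α t) atTop
      (𝓝 (sincMass (deltaMin hH * t / 2))) := by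
  rw [← rescaledGap_top hH hinj hd hα ht]
  exact tendsto_rescaledGap (s := fun _ => t) hH hinj hd hα ht
    (tendsto_rescaledMatrix_atTop (specNorm_pos hH hinj hd) hH hα ht)

/-- The population of an excited level is bounded by the rate out of the ground state, by balance
of the flows into and out of the ground state. -/
theorem excited_population_le (hH : H.IsHermitian) (hinj : Function.Injective hH.eigenvalues)
    (hd : 2 ≤ d) (β : ℝ≥0∞) {g : Fin d} (hg : ∀ j, hH.eigenvalues g ≤ hH.eigenvalues j) {α t : ℝ}
    (hα : α ≠ 0) (ht : 0 < t) {p : Fin d → ℝ} (hp : ∀ i, 0 ≤ p i) (hpsum : ∑ i, p i = 1)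
    (hTp : avgTransitionMatrix hH β α t *ᵥ p = 0) {i : Fin d} (hi : i ≠ g) :
    p i ≤ -rescaledMatrix hH β α t g g / (sincMass (deltaMin hH * t / 2) / 2) := by
  have h := specNorm_pos hH hinj hd
  have hr := resonance_pos hH hinj hd ht
  set Q := rescaledMatrix hH β α t with hQ
  have hgen : IsGenerator Q := isGenerator_rescaledMatrix h hH β hα ht
  have h1 : ∑ k, Q g k * p k = 0 :=
    congrFun ((rescaledMatrix_mulVec_eq_zero_iff h hH β hα ht p).mpr hTp) g
  rw [← Finset.add_sum_erase _ _ (Finset.mem_univ g)] at h1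
  have h2 : Q g i * p i ≤ ∑ k ∈ Finset.univ.erase g, Q g k * p k :=
    Finset.single_le_sum (f := fun k => Q g k * p k) (fun k hk =>
      mul_nonneg (hgen.nonneg _ _ (Finset.ne_of_mem_erase hk).symm) (hp k))
      (Finset.mem_erase.mpr ⟨hi, Finset.mem_univ i⟩)
  have h3 : sincMass (deltaMin hH * t / 2) / 2 * p i ≤ Q g i * p i :=
    mul_le_mul_of_nonneg_right
      (half_le_rescaledMatrix_ground hH hinj hd β hα ht hg hi) (hp i)
  have h4 : Q g g ≤ 0 := by
    have h5 := hgen.colSum g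
    rw [← Finset.add_sum_erase _ _ (Finset.mem_univ g)] at h5
    have h6 : 0 ≤ ∑ k ∈ Finset.univ.erase g, Q k g := Finset.sum_nonneg fun k hk =>
      hgen.nonneg _ _ (Finset.ne_of_mem_erase hk)
    linarith
  have h7 : p g ≤ 1 := by
    rw [← hpsum]
    exact Finset.single_le_sum (fun k _ => hp k) (Finset.mem_univ g)
  rw [le_div_iff₀ (by positivity)]
  nlinarith

theorem continuous_eigDiag (hH : H.IsHermitian) : Continuous (eigDiag hH) := by
  unfold eigDiag
  refine Continuous.matrix_mul (Continuous.matrix_mul continuous_const ?_) continuous_const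
  exact Continuous.matrix_diagonal (by fun_prop)

theorem tendsto_fixedState_ground (hH : H.IsHermitian)
    (hinj : Function.Injective hH.eigenvalues) (hd : 2 ≤ d) {g : Fin d}
    (hg : ∀ j, hH.eigenvalues g ≤ hH.eigenvalues j) {α t : ℝ} (hα : α ≠ 0) (ht : 0 < t)
    {ρfix : ℝ≥0 → Matrix (Fin d) (Fin d) ℂ} (hfix : ∀ β : ℝ≥0, IsFixedState hH β α t (ρfix β)) :
    Tendsto ρfix atTop (𝓝 (eigenProj hH g)) := by
  have h := specNorm_pos hH hinj hd
  choose p hp hpsum hρ hTp using fun β : ℝ≥0 => (isFixedState_iff hH hinj β α t _).mp (hfix β)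
  have hexc : ∀ i, i ≠ g → Tendsto (fun β => p β i) atTop (𝓝 0) := by
    intro i hi
    have h1 : Tendsto (fun β : ℝ≥0 => -rescaledMatrix hH β α t g g /
        (sincMass (deltaMin hH * t / 2) / 2)) atTop (𝓝 0) := by
      have h2 := tendsto_pi_nhds.mp (tendsto_pi_nhds.mp
        (tendsto_rescaledMatrix_atTop h hH hα ht) g) g
      rw [rescaledMatrix_top_ground hH hinj hd hg hα ht g] at h2
      simpa using h2.neg.div_const (sincMass (deltaMin hH * t / 2) / 2)
    exact squeeze_zero (fun β => hp β i) (fun β =>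
      excited_population_le hH hinj hd β hg hα ht (hp β) (hpsum β) (hTp β) hi) h1
  have hpop : Tendsto p atTop (𝓝 (Pi.single g 1)) := by
    refine tendsto_pi_nhds.mpr fun i => ?_
    rcases eq_or_ne i g with rfl | hi
    · have h1 : ∀ β, p β i = 1 - ∑ k ∈ Finset.univ.erase i, p β k := by
        intro β
        rw [← hpsum β, ← Finset.add_sum_erase _ _ (Finset.mem_univ i)]
        ring
      have h2 : Tendsto (fun β => ∑ k ∈ Finset.univ.erase i, p β k) atTop (𝓝 0) := by
        have := tendsto_finsetSum (Finset.univ.erase i) fun k hk =>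
          hexc k (Finset.ne_of_mem_erase hk)
        simpa using this
      simp_rw [h1]
      simpa using tendsto_const_nhds.sub h2
    · simpa [hi] using hexc i hi
  rw [eigenProj_eq, show ρfix = fun β => eigDiag hH (p β) from funext hρ]
  exact ((continuous_eigDiag hH).tendsto _).comp hpop

end GroundState

end ThermalPrep

theorem mainTheorem1 :
    -- the constants hidden in the soft-O notation are universal
    ∃ C₁ C₂ : ℝ, ∃ k : ℕ, 0 < C₁ ∧ 0 < C₂ ∧
    ∀ (d : ℕ), 2 ≤ d →
    ∀ (H : Matrix (Fin d) (Fin d) ℂ) (hH : H.IsHermitian), Function.Injective hH.eigenvalues →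
      -- existence and uniqueness of the fixed point of the transition dynamics
      (∀ (β : ℝ≥0∞) (α t : ℝ), 0 < α → 0 < t →
        ∃! ρ : Matrix (Fin d) (Fin d) ℂ, IsFixedState hH β α t ρ) ∧
      -- the thermal state is an approximate fixed point at finite temperature
      (∀ (β : ℝ≥0) (α t : ℝ), 0 ≤ α → 0 ≤ t →
        traceNorm (gibbsState H β - avgChannel H β α t (gibbsState H β)) ≤
          α ^ 2 * t * Real.exp (β * deltaMin hH) * (specNorm H)⁻¹ * Real.pi +
            8 * (α ^ 2 / deltaMin hH ^ 2) +
            16 * √(Real.pi / 2) * d * (α * t) ^ 3) ∧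
      -- parameter settings and total simulation time
      (∀ (β : ℝ≥0∞) (ε : ℝ), 0 < ε → ε ≤ 2 →
        (∃ α t : ℝ, IsParameterSetting hH β ε α t) ∧
        ∀ α t : ℝ, IsParameterSetting hH β ε α t →
          (∀ ρ ρfix : Matrix (Fin d) (Fin d) ℂ, IsState ρ → Commute ρ H →
            IsFixedState hH β α t ρfix →
            traceNorm (ρfix -
                (avgChannel H β α t)^[numSteps hH C₁ k ε (rescaledGap hH β α t)] ρ) ≤
              C₂ * ε * polylog k (stepScale hH ε (rescaledGap hH β α t))) ∧
          (numSteps hH C₁ k ε (rescaledGap hH β α t) : ℝ) ≤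
            C₂ * stepScale hH ε (rescaledGap hH β α t) *
              polylog k (stepScale hH ε (rescaledGap hH β α t)) ∧
          (numSteps hH C₁ k ε (rescaledGap hH β α t) : ℝ) * t ≤
            C₂ * timeScale hH ε (rescaledGap hH β α t) *
              polylog k (stepScale hH ε (rescaledGap hH β α t))) ∧
      -- the ground state limit
      (∀ g : Fin d, (∀ j, hH.eigenvalues g ≤ hH.eigenvalues j) →
        ∀ α t : ℝ, 0 < α → 0 < t →
          IsFixedState hH ⊤ α t (eigenProj hH g) ∧
          (∀ ρfix : ℝ≥0 → Matrix (Fin d) (Fin d) ℂ,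
            (∀ β : ℝ≥0, IsFixedState hH β α t (ρfix β)) →
            Tendsto ρfix atTop (𝓝 (eigenProj hH g))) ∧
          Tendsto (fun β : ℝ≥0 => rescaledGap hH β α t) atTop
            (𝓝 (2 * ∫ u in (0 : ℝ)..(deltaMin hH * t / 2), Real.sinc u ^ 2)) ∧
          rescaledGap hH ⊤ α t = 2 * ∫ u in (0 : ℝ)..(deltaMin hH * t / 2), Real.sinc u ^ 2 ∧
          (Real.pi ≤ deltaMin hH * t →
            2.43 ≤ 2 * ∫ u in (0 : ℝ)..(deltaMin hH * t / 2), Real.sinc u ^ 2) ∧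
          (∀ ε : ℝ, 0 < ε → ε ≤ 2 → t = 4 * d ^ 2 * specNorm H / (ε * deltaMin hH ^ 2) →
            2.43 ≤ 2 * ∫ u in (0 : ℝ)..(deltaMin hH * t / 2), Real.sinc u ^ 2)) := by
  refine ⟨5, 2000, 1, by norm_num, by norm_num, fun d hd H hH hinj => ?_⟩
  have hn := specNorm_pos hH hinj hd
  have hδ := deltaMin_pos hH hinj hd
  refine ⟨fun β α t hα ht => existsUnique_isFixedState hH hinj hd β hα.ne' ht,
    fun β α t hα ht => ?_, fun β ε hε hε2 => ⟨exists_isParameterSetting hH hinj hd β hε,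
      fun α t hset => ⟨fun ρ ρfix hρ hcomm hfix =>
        traceNorm_iterate_le hH hinj hd hε hset hρ hcomm hfix,
        numSteps_le hH hinj hd hε hε2 hset, ?_⟩⟩, fun g hg α t hα ht =>
    ⟨isFixedState_top_ground hH hinj hd hg hα.ne' ht,
      fun ρfix hfix => tendsto_fixedState_ground hH hinj hd hg hα.ne' ht hfix,
      tendsto_rescaledGap_atTop hH hinj hd hα.ne' ht, rescaledGap_top hH hinj hd hα.ne' ht,
      fun h => le_sincMass_of_pi_div_two_le (by linarith), fun ε hε hε2 h =>
        le_sincMass_of_pi_div_two_le ?_⟩⟩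
  · have h1 := traceNorm_gibbsState_sub_le hH hinj hd β hα ht
    unfold channelError at h1
    linarith
  · obtain ⟨-, -, -, -, hXt, -⟩ := hset.scales hH hinj hd hε
    have h1 := mul_le_mul_of_nonneg_right (numSteps_le hH hinj hd hε hε2 hset) hset.2.1.le
    refine h1.trans (le_of_eq ?_)
    rw [← hXt]
    ring
  · -- as `δ_min ≤ 2‖H_S‖`, `ε ≤ 2` and `d ≥ 2`, the argument is at least `2`
    have hδ2 := deltaMin_le_two_mul_specNorm hH hinj hd
    have hd2 : (2 : ℝ) ≤ d := by exact_mod_cast hd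
    have h1 : deltaMin hH * t / 2 = 2 * d ^ 2 * specNorm H / (ε * deltaMin hH) := by
      rw [h]
      field_simp
      ring
    have h2 : 2 ≤ deltaMin hH * t / 2 := by
      rw [h1, le_div_iff₀ (by positivity)]
      have h3 : ε * deltaMin hH ≤ 2 * (2 * specNorm H) :=
        mul_le_mul hε2 hδ2 hδ.le (by norm_num)
      have h4 : (4 : ℝ) ≤ d ^ 2 := by nlinarith
      nlinarith
    linarith [Real.pi_le_four]
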